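/- All objects are germs at the origin of $\mathbb C^2$ with coordinates $(x,y)$. A germ of $n$-web $\mathcal W$ on $(\mathbb C^2,0)$ is given, up to multiplication by a holomorphic unit, by a germ of holomorphic $n$-symmetric $1$-form $\omega=\sum_{i+j=n}a_{ij}(x,y)\,dx^i dy^j$ with isolated zeros and with discriminant not identically zero; the divisor of this discriminant is denoted $\Delta(\mathcal W)$. The superposition $\mathcal W\boxtimes\mathcal W'$ is defined by the product of the defining forms. *Curvature.* Near a point outside $\Delta(\mathcal W)$ the web is a superposition of $n$ foliations $[\omega_1],\dots,[\omega_n]$, with $\omega_i$ holomorphic $1$-forms. Write $\omega_i\wedge\omega_j=\delta_{ij}\,dx\wedge dy$, and for $r<s<t$ let $\eta_{rst}$ be the unique $1$-form with $d(\delta_{ij}\omega_l)=\eta_{rst}\wedge\delta_{ij}\omega_l$ for the three cyclic permutations $(i,j,l)$ of $(r,s,t)$. The curvature is $K(\mathcal W)=\sum_{r<s<t}d\eta_{rst}$; it does not depend on the choices, so these local $2$-forms define $K(\mathcal W)$ on the complement of $\Delta(\mathcal W)$. It is holomorphic along $\Delta(\mathcal W)$ if it extends to a germ of holomorphic $2$-form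 at $0$. *Barycenter.* At a point $p$, the tangent lines of a $k$-web $\mathcal W_k$ transverse to a line $\ell\subset T_p\mathbb C^2$ are $k$ points of the affine line $\mathbb P(T_p\mathbb C^2)\setminus\{\ell\}$; their barycenter is a line $\beta_\ell(\mathcal W_k)$ (set $\beta_\ell(\mathcal W_k)=\ell$ if $\ell$ is not transverse to $\mathcal W_k$). For a $2$-web $\mathcal W_2$, the barycenter $\beta_{\mathcal W_2}(\mathcal W_k)$ is the field which associates to $p$ the lines $\beta_\ell(\mathcal W_k)$, $\ell$ running through the tangent lines of $\mathcal W_2$ at $p$. A smooth curve $C$ is invariant by such a field of lines if at each $p\in C$ its tangent line $T_pC$ is one of the lines of the field. **Theorem.** Let $k\ge 1$, and let $\mathcal W=\mathcal W_2\boxtimes\mathcal W_k$ be a germ of $(k+2)$-web on $(\mathbb C^2,0)$, where $\mathcal W_2$ is a $2$-web and $\mathcal W_k$ is a $k$-web. Suppose that the discriminant of $\mathcal W$ is non-empty and smooth but not necessarily reduced, that is $\Delta(\mathcal W)=m\,C$ with $m\ge 1$ and $C$ a germ of smooth curve through $0$, and that $\Delta(\mathcal W_2)=\Delta(\mathcal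 W)$ as divisors. Then the curvature of $\mathcal W$ is holomorphic along $\Delta(\mathcal W)$ if and only if $C$ is invariant by $\mathcal W_2$ or by the barycenter $\beta_{\mathcal W_2}(\mathcal W_k)$. -/

import Mathlib

open Filter Topology

namespace Webs

noncomputable section

/-- A function of the two coordinates `(x, y)` on `ℂ²`; its germ at `0` is what matters. -/
abbrev Fn : Type := ℂ × ℂ → ℂ

/-- A homogeneous element of degree `n` stands for an `n`-symmetric form on the tangent space `ℂ²`:
the variable `X 0` is `dx` and the variable `X 1` is `dy`. -/
abbrev Form : Type := MvPolynomial (Fin 2) ℂ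

/-- The value of a symmetric form on a tangent vector. -/
def ev (F : Form) (v : ℂ × ℂ) : ℂ := MvPolynomial.eval ![v.1, v.2] F

/-- Putting `dx = 1`, `dy = z`. -/
def dehom (F : Form) : Polynomial ℂ := MvPolynomial.aeval ![1, Polynomial.X] F

/-- The discriminant of a binary form of degree `n`, as the homogeneous resultant (formal degrees
`n - 1`) of its two partial derivatives. For `n ≥ 1` it agrees with any other normalization of the
discriminant up to a nonzero constant factor. -/
def disc (n : ℕ) (F : Form) : ℂ :=
  Polynomial.resultant (dehom (MvPolynomial.pderiv 0 F)) (dehom (MvPolynomial.pderiv 1 F))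
    (n - 1) (n - 1)

/-- `ω` defines a germ of `n`-web on `(ℂ², 0)`: it is a germ of holomorphic `n`-symmetric `1`-form
with isolated zeros and with discriminant not identically zero. -/
structure IsWeb (n : ℕ) (ω : ℂ × ℂ → Form) : Prop where
  homogeneous : ∀ᶠ p in 𝓝 (0 : ℂ × ℂ), (ω p).IsHomogeneous n
  analytic : ∀ m, AnalyticAt ℂ (fun p => (ω p).coeff m) 0
  isolated_zeros : ∀ᶠ p in 𝓝[≠] (0 : ℂ × ℂ), ω p ≠ 0
  disc_ne_zero : ∃ᶠ p in 𝓝 (0 : ℂ × ℂ), disc n (ω p) ≠ 0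

/-- Two germs of symmetric forms define the same web: they differ by a holomorphic unit. -/
def SameWeb (ω ω' : ℂ × ℂ → Form) : Prop :=
  ∃ u : Fn, AnalyticAt ℂ u 0 ∧ u 0 ≠ 0 ∧
    ∀ᶠ p in 𝓝 (0 : ℂ × ℂ), ω p = MvPolynomial.C (u p) * ω' p

/-- The superposition `𝒲 ⊠ 𝒲'`, defined by the product of the defining forms. -/
def superpose (ω ω' : ℂ × ℂ → Form) : ℂ × ℂ → Form := fun p => ω p * ω' p

/-- A defining function of the discriminant divisor `Δ(𝒲)`. -/
def discFn (n : ℕ) (ω : ℂ × ℂ → Form) : Fn := fun p => disc n (ω p)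

/-- Two germs of functions have the same divisor: they differ by a holomorphic unit. -/
def SameDivisor (g h : Fn) : Prop :=
  ∃ u : Fn, AnalyticAt ℂ u 0 ∧ u 0 ≠ 0 ∧ ∀ᶠ p in 𝓝 (0 : ℂ × ℂ), g p = u p * h p

/-- `f` is a reduced equation of a germ of smooth curve `C = {f = 0}` through the origin. -/
structure IsSmoothCurve (f : Fn) : Prop where
  analytic : AnalyticAt ℂ f 0
  zero : f 0 = 0
  fderiv_ne_zero : fderiv ℂ f 0 ≠ 0

/-- The union of the tangent lines at `p` of the web defined by `ω`. -/
def tangentLines (ω : ℂ × ℂ → Form) (p : ℂ × ℂ) : Set (ℂ × ℂ) := {w | ev (ω p) w = 0}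

/-- The curve `{f = 0}` is invariant by a (possibly multivalued) field of lines `T`: its tangent
line at each of its points is contained in the union of the lines of `T` at that point. -/
def Invariant (f : Fn) (T : ℂ × ℂ → Set (ℂ × ℂ)) : Prop :=
  ∀ᶠ p in 𝓝 (0 : ℂ × ℂ), f p = 0 → ∀ v : ℂ × ℂ, fderiv ℂ f p v = 0 → v ∈ T p

/-- The barycenter, with respect to the line spanned by `v ≠ 0`, of the `k` lines on which the
binary form `G` of degree `k` vanishes. If `G v ≠ 0`, then for `e` independent of `v` the
lines different from that of `v` are spanned by the vectors `e + t • v`, with `t` an affine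
coordinate; the `k` lines have coordinates `t 1, …, t k`, and their barycenter is the line whose
coordinate is the mean. If `G v = 0` (no transversality), it is the line spanned by `v`. -/
def barycenterLine (k : ℕ) (G : Form) (v : ℂ × ℂ) : Set (ℂ × ℂ) :=
  {w | (ev G v = 0 ∧ ∃ c : ℂ, w = c • v) ∨
    (ev G v ≠ 0 ∧ ∃ (e : ℂ × ℂ) (a : ℂ) (t : Fin k → ℂ),
      v.1 * e.2 - v.2 * e.1 ≠ 0 ∧
      (∀ z : ℂ, ev G (e + z • v) = a * ∏ i, (z - t i)) ∧
      ∃ c : ℂ, w = c • (e + ((∑ i, t i) / (k : ℂ)) • v))}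

/-- The union of the tangent lines at `p` of the barycenter `β_{𝒲'}(𝒲)` of the `k`-web `𝒲` defined
by `ω` with respect to the web `𝒲'` defined by `ω'`: the superposition of the barycenters of `𝒲`
with respect to the tangent lines of `𝒲'` at `p`. -/
def barycenter (k : ℕ) (ω' ω : ℂ × ℂ → Form) (p : ℂ × ℂ) : Set (ℂ × ℂ) :=
  {w | ∃ v : ℂ × ℂ, v ≠ 0 ∧ v ∈ tangentLines ω' p ∧ w ∈ barycenterLine k (ω p) v}

/-- The `1`-form `a dx + b dy`. -/
structure OneForm where
  a : Fn
  b : Fn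

/-- The partial derivative along `x`. -/
def dX (g : Fn) : Fn := fun p => fderiv ℂ g p (1, 0)

/-- The partial derivative along `y`. -/
def dY (g : Fn) : Fn := fun p => fderiv ℂ g p (0, 1)

namespace OneForm

/-- The `1`-form is holomorphic near `p`. -/
def Holo (α : OneForm) (p : ℂ × ℂ) : Prop := AnalyticAt ℂ α.a p ∧ AnalyticAt ℂ α.b p

/-- The value at `p`, as a linear form in `dx`, `dy`. -/
def toForm (α : OneForm) (p : ℂ × ℂ) : Form :=
  MvPolynomial.C (α.a p) * MvPolynomial.X 0 + MvPolynomial.C (α.b p) * MvPolynomial.X 1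

/-- `g • α`. -/
def smul (g : Fn) (α : OneForm) : OneForm := ⟨g * α.a, g * α.b⟩

/-- The coefficient of `dx ∧ dy` in `α ∧ β`. -/
def wedge (α β : OneForm) : Fn := fun p => α.a p * β.b p - α.b p * β.a p

/-- The coefficient of `dx ∧ dy` in `dα`. -/
def d (α : OneForm) : Fn := fun p => dX α.b p - dY α.a p

end OneForm

/-- `η` is, near `p`, the `1`-form `η(ℱ₁ ⊠ ℱ₂ ⊠ ℱ₃)` attached to the `1`-forms `α₁, α₂, α₃` that
define `ℱ₁, ℱ₂, ℱ₃`: with `αᵢ ∧ αⱼ = δᵢⱼ dx ∧ dy` one has `d(δᵢⱼ αₗ) = η ∧ δᵢⱼ αₗ` for the cyclic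
permutations `(i, j, l)` of `(1, 2, 3)`. -/
structure IsEta (α₁ α₂ α₃ η : OneForm) (p : ℂ × ℂ) : Prop where
  holo : η.Holo p
  eq₁ : ∀ᶠ q in 𝓝 p, (OneForm.smul (OneForm.wedge α₂ α₃) α₁).d q =
    η.wedge (OneForm.smul (OneForm.wedge α₂ α₃) α₁) q
  eq₂ : ∀ᶠ q in 𝓝 p, (OneForm.smul (OneForm.wedge α₃ α₁) α₂).d q =
    η.wedge (OneForm.smul (OneForm.wedge α₃ α₁) α₂) q
  eq₃ : ∀ᶠ q in 𝓝 p, (OneForm.smul (OneForm.wedge α₁ α₂) α₃).d q =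
    η.wedge (OneForm.smul (OneForm.wedge α₁ α₂) α₃) q

/-- At a point `p` outside the discriminant, the curvature `K(𝒲)` of the `n`-web defined by `ω`
is `κ dx ∧ dy`. Near such a point the web is a superposition of `n` foliations `ℱ_r = [α_r]`
(`ω` is the product of the `α_r`, a unit being absorbed by one of them), and `K(𝒲)` is the
sum of the `dη(ℱ_r ⊠ ℱ_s ⊠ ℱ_t)` over `r < s < t`. -/
def CurvatureAt (n : ℕ) (ω : ℂ × ℂ → Form) (p : ℂ × ℂ) (κ : ℂ) : Prop :=
  ∃ α : Fin n → OneForm,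
    (∀ r, (α r).Holo p) ∧
    (∀ᶠ q in 𝓝 p, ω q = ∏ r, (α r).toForm q) ∧
    ∃ η : Fin n → Fin n → Fin n → OneForm,
      (∀ r s t, r < s → s < t → IsEta (α r) (α s) (α t) (η r s t) p) ∧
      κ = ∑ r, ∑ s ∈ Finset.Ioi r, ∑ t ∈ Finset.Ioi s, (η r s t).d p

/-- The curvature, a `2`-form defined outside the discriminant, is holomorphic along the
discriminant: it is the restriction of a germ of holomorphic `2`-form `g dx ∧ dy` at the origin. -/
def HolomorphicCurvature (n : ℕ) (ω : ℂ × ℂ → Form) : Prop :=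
  ∃ g : Fn, AnalyticAt ℂ g 0 ∧
    ∀ᶠ p in 𝓝 (0 : ℂ × ℂ), discFn n ω p ≠ 0 → CurvatureAt n ω p (g p)

end

end Webs

open Webs

open Filter Topology

namespace Webs

noncomputable section

/-! ### Partial derivatives of germs of analytic functions -/

section Calculus

variable {g h : Fn} {p : ℂ × ℂ}

/-! Up to a constant and units, the discriminant of a superposition is `Δ(𝒲₂) Δ(𝒲ₖ) Res(𝒲₂, 𝒲ₖ)²`.
Hence `Δ(𝒲₂) = Δ(𝒲)` forces `𝒲ₖ` to have distinct tangents at the origin, transverse to `𝒲₂`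
(`disc_ne_zero_of_sameDivisor`). So near the origin `𝒲ₖ` is a product of holomorphic forms `γᵢ`,
while `𝒲₂` is `A dx² + B dx dy + C dy²` with discriminant `D = U f^m`, `U` a unit; this is
`Setting`.

Off the curve, write `𝒲₂` as `b₀ b₁` and sort the 3-subwebs by the number of foliations they take
from `𝒲₂`. With none, the curvature is holomorphic. With one, the sum over `b₀` and `b₁` depends
only on the products `Nᵢ = (b₀ ∧ γᵢ)(b₁ ∧ γᵢ)`, which are values of the quadratic form and do not
vanish at the origin, so it is holomorphic too. With two, let `τᵢ` be the contraction of `𝒲₂` with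
the kernel of `γᵢ`; the curvature is `dh` with `h ∧ γᵢ = dγᵢ` and `h ∧ τᵢ = dτᵢ - ½ (dD/D) ∧ τᵢ`. As
`dD/D = dU/U + m df/f`, all that can be singular is `(m/4) d(Θ/f)`, where `Θ = ∑ᵢ ((df ∧ τᵢ)/Nᵢ) γᵢ`
is `residueForm`. This is `Setting.curvatureAt_iff`.

Since `d(Θ/f) = (f dΘ - df ∧ Θ)/f²`, holomorphy forces `df ∧ Θ = 0` on the curve. There `𝒲₂` is the
square of a linear form `l`, `τᵢ = 2 (l ∧ γᵢ) l` and `Nᵢ = (l ∧ γᵢ)²`, so that `df ∧ Θ = 2 (df ∧ l)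
∑ᵢ (df ∧ γᵢ)/(l ∧ γᵢ)`. The first factor vanishes when the curve is tangent to `𝒲₂`, the second when
it is tangent to the barycenter (`mem_barycenterLine_iff`). A smooth germ is irreducible, so one of
the two vanishes along the whole curve. Conversely, on the curve `Θ = 0` in the first case and `Θ =
-2k df` in the second; then `Θ/f` is a holomorphic form plus a constant multiple of the closed form
`df/f`, and `d(Θ/f)` is holomorphic. -/

theorem analyticAt_dX (hg : AnalyticAt ℂ g p) : AnalyticAt ℂ (dX g) p :=
  ((ContinuousLinearMap.apply ℂ ℂ ((1, 0) : ℂ × ℂ)).analyticAt _).comp hg.fderiv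

theorem analyticAt_dY (hg : AnalyticAt ℂ g p) : AnalyticAt ℂ (dY g) p :=
  ((ContinuousLinearMap.apply ℂ ℂ ((0, 1) : ℂ × ℂ)).analyticAt _).comp hg.fderiv

theorem dX_congr (H : g =ᶠ[𝓝 p] h) : dX g p = dX h p := by
  simp only [dX, H.fderiv_eq]

theorem dY_congr (H : g =ᶠ[𝓝 p] h) : dY g p = dY h p := by
  simp only [dY, H.fderiv_eq]

theorem dX_add (hg : AnalyticAt ℂ g p) (hh : AnalyticAt ℂ h p) :
    dX (fun q => g q + h q) p = dX g p + dX h p := by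
  simp only [dX]
  rw [fderiv_fun_add hg.differentiableAt hh.differentiableAt]; rfl

theorem dY_add (hg : AnalyticAt ℂ g p) (hh : AnalyticAt ℂ h p) :
    dY (fun q => g q + h q) p = dY g p + dY h p := by
  simp only [dY]
  rw [fderiv_fun_add hg.differentiableAt hh.differentiableAt]; rfl

theorem dX_mul (hg : AnalyticAt ℂ g p) (hh : AnalyticAt ℂ h p) :
    dX (fun q => g q * h q) p = dX g p * h p + g p * dX h p := by
  simp only [dX]
  rw [fderiv_fun_mul hg.differentiableAt hh.differentiableAt]
  simp; ring

theorem dY_mul (hg : AnalyticAt ℂ g p) (hh : AnalyticAt ℂ h p) :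
    dY (fun q => g q * h q) p = dY g p * h p + g p * dY h p := by
  simp only [dY]
  rw [fderiv_fun_mul hg.differentiableAt hh.differentiableAt]
  simp; ring

theorem dX_const (c : ℂ) : dX (fun _ => c) p = 0 := by simp [dX]

theorem dY_const (c : ℂ) : dY (fun _ => c) p = 0 := by simp [dY]

theorem dX_div (hg : AnalyticAt ℂ g p) (hh : AnalyticAt ℂ h p) (h0 : h p ≠ 0) :
    dX (fun q => g q / h q) p = (dX g p * h p - g p * dX h p) / h p ^ 2 := by
  have H : g =ᶠ[𝓝 p] fun q => (g q / h q) * h q := by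
    filter_upwards [hh.continuousAt.eventually_ne h0] with q hq
    field_simp
  have := dX_congr H
  rw [dX_mul (g := fun q => g q / h q) (hg.div hh h0) hh] at this
  rw [this]; field_simp; ring

theorem dY_div (hg : AnalyticAt ℂ g p) (hh : AnalyticAt ℂ h p) (h0 : h p ≠ 0) :
    dY (fun q => g q / h q) p = (dY g p * h p - g p * dY h p) / h p ^ 2 := by
  have H : g =ᶠ[𝓝 p] fun q => (g q / h q) * h q := by
    filter_upwards [hh.continuousAt.eventually_ne h0] with q hq
    field_simp
  have := dY_congr H
  rw [dY_mul (g := fun q => g q / h q) (hg.div hh h0) hh] at this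
  rw [this]; field_simp; ring

theorem dX_dY_comm (hg : AnalyticAt ℂ g p) : dX (dY g) p = dY (dX g) p := by
  have hs : IsSymmSndFDerivAt ℂ g p := by
    apply ContDiffAt.isSymmSndFDerivAt (n := ⊤) hg.contDiffAt
    simp
  have hd : DifferentiableAt ℂ (fderiv ℂ g) p := hg.fderiv.differentiableAt
  have key : ∀ v w : ℂ × ℂ, fderiv ℂ (fun q => fderiv ℂ g q v) p w
      = fderiv ℂ (fderiv ℂ g) p w v := by
    intro v w
    rw [fderiv_clm_apply hd (differentiableAt_const v)]
    simp
  show fderiv ℂ (fun q => fderiv ℂ g q (0, 1)) p (1, 0) =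
    fderiv ℂ (fun q => fderiv ℂ g q (1, 0)) p (0, 1)
  rw [key, key]
  exact hs (1, 0) (0, 1)

/-- The form `dg / g` is closed. -/
theorem dlog_closed (hg : AnalyticAt ℂ g p) (h0 : g p ≠ 0) :
    dX (fun q => dY g q / g q) p - dY (fun q => dX g q / g q) p = 0 := by
  rw [dX_div (analyticAt_dY hg) hg h0, dY_div (analyticAt_dX hg) hg h0, dX_dY_comm hg]
  ring

end Calculus

/-! ### Exterior calculus of 1-forms and Cramer's rule -/

namespace OneForm

variable {α β : OneForm} {g : Fn} {p : ℂ × ℂ}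

theorem Holo.smul (hg : AnalyticAt ℂ g p) (hα : α.Holo p) : (smul g α).Holo p :=
  ⟨hg.mul hα.1, hg.mul hα.2⟩

theorem Holo.wedge (hα : α.Holo p) (hβ : β.Holo p) : AnalyticAt ℂ (α.wedge β) p :=
  (hα.1.mul hβ.2).sub (hα.2.mul hβ.1)

theorem Holo.d (hα : α.Holo p) : AnalyticAt ℂ α.d p :=
  (analyticAt_dX hα.2).sub (analyticAt_dY hα.1)

theorem Holo.eventually (hα : α.Holo p) : ∀ᶠ q in 𝓝 p, α.Holo q :=
  hα.1.eventually_analyticAt.and hα.2.eventually_analyticAt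

theorem d_congr (ha : α.a =ᶠ[𝓝 p] β.a) (hb : α.b =ᶠ[𝓝 p] β.b) : α.d p = β.d p := by
  simp only [OneForm.d, dX_congr hb, dY_congr ha]

theorem d_smul (hg : AnalyticAt ℂ g p) (hα : α.Holo p) :
    (smul g α).d p = dX g p * α.b p - dY g p * α.a p + g p * α.d p := by
  have h1 : dX (g * α.b) p = _ := dX_mul hg hα.2
  have h2 : dY (g * α.a) p = _ := dY_mul hg hα.1
  simp only [OneForm.d, smul, h1, h2]; ring

/-- The sum of two `1`-forms. -/
def add (α β : OneForm) : OneForm := ⟨fun q => α.a q + β.a q, fun q => α.b q + β.b q⟩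

theorem Holo.add (hα : α.Holo p) (hβ : β.Holo p) : (add α β).Holo p :=
  ⟨hα.1.add hβ.1, hα.2.add hβ.2⟩

theorem d_add (hα : α.Holo p) (hβ : β.Holo p) : (add α β).d p = α.d p + β.d p := by
  simp only [OneForm.d, OneForm.add, dX_add hα.2 hβ.2, dY_add hα.1 hβ.1]; ring

/-- The form `dg`. -/
def ext (g : Fn) : OneForm := ⟨dX g, dY g⟩

theorem Holo.ext (hg : AnalyticAt ℂ g p) : (ext g).Holo p := ⟨analyticAt_dX hg, analyticAt_dY hg⟩

/-- The form `h` with `h ∧ α = a dx ∧ dy` and `h ∧ β = b dx ∧ dy`. -/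
def cramer (α β : OneForm) (a b : Fn) : OneForm :=
  ⟨fun q => (b q * α.a q - a q * β.a q) / α.wedge β q,
    fun q => (b q * α.b q - a q * β.b q) / α.wedge β q⟩

theorem Holo.cramer {a b : Fn} (hα : α.Holo p) (hβ : β.Holo p) (ha : AnalyticAt ℂ a p)
    (hb : AnalyticAt ℂ b p) (h : α.wedge β p ≠ 0) : (cramer α β a b).Holo p :=
  ⟨((hb.mul hα.1).sub (ha.mul hβ.1)).div (hα.wedge hβ) h,
    ((hb.mul hα.2).sub (ha.mul hβ.2)).div (hα.wedge hβ) h⟩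

theorem cramer_wedge_left {a b : Fn} (h : α.wedge β p ≠ 0) :
    (cramer α β a b).wedge α p = a p := by
  have : (cramer α β a b).wedge α p = a p * α.wedge β p / α.wedge β p := by
    simp only [cramer, OneForm.wedge]; ring
  rw [this, mul_div_cancel_right₀ _ h]

theorem cramer_wedge_right {a b : Fn} (h : α.wedge β p ≠ 0) :
    (cramer α β a b).wedge β p = b p := by
  have : (cramer α β a b).wedge β p = b p * α.wedge β p / α.wedge β p := by
    simp only [cramer, OneForm.wedge]; ring
  rw [this, mul_div_cancel_right₀ _ h]

/-- A `1`-form is determined by its wedge products with two independent `1`-forms. -/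
theorem eq_of_wedge_eq {x y : OneForm} {p : ℂ × ℂ} (h : α.wedge β p ≠ 0)
    (h1 : x.wedge α p = y.wedge α p) (h2 : x.wedge β p = y.wedge β p) :
    x.a p = y.a p ∧ x.b p = y.b p := by
  simp only [OneForm.wedge] at *
  constructor
  · apply mul_right_cancel₀ h; linear_combination (α.a p) * h2 - (β.a p) * h1
  · apply mul_right_cancel₀ h; linear_combination (α.b p) * h2 - (β.b p) * h1

end OneForm

/-! ### The curvature of a 3-web and its independence of choices -/

open OneForm

/-- After scaling by units, the three `1`-forms have sum `0` and `h` satisfies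
`d(uᵢ αᵢ) = h ∧ uᵢ αᵢ`. -/
structure IsConn (α₁ α₂ α₃ h : OneForm) (p : ℂ × ℂ) (u₁ u₂ u₃ : Fn) : Prop where
  holo : h.Holo p
  an₁ : AnalyticAt ℂ u₁ p
  an₂ : AnalyticAt ℂ u₂ p
  an₃ : AnalyticAt ℂ u₃ p
  ne₁ : u₁ p ≠ 0
  ne₂ : u₂ p ≠ 0
  ne₃ : u₃ p ≠ 0
  suma : ∀ᶠ q in 𝓝 p, u₁ q * α₁.a q + u₂ q * α₂.a q + u₃ q * α₃.a q = 0
  sumb : ∀ᶠ q in 𝓝 p, u₁ q * α₁.b q + u₂ q * α₂.b q + u₃ q * α₃.b q = 0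
  eq₁ : ∀ᶠ q in 𝓝 p, (smul u₁ α₁).d q = h.wedge (smul u₁ α₁) q
  eq₂ : ∀ᶠ q in 𝓝 p, (smul u₂ α₂).d q = h.wedge (smul u₂ α₂) q
  eq₃ : ∀ᶠ q in 𝓝 p, (smul u₃ α₃).d q = h.wedge (smul u₃ α₃) q

/-- Leaving the scaling factors free, instead of fixing them to be the wedge products, makes the
conditions symmetric in the three foliations with no signs to follow. -/
theorem IsConn.rotate {α₁ α₂ α₃ h : OneForm} {p : ℂ × ℂ} {u₁ u₂ u₃ : Fn}
    (H : IsConn α₁ α₂ α₃ h p u₁ u₂ u₃) : IsConn α₂ α₃ α₁ h p u₂ u₃ u₁ :=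
  ⟨H.holo, H.an₂, H.an₃, H.an₁, H.ne₂, H.ne₃, H.ne₁,
    H.suma.mono fun q hq => by linear_combination hq,
    H.sumb.mono fun q hq => by linear_combination hq, H.eq₂, H.eq₃, H.eq₁⟩

theorem IsConn.swap {α₁ α₂ α₃ h : OneForm} {p : ℂ × ℂ} {u₁ u₂ u₃ : Fn}
    (H : IsConn α₁ α₂ α₃ h p u₁ u₂ u₃) : IsConn α₂ α₁ α₃ h p u₂ u₁ u₃ :=
  ⟨H.holo, H.an₂, H.an₁, H.an₃, H.ne₂, H.ne₁, H.ne₃,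
    H.suma.mono fun q hq => by linear_combination hq,
    H.sumb.mono fun q hq => by linear_combination hq, H.eq₂, H.eq₁, H.eq₃⟩

/-- The third equation of `IsConn` follows from the first two. -/
theorem IsConn.of_two {α₁ α₂ α₃ h : OneForm} {p : ℂ × ℂ} {u₁ u₂ u₃ : Fn}
    (hα₁ : α₁.Holo p) (hα₂ : α₂.Holo p) (holo : h.Holo p)
    (an₁ : AnalyticAt ℂ u₁ p) (an₂ : AnalyticAt ℂ u₂ p) (an₃ : AnalyticAt ℂ u₃ p)
    (ne₁ : u₁ p ≠ 0) (ne₂ : u₂ p ≠ 0) (ne₃ : u₃ p ≠ 0)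
    (suma : ∀ᶠ q in 𝓝 p, u₁ q * α₁.a q + u₂ q * α₂.a q + u₃ q * α₃.a q = 0)
    (sumb : ∀ᶠ q in 𝓝 p, u₁ q * α₁.b q + u₂ q * α₂.b q + u₃ q * α₃.b q = 0)
    (eq₁ : ∀ᶠ q in 𝓝 p, (smul u₁ α₁).d q = h.wedge (smul u₁ α₁) q)
    (eq₂ : ∀ᶠ q in 𝓝 p, (smul u₂ α₂).d q = h.wedge (smul u₂ α₂) q) :
    IsConn α₁ α₂ α₃ h p u₁ u₂ u₃ := by
  refine ⟨holo, an₁, an₂, an₃, ne₁, ne₂, ne₃, suma, sumb, eq₁, eq₂, ?_⟩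
  filter_upwards [suma.eventually_nhds, sumb.eventually_nhds, eq₁, eq₂, hα₁.eventually,
    hα₂.eventually, an₁.eventually_analyticAt, an₂.eventually_analyticAt]
    with q ha hb h1 h2 H1 H2 A1 A2
  -- The relation makes `-u₃ α₃` equal to `u₁ α₁ + u₂ α₂` near `q`, so the third equation is minus
  -- the sum of the first two.
  have e1 : (smul (fun _ => -1) (smul u₃ α₃)).d q = ((smul u₁ α₁).add (smul u₂ α₂)).d q := by
    apply d_congr
    · filter_upwards [ha] with r hr
      simp [smul, OneForm.add]; linear_combination -hr
    · filter_upwards [hb] with r hr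
      simp [smul, OneForm.add]; linear_combination -hr
  have e2 : (smul (fun _ => -1) (smul u₃ α₃)).d q = -(smul u₃ α₃).d q := by
    have hX : ∀ g : Fn, dX ((fun _ => (-1 : ℂ)) * g) q = - dX g q := fun g => by
      have : ((fun _ => (-1 : ℂ)) * g) = fun r => - g r := by ext; simp
      rw [this]; simp [dX, fderiv_fun_neg]
    have hY : ∀ g : Fn, dY ((fun _ => (-1 : ℂ)) * g) q = - dY g q := fun g => by
      have : ((fun _ => (-1 : ℂ)) * g) = fun r => - g r := by ext; simp
      rw [this]; simp [dY, fderiv_fun_neg]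
    simp only [OneForm.d, smul, hX, hY]; ring
  rw [d_add (H1.smul A1) (H2.smul A2), h1, h2, e2] at e1
  have ha := ha.self_of_nhds
  have hb := hb.self_of_nhds
  simp only [OneForm.wedge, smul, Pi.mul_apply] at e1 ⊢
  linear_combination -e1 - (h.a q) * hb + (h.b q) * ha

/-- The linear relation between three pairwise independent forms in the plane is unique up to a
factor. Two scalings therefore differ by a common unit `ρ`, which changes `h` by the closed form
`dρ/ρ`. -/
theorem IsConn.d_eq {α₁ α₂ α₃ h h' : OneForm} {p : ℂ × ℂ} {u₁ u₂ u₃ u₁' u₂' u₃' : Fn}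
    (hα₁ : α₁.Holo p) (hα₂ : α₂.Holo p) (hα₃ : α₃.Holo p) (h12 : α₁.wedge α₂ p ≠ 0)
    (h23 : α₂.wedge α₃ p ≠ 0)
    (H : IsConn α₁ α₂ α₃ h p u₁ u₂ u₃) (H' : IsConn α₁ α₂ α₃ h' p u₁' u₂' u₃') :
    h'.d p = h.d p := by
  set ρ : Fn := fun q => u₁' q / u₁ q with hρ
  have hρan : AnalyticAt ℂ ρ p := H'.an₁.div H.an₁ H.ne₁
  have hρ0 : ρ p ≠ 0 := div_ne_zero H'.ne₁ H.ne₁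
  -- Wedging both relations with `α₃` eliminates the third coefficient and shows that the ratio of
  -- the first two is the same in each.
  have key : ∀ᶠ q in 𝓝 p, u₁' q = ρ q * u₁ q ∧ u₂' q = ρ q * u₂ q := by
    filter_upwards [H.suma, H.sumb, H'.suma, H'.sumb, H.an₁.continuousAt.eventually_ne H.ne₁,
      (hα₂.wedge hα₃).continuousAt.eventually_ne h23] with q a b a' b' n1 n2
    refine ⟨by simp only [hρ]; field_simp, ?_⟩
    simp only [hρ]
    rw [div_mul_eq_mul_div, eq_div_iff n1]
    apply mul_right_cancel₀ n2
    simp only [OneForm.wedge]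
    linear_combination (u₁ q) * (α₃.b q * a' - α₃.a q * b') - (u₁' q) * (α₃.b q * a - α₃.a q * b)
  have step : ∀ (α : OneForm) (u u' : Fn), α.Holo p → AnalyticAt ℂ u p →
      (∀ᶠ q in 𝓝 p, u' q = ρ q * u q) →
      (∀ᶠ q in 𝓝 p, (smul u α).d q = h.wedge (smul u α) q) →
      (∀ᶠ q in 𝓝 p, (smul u' α).d q = h'.wedge (smul u' α) q) →
      ∀ᶠ q in 𝓝 p, h'.wedge (smul u α) q =
        (h.add (smul (fun q => 1 / ρ q) (ext ρ))).wedge (smul u α) q := by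
    intro α u u' hα hu huu e e'
    filter_upwards [huu.eventually_nhds, e, e', hα.eventually, hu.eventually_analyticAt,
      hρan.eventually_analyticAt, hρan.continuousAt.eventually_ne hρ0] with q q1 q2 q3 q4 q5 q6 q7
    have e1 : (smul u' α).d q = (smul ρ (smul u α)).d q := by
      apply d_congr
      · filter_upwards [q1] with r hr
        simp [smul, hr, mul_assoc]
      · filter_upwards [q1] with r hr
        simp [smul, hr, mul_assoc]
    rw [d_smul q6 (q4.smul q5), q2, q3] at e1
    have := q1.self_of_nhds
    simp only [OneForm.wedge, smul, Pi.mul_apply, OneForm.add, OneForm.ext] at e1 ⊢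
    rw [this] at e1
    field_simp
    linear_combination e1
  have s1 := step α₁ u₁ u₁' hα₁ H.an₁ (key.mono fun q h => h.1) H.eq₁ H'.eq₁
  have s2 := step α₂ u₂ u₂' hα₂ H.an₂ (key.mono fun q h => h.2) H.eq₂ H'.eq₂
  have fin : ∀ᶠ q in 𝓝 p, h'.a q = (h.add (smul (fun q => 1 / ρ q) (ext ρ))).a q ∧
      h'.b q = (h.add (smul (fun q => 1 / ρ q) (ext ρ))).b q := by
    filter_upwards [s1, s2, (hα₁.wedge hα₂).continuousAt.eventually_ne h12,
      H.an₁.continuousAt.eventually_ne H.ne₁, H.an₂.continuousAt.eventually_ne H.ne₂]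
      with q q1 q2 q3 q4 q5
    refine eq_of_wedge_eq (α := smul u₁ α₁) (β := smul u₂ α₂) ?_ q1 q2
    have : (smul u₁ α₁).wedge (smul u₂ α₂) q = u₁ q * u₂ q * α₁.wedge α₂ q := by
      simp only [OneForm.wedge, smul, Pi.mul_apply]; ring
    rw [this]
    exact mul_ne_zero (mul_ne_zero q4 q5) q3
  have hi : AnalyticAt ℂ (fun q => 1 / ρ q) p := analyticAt_const.div hρan hρ0
  rw [d_congr (fin.mono fun q h => h.1) (fin.mono fun q h => h.2),
    d_add H.holo (Holo.smul hi (Holo.ext hρan))]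
  have := dlog_closed hρan hρ0
  have e : (smul (fun q => 1 / ρ q) (ext ρ)).d p = 0 := by
    rw [← this]
    simp only [OneForm.d, smul, OneForm.ext]
    congr 1
    · apply dX_congr; filter_upwards with q; simp [div_eq_mul_inv, mul_comm]
    · apply dY_congr; filter_upwards with q; simp [div_eq_mul_inv, mul_comm]
  rw [e, add_zero]

/-- The form `η` of three pairwise independent `1`-forms, given by Cramer's rule. -/
def eta (α₁ α₂ α₃ : OneForm) : OneForm :=
  cramer (smul (α₂.wedge α₃) α₁) (smul (α₃.wedge α₁) α₂)
    (smul (α₂.wedge α₃) α₁).d (smul (α₃.wedge α₁) α₂).d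

/-- The wedge products are one admissible scaling, because `δ₂₃ α₁ + δ₃₁ α₂ + δ₁₂ α₃ = 0` holds
identically in the plane. -/
theorem IsEta.isConn {α₁ α₂ α₃ η : OneForm} {p : ℂ × ℂ} (hα₁ : α₁.Holo p) (hα₂ : α₂.Holo p)
    (hα₃ : α₃.Holo p) (h12 : α₁.wedge α₂ p ≠ 0) (h23 : α₂.wedge α₃ p ≠ 0)
    (h31 : α₃.wedge α₁ p ≠ 0) (H : IsEta α₁ α₂ α₃ η p) :
    IsConn α₁ α₂ α₃ η p (α₂.wedge α₃) (α₃.wedge α₁) (α₁.wedge α₂) := by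
  refine ⟨H.holo, hα₂.wedge hα₃, hα₃.wedge hα₁, hα₁.wedge hα₂, h23, h31, h12, ?_, ?_, H.eq₁,
    H.eq₂, H.eq₃⟩
  · filter_upwards with q
    simp only [OneForm.wedge]; ring
  · filter_upwards with q
    simp only [OneForm.wedge]; ring

theorem Holo_eta {α₁ α₂ α₃ : OneForm} {p : ℂ × ℂ} (hα₁ : α₁.Holo p) (hα₂ : α₂.Holo p)
    (hα₃ : α₃.Holo p) (h12 : α₁.wedge α₂ p ≠ 0) (h23 : α₂.wedge α₃ p ≠ 0)
    (h31 : α₃.wedge α₁ p ≠ 0) : (eta α₁ α₂ α₃).Holo p := by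
  refine Holo.cramer (hα₁.smul (hα₂.wedge hα₃)) (hα₂.smul (hα₃.wedge hα₁))
    (hα₁.smul (hα₂.wedge hα₃)).d (hα₂.smul (hα₃.wedge hα₁)).d ?_
  have : (smul (α₂.wedge α₃) α₁).wedge (smul (α₃.wedge α₁) α₂) p =
      α₂.wedge α₃ p * α₃.wedge α₁ p * α₁.wedge α₂ p := by
    simp only [OneForm.wedge, smul, Pi.mul_apply]; ring
  rw [this]
  exact mul_ne_zero (mul_ne_zero h23 h31) h12

/-- Cramer's rule imposes only the first two equations; the third is automatic by `IsConn.of_two`.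
-/
theorem isConn_eta {α₁ α₂ α₃ : OneForm} {p : ℂ × ℂ} (hα₁ : α₁.Holo p) (hα₂ : α₂.Holo p)
    (hα₃ : α₃.Holo p) (h12 : α₁.wedge α₂ p ≠ 0) (h23 : α₂.wedge α₃ p ≠ 0)
    (h31 : α₃.wedge α₁ p ≠ 0) :
    IsConn α₁ α₂ α₃ (eta α₁ α₂ α₃) p (α₂.wedge α₃) (α₃.wedge α₁) (α₁.wedge α₂) := by
  have hne : ∀ᶠ q in 𝓝 p,
      (smul (α₂.wedge α₃) α₁).wedge (smul (α₃.wedge α₁) α₂) q ≠ 0 := by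
    apply ((hα₁.smul (hα₂.wedge hα₃)).wedge (hα₂.smul (hα₃.wedge hα₁))).continuousAt.eventually_ne
    have : (smul (α₂.wedge α₃) α₁).wedge (smul (α₃.wedge α₁) α₂) p =
        α₂.wedge α₃ p * α₃.wedge α₁ p * α₁.wedge α₂ p := by
      simp only [OneForm.wedge, smul, Pi.mul_apply]; ring
    rw [this]
    exact mul_ne_zero (mul_ne_zero h23 h31) h12
  refine IsConn.of_two hα₁ hα₂ (Holo_eta hα₁ hα₂ hα₃ h12 h23 h31) (hα₂.wedge hα₃)
    (hα₃.wedge hα₁) (hα₁.wedge hα₂) h23 h31 h12 ?_ ?_ ?_ ?_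
  · filter_upwards with q
    simp only [OneForm.wedge]; ring
  · filter_upwards with q
    simp only [OneForm.wedge]; ring
  · filter_upwards [hne] with q hq
    rw [eta, cramer_wedge_left hq]
  · filter_upwards [hne] with q hq
    rw [eta, cramer_wedge_right hq]

theorem isEta_eta {α₁ α₂ α₃ : OneForm} {p : ℂ × ℂ} (hα₁ : α₁.Holo p) (hα₂ : α₂.Holo p)
    (hα₃ : α₃.Holo p) (h12 : α₁.wedge α₂ p ≠ 0) (h23 : α₂.wedge α₃ p ≠ 0)
    (h31 : α₃.wedge α₁ p ≠ 0) : IsEta α₁ α₂ α₃ (eta α₁ α₂ α₃) p :=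
  have H := isConn_eta hα₁ hα₂ hα₃ h12 h23 h31
  ⟨H.holo, H.eq₁, H.eq₂, H.eq₃⟩

/-- Any `h` as in `IsConn` computes the curvature of the `3`-web. -/
theorem IsConn.d_eq_eta {α₁ α₂ α₃ h : OneForm} {p : ℂ × ℂ} {u₁ u₂ u₃ : Fn}
    (hα₁ : α₁.Holo p) (hα₂ : α₂.Holo p) (hα₃ : α₃.Holo p) (h12 : α₁.wedge α₂ p ≠ 0)
    (h23 : α₂.wedge α₃ p ≠ 0) (h31 : α₃.wedge α₁ p ≠ 0) (H : IsConn α₁ α₂ α₃ h p u₁ u₂ u₃) :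
    h.d p = (eta α₁ α₂ α₃).d p :=
  (isConn_eta hα₁ hα₂ hα₃ h12 h23 h31).d_eq hα₁ hα₂ hα₃ h12 h23 H

theorem IsEta.d_eq_eta {α₁ α₂ α₃ η : OneForm} {p : ℂ × ℂ} (hα₁ : α₁.Holo p) (hα₂ : α₂.Holo p)
    (hα₃ : α₃.Holo p) (h12 : α₁.wedge α₂ p ≠ 0) (h23 : α₂.wedge α₃ p ≠ 0)
    (h31 : α₃.wedge α₁ p ≠ 0) (H : IsEta α₁ α₂ α₃ η p) : η.d p = (eta α₁ α₂ α₃).d p :=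
  (H.isConn hα₁ hα₂ hα₃ h12 h23 h31).d_eq_eta hα₁ hα₂ hα₃ h12 h23 h31

theorem wedge_comm_ne {α β : OneForm} {p : ℂ × ℂ} (h : α.wedge β p ≠ 0) : β.wedge α p ≠ 0 := by
  have : β.wedge α p = - α.wedge β p := by simp only [OneForm.wedge]; ring
  rw [this]; exact neg_ne_zero.mpr h

theorem eta_rotate_d {α₁ α₂ α₃ : OneForm} {p : ℂ × ℂ} (hα₁ : α₁.Holo p) (hα₂ : α₂.Holo p)
    (hα₃ : α₃.Holo p) (h12 : α₁.wedge α₂ p ≠ 0) (h23 : α₂.wedge α₃ p ≠ 0)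
    (h31 : α₃.wedge α₁ p ≠ 0) : (eta α₁ α₂ α₃).d p = (eta α₂ α₃ α₁).d p :=
  (isConn_eta hα₁ hα₂ hα₃ h12 h23 h31).rotate.d_eq_eta hα₂ hα₃ hα₁ h23 h31 h12

theorem eta_swap_d {α₁ α₂ α₃ : OneForm} {p : ℂ × ℂ} (hα₁ : α₁.Holo p) (hα₂ : α₂.Holo p)
    (hα₃ : α₃.Holo p) (h12 : α₁.wedge α₂ p ≠ 0) (h23 : α₂.wedge α₃ p ≠ 0)
    (h31 : α₃.wedge α₁ p ≠ 0) : (eta α₁ α₂ α₃).d p = (eta α₂ α₁ α₃).d p :=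
  (isConn_eta hα₁ hα₂ hα₃ h12 h23 h31).swap.d_eq_eta hα₂ hα₁ hα₃ (wedge_comm_ne h12)
    (wedge_comm_ne h31) (wedge_comm_ne h23)

/-- Proportional holomorphic `1`-forms differ by a unit. -/
theorem exists_unit_of_wedge_eq_zero {α β : OneForm} {p : ℂ × ℂ} (hα : α.Holo p) (hβ : β.Holo p)
    (hα0 : α.a p ≠ 0 ∨ α.b p ≠ 0) (hβ0 : β.a p ≠ 0 ∨ β.b p ≠ 0)
    (h : ∀ᶠ q in 𝓝 p, α.wedge β q = 0) :
    ∃ u : Fn, AnalyticAt ℂ u p ∧ u p ≠ 0 ∧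
      ∀ᶠ q in 𝓝 p, β.a q = u q * α.a q ∧ β.b q = u q * α.b q := by
  have hp := h.self_of_nhds
  simp only [OneForm.wedge] at hp
  rcases hα0 with h0 | h0
  · refine ⟨fun q => β.a q / α.a q, hβ.1.div hα.1 h0, ?_, ?_⟩
    · intro h1
      have h1 : β.a p = 0 := by simpa [h0] using h1
      rw [h1] at hp
      simp_all
    · filter_upwards [h, hα.1.continuousAt.eventually_ne h0] with q hq hq0
      simp only [OneForm.wedge] at hq
      refine ⟨by field_simp, ?_⟩
      field_simp
      linear_combination hq
  · refine ⟨fun q => β.b q / α.b q, hβ.2.div hα.2 h0, ?_, ?_⟩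
    · intro h1
      have h1 : β.b p = 0 := by simpa [h0] using h1
      rw [h1] at hp
      simp_all
    · filter_upwards [h, hα.2.continuousAt.eventually_ne h0] with q hq hq0
      simp only [OneForm.wedge] at hq
      refine ⟨?_, by field_simp⟩
      field_simp
      linear_combination -hq

theorem ne_zero_of_wedge_ne {α β : OneForm} {p : ℂ × ℂ} (h : α.wedge β p ≠ 0) :
    α.a p ≠ 0 ∨ α.b p ≠ 0 := by
  by_contra! hc
  exact h (by simp [OneForm.wedge, hc.1, hc.2])

/-- The curvature of a `3`-web does not depend on the choice of the defining forms. -/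
theorem eta_d_congr {α₁ α₂ α₃ β₁ β₂ β₃ : OneForm} {p : ℂ × ℂ}
    (hα₁ : α₁.Holo p) (hα₂ : α₂.Holo p) (hα₃ : α₃.Holo p)
    (hβ₁ : β₁.Holo p) (hβ₂ : β₂.Holo p) (hβ₃ : β₃.Holo p)
    (h12 : α₁.wedge α₂ p ≠ 0) (h23 : α₂.wedge α₃ p ≠ 0) (h31 : α₃.wedge α₁ p ≠ 0)
    (k12 : β₁.wedge β₂ p ≠ 0) (k23 : β₂.wedge β₃ p ≠ 0) (k31 : β₃.wedge β₁ p ≠ 0)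
    (e₁ : ∀ᶠ q in 𝓝 p, β₁.wedge α₁ q = 0) (e₂ : ∀ᶠ q in 𝓝 p, β₂.wedge α₂ q = 0)
    (e₃ : ∀ᶠ q in 𝓝 p, β₃.wedge α₃ q = 0) :
    (eta α₁ α₂ α₃).d p = (eta β₁ β₂ β₃).d p := by
  obtain ⟨u₁, au₁, nu₁, hu₁⟩ := exists_unit_of_wedge_eq_zero hβ₁ hα₁ (ne_zero_of_wedge_ne k12)
    (ne_zero_of_wedge_ne h12) e₁
  obtain ⟨u₂, au₂, nu₂, hu₂⟩ := exists_unit_of_wedge_eq_zero hβ₂ hα₂ (ne_zero_of_wedge_ne k23)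
    (ne_zero_of_wedge_ne h23) e₂
  obtain ⟨u₃, au₃, nu₃, hu₃⟩ := exists_unit_of_wedge_eq_zero hβ₃ hα₃ (ne_zero_of_wedge_ne k31)
    (ne_zero_of_wedge_ne h31) e₃
  have H := isConn_eta hα₁ hα₂ hα₃ h12 h23 h31
  -- When `α = u β`, one has `v α = (v u) β`: a change of defining form is absorbed by the scaling
  -- factor, and `h` is kept.
  have tr : ∀ (α β : OneForm) (u v : Fn),
      (∀ᶠ q in 𝓝 p, α.a q = u q * β.a q ∧ α.b q = u q * β.b q) →
      (∀ᶠ q in 𝓝 p, (smul v α).d q = (eta α₁ α₂ α₃).wedge (smul v α) q) →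
      (∀ᶠ q in 𝓝 p, (smul (v * u) β).d q = (eta α₁ α₂ α₃).wedge (smul (v * u) β) q) := by
    intro α β u v huv e
    filter_upwards [huv.eventually_nhds, e] with q h1 h2
    have : (smul (v * u) β).d q = (smul v α).d q := by
      apply d_congr
      · filter_upwards [h1] with r hr
        simp [smul, hr.1, mul_assoc]
      · filter_upwards [h1] with r hr
        simp [smul, hr.2, mul_assoc]
    rw [this, h2]
    have := h1.self_of_nhds
    simp only [OneForm.wedge, smul, Pi.mul_apply, this.1, this.2]; ring
  refine IsConn.d_eq_eta hβ₁ hβ₂ hβ₃ k12 k23 k31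
    (u₁ := α₂.wedge α₃ * u₁) (u₂ := α₃.wedge α₁ * u₂) (u₃ := α₁.wedge α₂ * u₃)
    ⟨H.holo, H.an₁.mul au₁, H.an₂.mul au₂, H.an₃.mul au₃, mul_ne_zero H.ne₁ nu₁,
      mul_ne_zero H.ne₂ nu₂, mul_ne_zero H.ne₃ nu₃, ?_, ?_, tr _ _ _ _ hu₁ H.eq₁,
      tr _ _ _ _ hu₂ H.eq₂, tr _ _ _ _ hu₃ H.eq₃⟩
  · filter_upwards [hu₁, hu₂, hu₃, H.suma] with q q1 q2 q3 q4
    rw [q1.1, q2.1, q3.1] at q4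
    simp only [Pi.mul_apply]; linear_combination q4
  · filter_upwards [hu₁, hu₂, hu₃, H.sumb] with q q1 q2 q3 q4
    rw [q1.2, q2.2, q3.2] at q4
    simp only [Pi.mul_apply]; linear_combination q4

/-! ### Binary forms as functions on tangent vectors -/

section Evaluation

theorem ev_mul (F G : Form) (v : ℂ × ℂ) : ev (F * G) v = ev F v * ev G v := by simp [ev]

theorem ev_C (c : ℂ) (v : ℂ × ℂ) : ev (MvPolynomial.C c) v = c := by simp [ev]

theorem ev_prod {ι : Type*} (s : Finset ι) (F : ι → Form) (v : ℂ × ℂ) :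
    ev (∏ i ∈ s, F i) v = ∏ i ∈ s, ev (F i) v := by simp [ev]

theorem form_ext {F G : Form} (h : ∀ v, ev F v = ev G v) : F = G := by
  apply MvPolynomial.funext
  intro x
  have := h (x 0, x 1)
  have e : ![x 0, x 1] = x := by ext i; fin_cases i <;> rfl
  simpa [ev, e] using this

/-- The linear form `l.1 dx + l.2 dy`. -/
def lin (l : ℂ × ℂ) : Form :=
  MvPolynomial.C l.1 * MvPolynomial.X 0 + MvPolynomial.C l.2 * MvPolynomial.X 1

theorem ev_lin (l v : ℂ × ℂ) : ev (lin l) v = l.1 * v.1 + l.2 * v.2 := by simp [ev, lin]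

theorem lin_isHomogeneous (l : ℂ × ℂ) : (lin l).IsHomogeneous 1 :=
  (MvPolynomial.isHomogeneous_C_mul_X _ _).add (MvPolynomial.isHomogeneous_C_mul_X _ _)

theorem prod_lin_isHomogeneous {ι : Type*} [Fintype ι] (l : ι → ℂ × ℂ) :
    (∏ i, lin (l i)).IsHomogeneous (Fintype.card ι) := by
  have := MvPolynomial.IsHomogeneous.prod Finset.univ (fun i => lin (l i)) (fun _ => 1)
    (fun i _ => lin_isHomogeneous (l i))
  simpa using this

/-- The determinant of two vectors. -/
def det2 (l g : ℂ × ℂ) : ℂ := l.1 * g.2 - l.2 * g.1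

theorem det2_neg (l g : ℂ × ℂ) : det2 l g = - det2 g l := by simp only [det2]; ring

end Evaluation

/-! ### Splitting binary forms into linear factors -/

section Factorization

open Polynomial in
-- A root `r` gives the factor `dx - r dy`. The missing degree `n - s.card` is a multiple root at
-- infinity and is filled with copies of `dy`.
theorem homogenize_prod_X_sub_C (s : Multiset ℂ) : ∀ n, s.card ≤ n →
    ∃ t : Multiset (ℂ × ℂ), t.card = n ∧
      Polynomial.homogenize ((s.map fun r => X - C r).prod) n = (t.map lin).prod := by
  induction s using Multiset.induction with
  | empty =>
    intro n _
    exact ⟨Multiset.replicate n (0, 1), by simp, by simp [lin]⟩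
  | cons r s ih =>
    intro n hn
    rw [Multiset.card_cons] at hn
    obtain ⟨m, rfl⟩ : ∃ m, n = 1 + m := ⟨n - 1, by omega⟩
    obtain ⟨t, ht, e⟩ := ih m (by omega)
    refine ⟨(1, -r) ::ₘ t, by simp [ht, add_comm], ?_⟩
    rw [Multiset.map_cons, Multiset.prod_cons, homogenize_mul _ _ (natDegree_X_sub_C_le r), e,
      Multiset.map_cons, Multiset.prod_cons]
    · congr 1
      simp [lin, sub_eq_add_neg]
    · rw [natDegree_multiset_prod_X_sub_C_eq_card]; omega

theorem exists_eq_C_mul_prod_lin {n : ℕ} {F : Form} (hF : F.IsHomogeneous n) :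
    ∃ (c : ℂ) (l : Fin n → ℂ × ℂ), F = MvPolynomial.C c * ∏ i, lin (l i) := by
  -- The chart is `dy = 1` here, opposite to that of `dehom`, to agree with `Polynomial.homogenize`.
  set P : Polynomial ℂ := MvPolynomial.aeval ![Polynomial.X, 1] F with hP
  have hd : P.natDegree ≤ n := by
    have := MvPolynomial.aeval_natDegree_le (m := n) (n := 1) F hF.totalDegree_le
      ![Polynomial.X, 1] (by intro i; fin_cases i <;> simp)
    simpa using this
  have hF' := Polynomial.homogenize_eq_of_isHomogeneous hF hP.symm
  have hs := (IsAlgClosed.splits P)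
  obtain ⟨t, ht, e⟩ := homogenize_prod_X_sub_C P.roots n ((Polynomial.card_roots' P).trans hd)
  obtain ⟨L, rfl⟩ := Quot.exists_rep t
  obtain rfl : L.length = n := by simpa using ht
  refine ⟨P.leadingCoeff, L.get, ?_⟩
  rw [← hF']
  conv_lhs => rw [hs.eq_prod_roots]
  rw [Polynomial.homogenize_C_mul, e]
  congr 1
  rw [← List.prod_ofFn]
  simp

theorem exists_eq_prod_lin {n : ℕ} (hn : 1 ≤ n) {F : Form} (hF : F.IsHomogeneous n) :
    ∃ l : Fin n → ℂ × ℂ, F = ∏ i, lin (l i) := by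
  obtain ⟨c, l, rfl⟩ := exists_eq_C_mul_prod_lin hF
  obtain ⟨m, rfl⟩ : ∃ m, n = m + 1 := ⟨n - 1, by omega⟩
  -- The constant is absorbed by the first factor, which exists since `n ≥ 1`.
  refine ⟨Fin.cons (c • l 0) (fun i => l i.succ), ?_⟩
  rw [Fin.prod_univ_succ, Fin.prod_univ_succ, ← mul_assoc]
  congr 1
  simp [lin]; ring

end Factorization

/-! ### Continuity of resultants and discriminants in the coefficients -/

section Coefficients

/-- In a fixed degree there are finitely many monomials, so regularity of a linear function of a
family of forms reduces to that of finitely many coefficients. -/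
theorem linearMap_eq_sum {M : Type*} [AddCommMonoid M] [Module ℂ M] {n : ℕ} {F : Form}
    (hF : F.IsHomogeneous n) (L : Form →ₗ[ℂ] M) :
    L F = ∑ m ∈ (Finset.univ : Finset (Fin 2)).finsuppAntidiag n,
      F.coeff m • L (MvPolynomial.monomial m 1) := by
  have h : F = ∑ m ∈ (Finset.univ : Finset (Fin 2)).finsuppAntidiag n,
      F.coeff m • MvPolynomial.monomial m (1 : ℂ) := by
    conv_lhs => rw [← MvPolynomial.support_sum_monomial_coeff F]
    have : ∀ m, F.coeff m • MvPolynomial.monomial m (1 : ℂ) =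
        MvPolynomial.monomial m (F.coeff m) := fun m => by
      rw [MvPolynomial.smul_monomial]; simp
    simp_rw [this]
    apply Finset.sum_subset
    · intro m hm
      rw [Finset.mem_finsuppAntidiag]
      refine ⟨?_, by simp⟩
      have h1 : m.weight 1 = n := hF (by simpa using hm)
      rw [← h1]
      simp [Finsupp.weight_apply, Finsupp.sum_fintype, Fin.sum_univ_two]
    · intro m _ hm
      rw [MvPolynomial.notMem_support_iff.mp hm, map_zero]
  conv_lhs => rw [h]
  simp

variable {T : Type*} [TopologicalSpace T] {t : T} {n : ℕ} {F : T → Form}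

theorem continuousAt_linearMap (hF : ∀ᶠ s in 𝓝 t, (F s).IsHomogeneous n)
    (hc : ∀ m, ContinuousAt (fun s => (F s).coeff m) t) (L : Form →ₗ[ℂ] ℂ) :
    ContinuousAt (fun s => L (F s)) t := by
  have : (fun s => L (F s)) =ᶠ[𝓝 t] fun s =>
      ∑ m ∈ (Finset.univ : Finset (Fin 2)).finsuppAntidiag n,
        (F s).coeff m • L (MvPolynomial.monomial m 1) := by
    filter_upwards [hF] with s hs
    exact linearMap_eq_sum hs L
  refine ContinuousAt.congr ?_ this.symm
  exact tendsto_finsetSum _ fun m _ => (hc m).smul_const _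

/-- The linear map `dehom`. -/
def dehomL : Form →ₗ[ℂ] Polynomial ℂ :=
  (MvPolynomial.aeval ![1, Polynomial.X] : Form →ₐ[ℂ] Polynomial ℂ).toLinearMap

/-- The formal degrees are constant, so the Sylvester matrix keeps its size when actual degrees
drop, and its entries are coefficients or zero. -/
theorem continuousAt_resultant {f g : T → Polynomial ℂ} {m n : ℕ}
    (hf : ∀ i, ContinuousAt (fun s => (f s).coeff i) t)
    (hg : ∀ i, ContinuousAt (fun s => (g s).coeff i) t) :
    ContinuousAt (fun s => Polynomial.resultant (f s) (g s) m n) t := by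
  have hdet : Continuous fun A : Matrix (Fin (m + n)) (Fin (m + n)) ℂ => A.det :=
    continuous_id.matrix_det
  refine hdet.continuousAt.comp (f := fun s => Polynomial.sylvester (f s) (g s) m n) ?_
  refine tendsto_pi_nhds.mpr fun i => tendsto_pi_nhds.mpr fun j => ?_
  induction j using Fin.addCases with
  | left j =>
    simp only [Polynomial.sylvester, Matrix.of_apply, Fin.addCases_left]
    split_ifs
    · exact hg _
    · exact tendsto_const_nhds
  | right j =>
    simp only [Polynomial.sylvester, Matrix.of_apply, Fin.addCases_right]
    split_ifs
    · exact hf _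
    · exact tendsto_const_nhds

theorem continuousAt_disc (hF : ∀ᶠ s in 𝓝 t, (F s).IsHomogeneous n)
    (hc : ∀ m, ContinuousAt (fun s => (F s).coeff m) t) :
    ContinuousAt (fun s => disc n (F s)) t :=
  continuousAt_resultant
    (fun i => continuousAt_linearMap hF hc
      (Polynomial.lcoeff ℂ i ∘ₗ dehomL ∘ₗ (MvPolynomial.pderiv (R := ℂ) (0 : Fin 2)).toLinearMap))
    (fun i => continuousAt_linearMap hF hc
      (Polynomial.lcoeff ℂ i ∘ₗ dehomL ∘ₗ (MvPolynomial.pderiv (R := ℂ) (1 : Fin 2)).toLinearMap))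

theorem continuousAt_resultant_dehom {G : T → Form} {m : ℕ}
    (hF : ∀ᶠ s in 𝓝 t, (F s).IsHomogeneous n)
    (hc : ∀ m, ContinuousAt (fun s => (F s).coeff m) t)
    (hG : ∀ᶠ s in 𝓝 t, (G s).IsHomogeneous m)
    (hd : ∀ m, ContinuousAt (fun s => (G s).coeff m) t) :
    ContinuousAt (fun s => Polynomial.resultant (dehom (F s)) (dehom (G s)) n m) t :=
  continuousAt_resultant
    (fun i => continuousAt_linearMap hF hc (Polynomial.lcoeff ℂ i ∘ₗ dehomL))
    (fun i => continuousAt_linearMap hG hd (Polynomial.lcoeff ℂ i ∘ₗ dehomL))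

theorem continuous_coeff_prod_lin {ι : Type*} [Fintype ι] (m : Fin 2 →₀ ℕ) :
    Continuous fun l : ι → ℂ × ℂ => (∏ i, lin (l i)).coeff m := by
  classical
  have : ∀ s : Finset ι, ∀ m, Continuous fun l : ι → ℂ × ℂ => (∏ i ∈ s, lin (l i)).coeff m := by
    intro s
    induction s using Finset.induction with
    | empty => intro m; simpa using continuous_const
    | insert i s hi ih =>
      intro m
      simp only [Finset.prod_insert hi, MvPolynomial.coeff_mul]
      refine continuous_finsetSum _ fun x _ => Continuous.mul ?_ (ih _)
      simp only [lin, MvPolynomial.coeff_add, MvPolynomial.coeff_C_mul]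
      fun_prop
  exact this _ m

end Coefficients

/-! ### Discriminants and resultants of products of linear forms -/

section Discriminant

theorem dehom_pderiv_one (F : Form) :
    dehom (MvPolynomial.pderiv 1 F) = Polynomial.derivative (dehom F) := by
  unfold dehom
  induction F using MvPolynomial.induction_on with
  | C a => simp
  | add p q hp hq => simp [hp, hq]
  | mul_X p i hp =>
    simp only [MvPolynomial.pderiv_mul, map_add, map_mul, hp, Polynomial.derivative_mul,
      MvPolynomial.aeval_X]
    fin_cases i <;> simp [MvPolynomial.pderiv_X]

theorem natDegree_dehom_le {F : Form} {n : ℕ} (hF : F.IsHomogeneous n) :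
    (dehom F).natDegree ≤ n := by
  have := MvPolynomial.aeval_natDegree_le (m := n) (n := 1) F hF.totalDegree_le
    ![1, Polynomial.X] (by intro i; fin_cases i <;> simp)
  unfold dehom
  simpa using this

theorem dehom_prod_lin {ι : Type*} [Fintype ι] (l : ι → ℂ × ℂ) :
    dehom (∏ i, lin (l i)) =
      ∏ i, (Polynomial.C (l i).1 + Polynomial.C (l i).2 * Polynomial.X) := by
  simp only [dehom, map_prod, lin, map_add, map_mul, MvPolynomial.aeval_C, MvPolynomial.aeval_X]
  refine Finset.prod_congr rfl fun i _ => ?_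
  simp [Polynomial.algebraMap_eq]

theorem dehom_euler {F : Form} {n : ℕ} (hF : F.IsHomogeneous n) :
    dehom (MvPolynomial.pderiv 0 F) + dehom (MvPolynomial.pderiv 1 F) * Polynomial.X =
      Polynomial.C (n : ℂ) * dehom F := by
  have := congrArg dehom hF.sum_X_mul_pderiv
  simp only [Fin.sum_univ_two, dehom, map_add, map_mul, MvPolynomial.aeval_X, map_nsmul] at this
  simp only [dehom]
  simp at this ⊢
  linear_combination this

open Polynomial in
theorem natDegree_linear_prod {ι : Type*} [Fintype ι] (l : ι → ℂ × ℂ) (hl : ∀ i, (l i).2 ≠ 0) :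
    (∏ i, (C (l i).1 + C (l i).2 * X)).natDegree = Fintype.card ι ∧
      (∏ i, (C (l i).1 + C (l i).2 * X)).leadingCoeff = ∏ i, (l i).2 := by
  have h1 : ∀ i, (C (l i).1 + C (l i).2 * X).natDegree = 1 := fun i => by
    rw [add_comm]; exact natDegree_linear (hl i)
  have h2 : ∀ i, (C (l i).1 + C (l i).2 * X).leadingCoeff = (l i).2 := fun i => by
    rw [add_comm]; exact leadingCoeff_linear (hl i)
  constructor
  · rw [natDegree_prod]
    · simp [h1]
    · intro i _ h
      have := h1 i
      rw [h] at this
      simp at this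
  · rw [leadingCoeff_prod]; simp [h2]

open Polynomial in
-- Multiplicativity reduces to one linear factor, whose resultant with `P` is the value of `P` at
-- its root, up to a power of the leading coefficient.
theorem resultant_linear_prod {ι : Type*} [Fintype ι] (l : ι → ℂ × ℂ) (hl : ∀ i, (l i).2 ≠ 0)
    (P : ℂ[X]) (N : ℕ) (hP : P.natDegree ≤ N) :
    resultant (∏ i, (C (l i).1 + C (l i).2 * X)) P (Fintype.card ι) N =
      ∏ i, ((l i).2 ^ N * P.eval (-(l i).1 / (l i).2)) := by
  have h1 : ∀ i, (C (l i).1 + C (l i).2 * X).natDegree = 1 := fun i => by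
    rw [add_comm]; exact natDegree_linear (hl i)
  have h2 : ∀ i, (C (l i).1 + C (l i).2 * X).leadingCoeff = (l i).2 := fun i => by
    rw [add_comm]; exact leadingCoeff_linear (hl i)
  have := resultant_prod_left Finset.univ (fun i => C (l i).1 + C (l i).2 * X) P N
    (by simp only [h2]; exact Finset.prod_ne_zero_iff.mpr fun i _ => hl i) hP
  rw [(natDegree_linear_prod l hl).1] at this
  rw [this]
  refine Finset.prod_congr rfl fun i _ => ?_
  rw [h1]
  have e : C (l i).1 + C (l i).2 * X = C (l i).2 * (X + C ((l i).1 / (l i).2)) := by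
    rw [mul_add, ← C_mul, mul_div_cancel₀ _ (hl i), add_comm]
  rw [e, resultant_C_mul_left, resultant_X_add_C_left _ _ _ hP, neg_div]

/-- A property of families of vectors which holds if no vector is horizontal holds for all families
if it is an equality of continuous functions. -/
theorem eq_of_eq_off_horizontal {ι : Type*} [Fintype ι] {φ ψ : (ι → ℂ × ℂ) → ℂ}
    (hφ : Continuous φ) (hψ : Continuous ψ) (h : ∀ l, (∀ i, (l i).2 ≠ 0) → φ l = ψ l) : φ = ψ := by
  refine Continuous.ext_on
    (s := Set.pi Set.univ fun _ : ι => (Set.univ : Set ℂ) ×ˢ ({0}ᶜ : Set ℂ)) ?_ hφ hψ ?_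
  · exact dense_pi _ fun i _ => dense_univ.prod (dense_compl_singleton 0)
  · intro l hl
    exact h l fun i => by simpa using hl i (Set.mem_univ i)

theorem continuous_det2_comp {ι : Type*} (i j : ι) :
    Continuous fun l : ι → ℂ × ℂ => det2 (l i) (l j) := by
  unfold det2; fun_prop

/-- The resultant of two products of linear forms. -/
theorem resultant_prod_lin {ι κ : Type*} [Fintype ι] [Fintype κ] (l : ι → ℂ × ℂ)
    (g : κ → ℂ × ℂ) :
    Polynomial.resultant (dehom (∏ i, lin (l i))) (dehom (∏ j, lin (g j))) (Fintype.card ι)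
      (Fintype.card κ) = ∏ i, ∏ j, det2 (g j) (l i) := by
  have hg : (dehom (∏ j, lin (g j))).natDegree ≤ Fintype.card κ :=
    natDegree_dehom_le (prod_lin_isHomogeneous g)
  -- Both sides are continuous in the factors, so the factors constant in the chart `dx = 1` can be
  -- left out.
  refine congrFun (eq_of_eq_off_horizontal
    (φ := fun l => Polynomial.resultant (dehom (∏ i, lin (l i))) (dehom (∏ j, lin (g j)))
      (Fintype.card ι) (Fintype.card κ))
    (ψ := fun l => ∏ i, ∏ j, det2 (g j) (l i)) ?_ ?_ ?_) l
  · refine continuous_iff_continuousAt.mpr fun l => continuousAt_resultant_dehom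
      (Eventually.of_forall fun l => prod_lin_isHomogeneous l)
      (fun m => (continuous_coeff_prod_lin m).continuousAt)
      (Eventually.of_forall fun l => prod_lin_isHomogeneous g) (fun m => continuousAt_const)
  · unfold det2; fun_prop
  · intro l hl
    rw [dehom_prod_lin l, resultant_linear_prod l hl _ _ hg]
    refine Finset.prod_congr rfl fun i _ => ?_
    rw [dehom_prod_lin, Polynomial.eval_prod, ← Finset.card_univ, ← Finset.prod_const,
      ← Finset.prod_mul_distrib]
    refine Finset.prod_congr rfl fun j _ => ?_
    have := hl i
    simp [det2]; field_simp; ring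

/-- The product of the determinants of pairs of distinct members of a family of vectors. -/
def pairProd {ι : Type*} [Fintype ι] [DecidableEq ι] (l : ι → ℂ × ℂ) : ℂ :=
  ∏ i, ∏ j, if j = i then 1 else det2 (l j) (l i)

/-- The normalization constant of the discriminant. -/
def discConst (n : ℕ) : ℂ := (-1) ^ (n - 1) * n ^ (n - 1) / n

theorem discConst_ne_zero {n : ℕ} (hn : 1 ≤ n) : discConst n ≠ 0 := by
  have : (n : ℂ) ≠ 0 := by exact_mod_cast (by omega : n ≠ 0)
  exact div_ne_zero (mul_ne_zero (pow_ne_zero _ (by norm_num)) (pow_ne_zero _ this)) this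

/-- By Euler's relation `n F = F_x + z F_y` in the chart `dx = 1`, so `Res(F_x, F_y)` can be read
off `Res(F, F_y)`. The latter is the product of the values of `F_y = F'` at the roots of `F`, that
is, of the differences of roots. -/
theorem disc_prod_lin {ι : Type*} [Fintype ι] [DecidableEq ι] {n : ℕ} (hn : 1 ≤ n)
    (hι : Fintype.card ι = n) (l : ι → ℂ × ℂ) :
    disc n (∏ i, lin (l i)) = discConst n * pairProd l := by
  refine congrFun (eq_of_eq_off_horizontal (φ := fun l => disc n (∏ i, lin (l i)))
    (ψ := fun l => discConst n * pairProd l) ?_ ?_ ?_) l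
  · refine continuous_iff_continuousAt.mpr fun l => continuousAt_disc
      (Eventually.of_forall fun l => hι ▸ prod_lin_isHomogeneous l)
      (fun m => (continuous_coeff_prod_lin m).continuousAt)
  · refine continuous_const.mul (continuous_finsetProd _ fun i _ => continuous_finsetProd _
      fun j _ => ?_)
    split_ifs
    · exact continuous_const
    · exact continuous_det2_comp _ _
  · intro l hl
    obtain ⟨m, rfl⟩ : ∃ m, n = m + 1 := ⟨n - 1, by omega⟩
    set F : Form := ∏ i, lin (l i) with hF
    have hom : F.IsHomogeneous (m + 1) := hι ▸ prod_lin_isHomogeneous l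
    set f0 := dehom (MvPolynomial.pderiv 0 F) with hf0
    set f1 := dehom (MvPolynomial.pderiv 1 F) with hf1
    have d0 : f0.natDegree ≤ m := by simpa using natDegree_dehom_le (hom.pderiv (i := 0))
    have d1 : f1.natDegree ≤ m := by simpa using natDegree_dehom_le (hom.pderiv (i := 1))
    have hder : f1 = Polynomial.derivative (dehom F) := dehom_pderiv_one F
    have e1 : Polynomial.resultant (f0 + f1 * Polynomial.X) f1 (m + 1) m =
        Polynomial.resultant f0 f1 (m + 1) m :=
      Polynomial.resultant_add_mul_left _ _ _ _ _ (by simp [add_comm]) d1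
    -- Raising the formal degree of `f0` from `m` to `m + 1` contributes, up to sign, the
    -- coefficient of degree `m` of `f1`; `hlead` computes it.
    rw [Polynomial.resultant_succ_left_deg _ _ _ _ d0, hf0, hf1, dehom_euler hom,
      Polynomial.resultant_C_mul_left, ← hf0, ← hf1] at e1
    have hdeh : dehom F = _ := dehom_prod_lin l
    have hlead : f1.coeff m = (∏ i, (l i).2) * (m + 1) := by
      rw [hder, Polynomial.coeff_derivative]
      congr 1
      rw [hdeh, ← (natDegree_linear_prod l hl).2, Polynomial.leadingCoeff,
        (natDegree_linear_prod l hl).1, hι]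
    -- In the Leibniz formula for the derivative, only the term differentiating the `i`-th factor
    -- survives at its root.
    have hev : ∀ i, (l i).2 ^ m * f1.eval (-(l i).1 / (l i).2) =
        (l i).2 * ∏ j, if j = i then 1 else det2 (l j) (l i) := by
      intro i
      rw [hder, hdeh, Polynomial.derivative_prod_finset, Polynomial.eval_finsetSum,
        Finset.sum_eq_single i]
      · rw [← Finset.mul_prod_erase Finset.univ _ (Finset.mem_univ i)]
        have hc : m = (Finset.univ.erase i).card := by
          rw [Finset.card_erase_of_mem (Finset.mem_univ i), Finset.card_univ, hι]; simp
        rw [Polynomial.eval_mul, Polynomial.eval_prod]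
        simp only [if_true, one_mul]
        have : ∀ x y z : ℂ, x * (y * z) = z * (x * y) := by intros; ring
        rw [this, mul_comm ((l i).2)]
        conv_lhs => rw [hc]
        rw [← Finset.prod_const, ← Finset.prod_mul_distrib, mul_comm]
        congr 1
        · refine Finset.prod_congr rfl fun j hj => ?_
          rw [if_neg (Finset.ne_of_mem_erase hj)]
          have := hl i
          simp [det2]; field_simp; ring
        · simp
      · intro j _ hj
        rw [Polynomial.eval_mul, Polynomial.eval_prod, Finset.prod_eq_zero (i := i), zero_mul]
        · simp [Ne.symm hj]
        · have := hl i
          simp; field_simp; ring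
      · simp
    have e2 : Polynomial.resultant (dehom F) f1 (m + 1) m = (∏ i, (l i).2) * pairProd l := by
      rw [hdeh, ← hι, resultant_linear_prod l hl _ _ d1, pairProd, ← Finset.prod_mul_distrib]
      exact Finset.prod_congr rfl fun i _ => hev i
    rw [e2, hlead] at e1
    have hb : ∏ i, (l i).2 ≠ 0 := Finset.prod_ne_zero_iff.mpr fun i _ => hl i
    have hm : (m + 1 : ℂ) ≠ 0 := by exact_mod_cast Nat.succ_ne_zero m
    have hs : ((-1 : ℂ) ^ m) * (-1) ^ m = 1 := by rw [← mul_pow]; simp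
    simp only [disc, discConst, Nat.add_sub_cancel]
    push_cast at e1 ⊢
    rw [div_mul_eq_mul_div, eq_div_iff hm]
    apply mul_left_cancel₀ hb
    linear_combination (-(-1 : ℂ) ^ m) * e1 - (∏ i, (l i).2) * (m + 1) * (Polynomial.resultant f0 f1 m m) * hs

theorem disc_ne_zero_iff {ι : Type*} [Fintype ι] [DecidableEq ι] {n : ℕ} (hn : 1 ≤ n)
    (hι : Fintype.card ι = n) (l : ι → ℂ × ℂ) :
    disc n (∏ i, lin (l i)) ≠ 0 ↔ ∀ i j, i ≠ j → det2 (l i) (l j) ≠ 0 := by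
  rw [disc_prod_lin hn hι, mul_ne_zero_iff, pairProd]
  simp only [Finset.prod_ne_zero_iff, discConst_ne_zero hn, ne_eq, not_false_eq_true, true_and,
    Finset.mem_univ, forall_true_left]
  constructor
  · intro h i j hij
    have := h j i
    rwa [if_neg hij] at this
  · intro h i j
    split_ifs with hji
    · simp
    · exact h j i hji

/-- The discriminant of a product. -/
theorem disc_mul {m n : ℕ} (hm : 1 ≤ m) (hn : 1 ≤ n) : ∃ c : ℂ, c ≠ 0 ∧
    ∀ F G : Form, F.IsHomogeneous m → G.IsHomogeneous n → disc (m + n) (F * G) =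
      c * disc m F * disc n G * Polynomial.resultant (dehom F) (dehom G) m n ^ 2 := by
  refine ⟨discConst (m + n) * (-1) ^ (n * m) / (discConst m * discConst n), ?_, ?_⟩
  · exact div_ne_zero (mul_ne_zero (discConst_ne_zero (by omega)) (pow_ne_zero _ (by norm_num)))
      (mul_ne_zero (discConst_ne_zero hm) (discConst_ne_zero hn))
  intro F G hF hG
  obtain ⟨l, rfl⟩ := exists_eq_prod_lin hm hF
  obtain ⟨g, rfl⟩ := exists_eq_prod_lin hn hG
  have h1 : (∏ i, lin (l i)) * (∏ j, lin (g j)) = ∏ x : Fin m ⊕ Fin n, lin (Sum.elim l g x) := by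
    simp [Fintype.prod_sum_type]
  have hr := resultant_prod_lin l g
  simp only [Fintype.card_fin] at hr
  rw [h1, disc_prod_lin (by omega) (by simp), disc_prod_lin hm (by simp),
    disc_prod_lin hn (by simp), hr]
  -- The product runs over ordered pairs, so each mixed pair occurs twice, which produces the square
  -- of the resultant up to sign.
  have h2 : pairProd (Sum.elim l g) = pairProd l * pairProd g *
      ((∏ i, ∏ j, det2 (g j) (l i)) * ∏ j, ∏ i, det2 (l i) (g j)) := by
    simp only [pairProd, Fintype.prod_sum_type, Sum.elim_inl, Sum.elim_inr, Sum.inl.injEq,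
      Sum.inr.injEq, reduceCtorEq, if_false, Finset.prod_mul_distrib]
    ring
  have h3 : ∏ j, ∏ i, det2 (l i) (g j) = (-1) ^ (n * m) * ∏ i, ∏ j, det2 (g j) (l i) := by
    rw [Finset.prod_comm]
    simp_rw [det2_neg (l _) (g _)]
    have : ∀ i j, -det2 (g j) (l i) = (-1) * det2 (g j) (l i) := by intros; ring
    simp_rw [this, Finset.prod_mul_distrib]
    simp [← pow_mul]
  rw [h2, h3]
  have := discConst_ne_zero hm
  have := discConst_ne_zero hn
  field_simp

theorem disc_C_mul (n : ℕ) (c : ℂ) (F : Form) :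
    disc n (MvPolynomial.C c * F) = c ^ (n - 1) * c ^ (n - 1) * disc n F := by
  have h : ∀ i, dehom (MvPolynomial.pderiv i (MvPolynomial.C c * F)) =
      Polynomial.C c * dehom (MvPolynomial.pderiv i F) := by
    intro i
    simp [dehom, Polynomial.algebraMap_eq]
  rw [disc, h, h, Polynomial.resultant_C_mul_left, Polynomial.resultant_C_mul_right, disc]
  ring

end Discriminant

/-! ### Smooth curves: division by the equation, irreducibility -/

section Division

/-- The map `(x, y) ↦ (x, τ y)`. -/
def scaleSnd (τ : ℂ) : ℂ × ℂ →L[ℂ] ℂ × ℂ :=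
  (ContinuousLinearMap.fst ℂ ℂ ℂ).prod (τ • ContinuousLinearMap.snd ℂ ℂ ℂ)

theorem scaleSnd_apply (τ : ℂ) (p : ℂ × ℂ) : scaleSnd τ p = (p.1, τ * p.2) := rfl

theorem norm_scaleSnd_le {τ : ℂ} (h : ‖τ‖ ≤ 1) : ‖scaleSnd τ‖ ≤ 1 := by
  refine ContinuousLinearMap.opNorm_le_bound _ zero_le_one fun p => ?_
  rw [one_mul, scaleSnd_apply, Prod.norm_def, Prod.norm_def, norm_mul]
  exact max_le_max le_rfl (mul_le_of_le_one_left (norm_nonneg _) h)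

theorem continuous_scaleSnd : Continuous scaleSnd := by
  have : scaleSnd = fun τ => (ContinuousLinearMap.inl ℂ ℂ ℂ ∘L ContinuousLinearMap.fst ℂ ℂ ℂ) +
      τ • (ContinuousLinearMap.inr ℂ ℂ ℂ ∘L ContinuousLinearMap.snd ℂ ℂ ℂ) := by
    ext τ <;> simp [scaleSnd]
  rw [this]
  fun_prop

/-- The average of an analytic function over the segment from `(x, 0)` to `(x, y)` is analytic. -/
theorem analyticAt_average {H : Fn} (hH : AnalyticAt ℂ H 0) :
    AnalyticAt ℂ (fun p : ℂ × ℂ => ∫ τ in (0 : ℝ)..1, H (p.1, τ * p.2)) 0 := by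
  obtain ⟨P, r, hP⟩ := hH
  have hτ : ∀ τ ∈ Set.uIoc (0 : ℝ) 1, ‖(τ : ℂ)‖ ≤ 1 := by
    intro τ h
    rw [Set.uIoc_of_le zero_le_one] at h
    rw [Complex.norm_real, Real.norm_eq_abs, abs_of_pos h.1]; exact h.2
  -- The power series of `y ↦ H (x, τ y)`. Since `scaleSnd τ` has norm at most one, its terms are
  -- bounded by those of `P`, uniformly in `τ`, and the series can be integrated term by term.
  set S : ℝ → FormalMultilinearSeries ℂ (ℂ × ℂ) ℂ :=
    fun τ n => (P n).compContinuousLinearMap fun _ => scaleSnd τ with hS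
  have hcont : ∀ n, Continuous fun τ => S τ n := by
    intro n
    have h1 : Continuous fun τ : ℝ =>
        ContinuousMultilinearMap.compContinuousLinearMapContinuousMultilinear ℂ
          (fun _ : Fin n => ℂ × ℂ) (fun _ : Fin n => ℂ × ℂ) ℂ (fun _ => scaleSnd τ) :=
      (ContinuousMultilinearMap.cont _).comp
        (continuous_pi fun _ => continuous_scaleSnd.comp Complex.continuous_ofReal)
    exact h1.clm_apply continuous_const
  have hbound : ∀ n, ∀ τ ∈ Set.uIoc (0 : ℝ) 1, ‖S τ n‖ ≤ ‖P n‖ := by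
    intro n τ h
    refine (ContinuousMultilinearMap.norm_compContinuousLinearMap_le _ _).trans ?_
    refine mul_le_of_le_one_right (norm_nonneg _) (Finset.prod_le_one (fun _ _ => norm_nonneg _)
      fun _ _ => norm_scaleSnd_le (hτ τ h))
  set Q : FormalMultilinearSeries ℂ (ℂ × ℂ) ℂ := fun n => ∫ τ in (0 : ℝ)..1, S τ n with hQ
  have hQn : ∀ n, ‖Q n‖ ≤ ‖P n‖ := by
    intro n
    have := intervalIntegral.norm_integral_le_of_norm_le_const (hbound n)
    simpa using this
  refine ⟨Q, r, ?_, hP.r_pos, ?_⟩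
  · refine ENNReal.le_of_forall_nnreal_lt fun ρ hρ => ?_
    obtain ⟨C, _, hC⟩ := P.norm_mul_pow_le_of_lt_radius (hρ.trans_le hP.r_le)
    exact Q.le_radius_of_bound C fun n =>
      (mul_le_mul_of_nonneg_right (hQn n) (by positivity)).trans (hC n)
  · intro y hy
    have hy' : (‖y‖₊ : ENNReal) < r := by simpa [enorm_eq_nnnorm] using hy
    have hsum : Summable fun n => ‖P n‖ * ‖y‖ ^ n := by
      simpa using P.summable_norm_mul_pow (hy'.trans_le hP.r_le)
    have e : ∀ n, (Q n fun _ => y) = ∫ τ in (0 : ℝ)..1, (S τ n fun _ => y) := by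
      intro n
      exact (ContinuousLinearMap.intervalIntegral_comp_comm
        (ContinuousMultilinearMap.apply ℂ (fun _ : Fin n => ℂ × ℂ) ℂ fun _ => y)
        ((hcont n).intervalIntegrable 0 1)).symm
    simp_rw [e, zero_add]
    refine intervalIntegral.hasSum_integral_of_dominated_convergence
      (fun n _ => ‖P n‖ * ‖y‖ ^ n) ?_ ?_ ?_ ?_ ?_
    · intro n
      exact ((ContinuousMultilinearMap.apply ℂ (fun _ : Fin n => ℂ × ℂ) ℂ
        fun _ => y).continuous.comp (hcont n)).aestronglyMeasurable
    · intro n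
      refine Eventually.of_forall fun τ h => ?_
      refine ((S τ n).le_opNorm _).trans ?_
      rw [Finset.prod_const, Finset.card_univ, Fintype.card_fin]
      exact mul_le_mul_of_nonneg_right (hbound n τ h) (by positivity)
    · exact Eventually.of_forall fun _ _ => hsum
    · exact intervalIntegrable_const
    · refine Eventually.of_forall fun τ h => ?_
      have hmem : scaleSnd τ y ∈ Metric.eball (0 : ℂ × ℂ) r := by
        have h1 : ‖scaleSnd τ y‖ ≤ ‖y‖ := by
          refine ((scaleSnd τ).le_opNorm y).trans ?_
          exact mul_le_of_le_one_left (norm_nonneg _) (norm_scaleSnd_le (hτ τ h))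
        have h2 : (‖scaleSnd τ y‖₊ : ENNReal) < r :=
          lt_of_le_of_lt (by exact_mod_cast h1) hy'
        simpa [enorm_eq_nnnorm] using h2
      have := hP.hasSum hmem
      rw [zero_add] at this
      exact this

/-- An analytic function vanishing on the line `y = 0` is divisible by `y`. -/
theorem exists_eq_snd_mul {G : Fn} (hG : AnalyticAt ℂ G 0)
    (h0 : ∀ᶠ x in 𝓝 (0 : ℂ), G (x, 0) = 0) :
    ∃ Q : Fn, AnalyticAt ℂ Q 0 ∧ ∀ᶠ p in 𝓝 (0 : ℂ × ℂ), G p = p.2 * Q p := by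
  -- Hadamard's lemma: the quotient is the average of `∂G/∂y` over the segment from `(x, 0)` to `(x,
  -- y)`.
  refine ⟨_, analyticAt_average (analyticAt_dY hG), ?_⟩
  obtain ⟨ε, hε, hball⟩ := Metric.eventually_nhds_iff_ball.mp hG.eventually_analyticAt
  have h0' : ∀ᶠ p in 𝓝 (0 : ℂ × ℂ), G (p.1, 0) = 0 :=
    (continuous_fst.tendsto (0 : ℂ × ℂ)).eventually h0
  filter_upwards [h0', Metric.ball_mem_nhds 0 hε] with p hp hpε
  have hmem : ∀ τ ∈ Set.uIcc (0 : ℝ) 1, AnalyticAt ℂ G (p.1, τ * p.2) := by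
    intro τ h
    rw [Set.uIcc_of_le zero_le_one] at h
    apply hball
    have h1 : ‖scaleSnd τ p‖ ≤ ‖p‖ := by
      refine ((scaleSnd τ).le_opNorm p).trans ?_
      refine mul_le_of_le_one_left (norm_nonneg _) (norm_scaleSnd_le ?_)
      rw [Complex.norm_real, Real.norm_eq_abs, abs_of_nonneg h.1]; exact h.2
    rw [mem_ball_zero_iff] at hpε ⊢
    exact lt_of_le_of_lt h1 hpε
  have hd : ∀ τ ∈ Set.uIcc (0 : ℝ) 1,
      HasDerivAt (fun τ : ℝ => G (p.1, τ * p.2)) (p.2 * dY G (p.1, τ * p.2)) τ := by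
    intro τ h
    have h1 : HasDerivAt (fun z : ℂ => ((p.1, z * p.2) : ℂ × ℂ)) (0, p.2) (τ : ℂ) := by
      simpa using (hasDerivAt_const (τ : ℂ) p.1).prodMk ((hasDerivAt_id (τ : ℂ)).mul_const p.2)
    have h2 := ((hmem τ h).differentiableAt.hasFDerivAt.comp_hasDerivAt (τ : ℂ) h1).comp_ofReal
    have h3 : ((0, p.2) : ℂ × ℂ) = p.2 • (0, 1) := by simp
    rw [h3, map_smul] at h2
    exact h2
  have hi : IntervalIntegrable (fun τ : ℝ => p.2 * dY G (p.1, τ * p.2)) MeasureTheory.volume 0 1 := by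
    apply ContinuousOn.intervalIntegrable
    intro τ h
    apply ContinuousAt.continuousWithinAt
    refine continuousAt_const.mul ?_
    exact ContinuousAt.comp (f := fun τ : ℝ => ((p.1, τ * p.2) : ℂ × ℂ))
      (analyticAt_dY (hmem τ h)).continuousAt (by fun_prop)
  have := intervalIntegral.integral_eq_sub_of_hasDerivAt hd hi
  rw [intervalIntegral.integral_const_mul] at this
  simp only [Complex.ofReal_one, one_mul, Complex.ofReal_zero, zero_mul] at this
  rw [hp, sub_zero] at this
  exact this.symm

/-- A smooth curve transverse to the `y`-axis direction is a graph. -/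
theorem exists_graph {f : Fn} (hf : AnalyticAt ℂ f 0) (h0 : f 0 = 0) (hY : dY f 0 ≠ 0) :
    ∃ ψ : ℂ → ℂ, AnalyticAt ℂ ψ 0 ∧ ψ 0 = 0 ∧ (∀ᶠ x in 𝓝 (0 : ℂ), f (x, ψ x) = 0) ∧
      ∀ᶠ p in 𝓝 (0 : ℂ × ℂ), f p = 0 → ψ p.1 = p.2 := by
  have hc : ContDiffAt ℂ ⊤ f 0 := hf.contDiffAt
  have inv : (fderiv ℂ f 0 ∘L .inr ℂ ℂ ℂ).IsInvertible := by
    refine ⟨ContinuousLinearEquiv.unitsEquivAut ℂ (Units.mk0 _ hY), ?_⟩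
    ext
    simp [dY]
  refine ⟨hc.implicitFunction (by simp) inv,
    (hc.contDiffAt_implicitFunction (by simp) inv).analyticAt, ?_, ?_, ?_⟩
  · exact hc.implicitFunction_apply_self (by simp) inv
  · simpa [h0] using hc.eventually_apply_implicitFunction (by simp) inv
  · filter_upwards [hc.eventually_apply_eq_iff_implicitFunction (by simp) inv] with p hp h
    exact hp.mp (h.trans h0.symm)

/-- The function `p ↦ (x, y - ψ x)` and its inverse are analytic. -/
theorem analyticAt_shear {ψ : ℂ → ℂ} (hψ : AnalyticAt ℂ ψ 0) :
    AnalyticAt ℂ (fun p : ℂ × ℂ => ((p.1, p.2 + ψ p.1) : ℂ × ℂ)) 0 ∧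
      AnalyticAt ℂ (fun p : ℂ × ℂ => ((p.1, p.2 - ψ p.1) : ℂ × ℂ)) 0 := by
  have h1 : AnalyticAt ℂ (fun p : ℂ × ℂ => ψ p.1) 0 :=
    hψ.comp_of_eq (f := fun p : ℂ × ℂ => p.1) analyticAt_fst rfl
  exact ⟨analyticAt_fst.prod (analyticAt_snd.add h1), analyticAt_fst.prod (analyticAt_snd.sub h1)⟩

/-- The shear `(x, y) ↦ (x, y + ψ x)` straightens the graph to the line `y = 0`. -/
theorem exists_eq_graph_mul {ψ : ℂ → ℂ} (hψ : AnalyticAt ℂ ψ 0) (hψ0 : ψ 0 = 0) {g : Fn}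
    (hg : AnalyticAt ℂ g 0) (h : ∀ᶠ x in 𝓝 (0 : ℂ), g (x, ψ x) = 0) :
    ∃ Q : Fn, AnalyticAt ℂ Q 0 ∧ ∀ᶠ p in 𝓝 (0 : ℂ × ℂ), g p = (p.2 - ψ p.1) * Q p := by
  obtain ⟨s1, s2⟩ := analyticAt_shear hψ
  obtain ⟨Q, hQ, e⟩ := exists_eq_snd_mul
    (G := fun p => g (p.1, p.2 + ψ p.1)) (hg.comp_of_eq s1 (by simp [hψ0])) (by simpa using h)
  refine ⟨fun p => Q (p.1, p.2 - ψ p.1), hQ.comp_of_eq s2 (by simp [hψ0]), ?_⟩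
  have ht : Tendsto (fun p : ℂ × ℂ => ((p.1, p.2 - ψ p.1) : ℂ × ℂ)) (𝓝 0) (𝓝 0) := by
    have := s2.continuousAt.tendsto
    simpa [hψ0, Prod.mk_zero_zero] using this
  filter_upwards [ht.eventually e] with p hp
  simpa using hp

/-- Both `f` and `g` are divisible by `y - ψ x`, and the cofactor of `f` is a unit because `∂f/∂y`
does not vanish at the origin. -/
theorem exists_eq_mul_of_dY_ne_zero {f g : Fn} (hf : AnalyticAt ℂ f 0) (h0 : f 0 = 0)
    (hY : dY f 0 ≠ 0) (hg : AnalyticAt ℂ g 0) (h : ∀ᶠ p in 𝓝 (0 : ℂ × ℂ), f p = 0 → g p = 0) :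
    ∃ Q : Fn, AnalyticAt ℂ Q 0 ∧ ∀ᶠ p in 𝓝 (0 : ℂ × ℂ), g p = f p * Q p := by
  obtain ⟨ψ, hψ, hψ0, h1, -⟩ := exists_graph hf h0 hY
  have ht : Tendsto (fun x : ℂ => ((x, ψ x) : ℂ × ℂ)) (𝓝 0) (𝓝 0) := by
    have : ContinuousAt (fun x : ℂ => ((x, ψ x) : ℂ × ℂ)) 0 :=
      continuousAt_id.prodMk hψ.continuousAt
    simpa [ContinuousAt, hψ0, Prod.mk_zero_zero] using this
  obtain ⟨A, hA, eA⟩ := exists_eq_graph_mul hψ hψ0 hf h1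
  obtain ⟨B, hB, eB⟩ := exists_eq_graph_mul hψ hψ0 hg
    (by filter_upwards [h1, ht.eventually h] with x hx hx'; exact hx' hx)
  have hu : AnalyticAt ℂ (fun p : ℂ × ℂ => p.2 - ψ p.1) 0 :=
    analyticAt_snd.comp (analyticAt_shear hψ).2
  have hA0 : A 0 ≠ 0 := by
    intro hA0
    apply hY
    rw [dY_congr eA, dY_mul hu hA, hA0]
    simp [hψ0]
  refine ⟨fun p => B p / A p, hB.div hA hA0, ?_⟩
  filter_upwards [eA, eB, hA.continuousAt.eventually_ne hA0] with p p1 p2 p3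
  rw [p1, p2]; field_simp

/-- Restricted to the parametrized curve, `g` and `h` are analytic in one variable, and their zeros
are isolated unless they vanish identically. -/
theorem eventually_zero_of_mul_of_dY_ne_zero {f g h : Fn} (hf : AnalyticAt ℂ f 0) (h0 : f 0 = 0)
    (hY : dY f 0 ≠ 0) (hg : AnalyticAt ℂ g 0) (hh : AnalyticAt ℂ h 0)
    (H : ∀ᶠ p in 𝓝 (0 : ℂ × ℂ), f p = 0 → g p * h p = 0) :
    (∀ᶠ p in 𝓝 (0 : ℂ × ℂ), f p = 0 → g p = 0) ∨
      ∀ᶠ p in 𝓝 (0 : ℂ × ℂ), f p = 0 → h p = 0 := by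
  obtain ⟨ψ, hψ, hψ0, h1, h2⟩ := exists_graph hf h0 hY
  have han : AnalyticAt ℂ (fun x : ℂ => ((x, ψ x) : ℂ × ℂ)) 0 := analyticAt_id.prod hψ
  have ht : Tendsto (fun x : ℂ => ((x, ψ x) : ℂ × ℂ)) (𝓝 0) (𝓝 0) := by
    simpa [ContinuousAt, hψ0, Prod.mk_zero_zero] using han.continuousAt
  have back : ∀ k : Fn, (∀ᶠ x in 𝓝 (0 : ℂ), k (x, ψ x) = 0) →
      ∀ᶠ p in 𝓝 (0 : ℂ × ℂ), f p = 0 → k p = 0 := by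
    intro k hk
    filter_upwards [h2, (continuous_fst.tendsto (0 : ℂ × ℂ)).eventually hk] with p hp hp' hfp
    rwa [hp hfp] at hp'
  have ag : AnalyticAt ℂ (fun x => g (x, ψ x)) 0 := hg.comp_of_eq han (by simp [hψ0])
  have ah : AnalyticAt ℂ (fun x => h (x, ψ x)) 0 := hh.comp_of_eq han (by simp [hψ0])
  rcases ag.eventually_eq_zero_or_eventually_ne_zero with eg | eg
  · exact Or.inl (back g eg)
  rcases ah.eventually_eq_zero_or_eventually_ne_zero with eh | eh
  · exact Or.inr (back h eh)
  exfalso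
  have H' := (h1.and (ht.eventually H)).filter_mono (nhdsWithin_le_nhds (s := {(0 : ℂ)}ᶜ))
  obtain ⟨x, hx1, hx2, hx3, hx4⟩ := (eg.and (eh.and H')).exists
  exact mul_ne_zero hx1 hx2 (hx4 hx3)

/-- Exchanging the coordinates reduces a curve with `∂f/∂x ≠ 0` to the case of a graph over the
`x`-axis. -/
theorem analyticAt_swap {g : Fn} (hg : AnalyticAt ℂ g 0) :
    AnalyticAt ℂ (fun p : ℂ × ℂ => g p.swap) 0 :=
  hg.comp_of_eq (f := fun p : ℂ × ℂ => p.swap) (analyticAt_snd.prod analyticAt_fst) rfl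

theorem tendsto_swap : Tendsto (Prod.swap : ℂ × ℂ → ℂ × ℂ) (𝓝 0) (𝓝 0) :=
  continuous_swap.tendsto' _ _ rfl

theorem dY_swap {f : Fn} (hf : AnalyticAt ℂ f 0) : dY (fun p : ℂ × ℂ => f p.swap) 0 = dX f 0 := by
  have h1 : HasFDerivAt (Prod.swap : ℂ × ℂ → ℂ × ℂ)
      ((ContinuousLinearMap.snd ℂ ℂ ℂ).prod (ContinuousLinearMap.fst ℂ ℂ ℂ)) 0 :=
    hasFDerivAt_snd.prodMk hasFDerivAt_fst
  have h2 := HasFDerivAt.comp (0 : ℂ × ℂ) (g := f) hf.differentiableAt.hasFDerivAt h1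
  show fderiv ℂ (f ∘ Prod.swap) 0 (0, 1) = _
  rw [h2.fderiv]
  rfl

theorem IsSmoothCurve.dX_or_dY {f : Fn} (hf : IsSmoothCurve f) : dY f 0 ≠ 0 ∨ dX f 0 ≠ 0 := by
  by_contra! hc
  apply hf.fderiv_ne_zero
  ext
  · simpa [dX] using hc.2
  · simpa [dY] using hc.1

/-- An analytic function which vanishes on a smooth curve is divisible by its equation. -/
theorem IsSmoothCurve.exists_eq_mul {f g : Fn} (hf : IsSmoothCurve f) (hg : AnalyticAt ℂ g 0)
    (h : ∀ᶠ p in 𝓝 (0 : ℂ × ℂ), f p = 0 → g p = 0) :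
    ∃ Q : Fn, AnalyticAt ℂ Q 0 ∧ ∀ᶠ p in 𝓝 (0 : ℂ × ℂ), g p = f p * Q p := by
  rcases hf.dX_or_dY with hY | hX
  · exact exists_eq_mul_of_dY_ne_zero hf.analytic hf.zero hY hg h
  · obtain ⟨Q, hQ, e⟩ := exists_eq_mul_of_dY_ne_zero (analyticAt_swap hf.analytic) hf.zero
      (by rwa [dY_swap hf.analytic]) (analyticAt_swap hg) (tendsto_swap.eventually h)
    refine ⟨_, analyticAt_swap hQ, ?_⟩
    filter_upwards [tendsto_swap.eventually e] with p hp
    simpa using hp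

/-- A germ of smooth curve is irreducible. -/
theorem IsSmoothCurve.eventually_zero_of_mul {f g h : Fn} (hf : IsSmoothCurve f)
    (hg : AnalyticAt ℂ g 0) (hh : AnalyticAt ℂ h 0)
    (H : ∀ᶠ p in 𝓝 (0 : ℂ × ℂ), f p = 0 → g p * h p = 0) :
    (∀ᶠ p in 𝓝 (0 : ℂ × ℂ), f p = 0 → g p = 0) ∨
      ∀ᶠ p in 𝓝 (0 : ℂ × ℂ), f p = 0 → h p = 0 := by
  rcases hf.dX_or_dY with hY | hX
  · exact eventually_zero_of_mul_of_dY_ne_zero hf.analytic hf.zero hY hg hh H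
  · have := eventually_zero_of_mul_of_dY_ne_zero (analyticAt_swap hf.analytic) hf.zero
      (by rwa [dY_swap hf.analytic]) (analyticAt_swap hg) (analyticAt_swap hh)
      (tendsto_swap.eventually H)
    exact this.imp (fun k => by simpa using tendsto_swap.eventually k)
      (fun k => by simpa using tendsto_swap.eventually k)

/-- The complement of a smooth curve is dense. -/
theorem IsSmoothCurve.eventually_frequently {f : Fn} (hf : IsSmoothCurve f) :
    ∀ᶠ p in 𝓝 (0 : ℂ × ℂ), ∃ᶠ q in 𝓝 p, f q ≠ 0 := by
  filter_upwards [hf.analytic.fderiv.continuousAt.eventually_ne hf.fderiv_ne_zero] with p hp h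
  apply hp
  have : f =ᶠ[𝓝 p] fun _ => 0 := by filter_upwards [h] with q hq; simpa using hq
  rw [this.fderiv_eq]; simp

end Division

/-! ### Matching two factorizations of the same form -/

section Matching

theorem det2_eq_zero_trans {m x y : ℂ × ℂ} (hm : m ≠ 0) (hx : det2 m x = 0) (hy : det2 m y = 0) :
    det2 x y = 0 := by
  have h1 : m.1 * det2 x y = 0 := by
    simp only [det2] at *; linear_combination x.1 * hy - y.1 * hx
  have h2 : m.2 * det2 x y = 0 := by
    simp only [det2] at *; linear_combination x.2 * hy - y.2 * hx
  by_contra hc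
  apply hm
  ext
  · simpa [hc] using h1
  · simpa [hc] using h2

theorem exists_smul_of_det2_eq_zero {m x : ℂ × ℂ} (hx : x ≠ 0) (h : det2 m x = 0) :
    ∃ c : ℂ, m = c • x := by
  simp only [det2] at h
  by_cases h1 : x.1 = 0
  · have h2 : x.2 ≠ 0 := fun h2 => hx (Prod.ext h1 h2)
    refine ⟨m.2 / x.2, Prod.ext ?_ ?_⟩
    · have : m.1 = 0 := by simpa [h1, h2] using h
      simp [h1, this]
    · simp [h2]
  · refine ⟨m.1 / x.1, Prod.ext ?_ ?_⟩
    · simp [h1]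
    · simp only [Prod.smul_snd, smul_eq_mul]; field_simp; linear_combination -h

/-- Two of the pairwise independent `g i` cannot be proportional to the same nonzero `m j`, so the
choice of `j` is injective, hence bijective by counting. -/
theorem exists_equiv_of_roots {ι κ : Type*} [Fintype ι] [Fintype κ]
    (hcard : Fintype.card ι = Fintype.card κ) (m : κ → ℂ × ℂ) (g : ι → ℂ × ℂ) (hm : ∀ j, m j ≠ 0)
    (hg : ∀ i i', i ≠ i' → det2 (g i) (g i') ≠ 0) (h : ∀ i, ∃ j, det2 (m j) (g i) = 0) :
    ∃ e : ι ≃ κ, ∀ i, det2 (m (e i)) (g i) = 0 := by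
  choose σ hσ using h
  have inj : Function.Injective σ := by
    intro i i' hii
    by_contra hne
    have h1 := hσ i
    rw [hii] at h1
    exact hg i i' hne (det2_eq_zero_trans (hm (σ i')) h1 (hσ i'))
  exact ⟨Equiv.ofBijective σ ((Fintype.bijective_iff_injective_and_card σ).mpr ⟨inj, hcard⟩), hσ⟩

/-- Evaluation on the kernel vector of `g` detects whether `g` is proportional to one of the
factors. -/
theorem ev_prod_lin_ker {ι : Type*} [Fintype ι] (l : ι → ℂ × ℂ) (g : ℂ × ℂ) :
    ev (∏ i, lin (l i)) (g.2, -g.1) = ∏ i, det2 (l i) g := by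
  rw [ev_prod]
  refine Finset.prod_congr rfl fun i _ => ?_
  rw [ev_lin, det2]; ring

theorem lin_smul (c : ℂ) (l : ℂ × ℂ) : lin (c • l) = MvPolynomial.C c * lin l := by
  simp [lin]; ring

theorem eq_C_mul_prod_of_roots {n : ℕ} (hn : 1 ≤ n) {F : Form} (hF : F.IsHomogeneous n)
    (g : Fin n → ℂ × ℂ) (hg0 : ∀ i, g i ≠ 0) (hg : ∀ i i', i ≠ i' → det2 (g i) (g i') ≠ 0)
    (h : ∀ i, ev F ((g i).2, -(g i).1) = 0) :
    ∃ c : ℂ, F = MvPolynomial.C c * ∏ i, lin (g i) := by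
  by_cases hF0 : F = 0
  · exact ⟨0, by simp [hF0]⟩
  obtain ⟨m, rfl⟩ := exists_eq_prod_lin hn hF
  have hm : ∀ j, m j ≠ 0 := by
    intro j hj
    apply hF0
    apply Finset.prod_eq_zero (Finset.mem_univ j)
    simp [hj, lin]
  obtain ⟨e, he⟩ := exists_equiv_of_roots rfl m g hm hg fun i => by
    have := h i
    rw [ev_prod_lin_ker, Finset.prod_eq_zero_iff] at this
    obtain ⟨j, _, hj⟩ := this
    exact ⟨j, hj⟩
  choose c hc using fun i => exists_smul_of_det2_eq_zero (hg0 i) (he i)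
  refine ⟨∏ i, c i, ?_⟩
  rw [← Equiv.prod_comp e fun j => lin (m j), map_prod, ← Finset.prod_mul_distrib]
  exact Finset.prod_congr rfl fun i _ => by rw [hc i, lin_smul]

/-- The coefficients of a `1`-form at a point. -/
def OneForm.vec (α : OneForm) (p : ℂ × ℂ) : ℂ × ℂ := (α.a p, α.b p)

theorem OneForm.toForm_eq_lin (α : OneForm) (p : ℂ × ℂ) : α.toForm p = lin (α.vec p) := rfl

theorem OneForm.wedge_eq_det2 (α β : OneForm) (p : ℂ × ℂ) :
    α.wedge β p = det2 (α.vec p) (β.vec p) := rfl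

/-- Two local decompositions of a web into foliations agree. -/
theorem exists_matching {ι κ : Type*} [Fintype ι] [Fintype κ] {p : ℂ × ℂ}
    (hcard : Fintype.card ι = Fintype.card κ) {α : ι → OneForm} {β : κ → OneForm}
    (hα : ∀ i, (α i).Holo p) (hβ : ∀ j, (β j).Holo p)
    (hαi : ∀ i i', i ≠ i' → (α i).wedge (α i') p ≠ 0)
    (hβi : ∀ j j', j ≠ j' → (β j).wedge (β j') p ≠ 0)
    (hα0 : ∀ i, (α i).vec p ≠ 0) (hβ0 : ∀ j, (β j).vec p ≠ 0)
    (h : ∀ᶠ q in 𝓝 p, ∏ i, (α i).toForm q = ∏ j, (β j).toForm q) :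
    ∃ e : ι ≃ κ, ∀ i, ∀ᶠ q in 𝓝 p, (β (e i)).wedge (α i) q = 0 := by
  have hz : ∀ i, ∀ᶠ q in 𝓝 p, ∏ j, (β j).wedge (α i) q = 0 := by
    intro i
    filter_upwards [h] with q hq
    have := congrArg (fun F => ev F ((α i).b q, -(α i).a q)) hq
    simp only [OneForm.toForm_eq_lin] at this
    have e1 : ev (∏ j, lin ((α j).vec q)) (((α i).vec q).2, -((α i).vec q).1) = 0 := by
      rw [ev_prod_lin_ker]
      exact Finset.prod_eq_zero (Finset.mem_univ i) (by simp only [det2]; ring)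
    have e2 := ev_prod_lin_ker (fun j => (β j).vec q) ((α i).vec q)
    simp only [OneForm.wedge_eq_det2]
    rw [← e2, ← e1]
    exact this.symm
  obtain ⟨e, he⟩ := exists_equiv_of_roots hcard (fun j => (β j).vec p) (fun i => (α i).vec p)
    hβ0 hαi fun i => by
      have := (hz i).self_of_nhds
      rw [Finset.prod_eq_zero_iff] at this
      obtain ⟨j, _, hj⟩ := this
      exact ⟨j, hj⟩
  refine ⟨e, fun i => ?_⟩
  classical
  -- At `p` only the factor `e i` is proportional to `α i`. The others stay independent of it
  -- nearby, so the vanishing product forces this one factor to vanish on a neighbourhood.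
  have hne : ∀ j, j ≠ e i → ∀ᶠ q in 𝓝 p, (β j).wedge (α i) q ≠ 0 := by
    intro j hj
    apply ((hβ j).wedge (hα i)).continuousAt.eventually_ne
    intro h0
    refine hβi j (e i) hj (?_ : det2 ((β j).vec p) ((β (e i)).vec p) = 0)
    refine det2_eq_zero_trans (hα0 i) ?_ ?_
    · rw [det2_neg]; exact neg_eq_zero.mpr h0
    · rw [det2_neg]; exact neg_eq_zero.mpr (he i)
  have hall : ∀ᶠ q in 𝓝 p, ∀ j, j ≠ e i → (β j).wedge (α i) q ≠ 0 := by
    rw [eventually_all]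
    intro j
    by_cases hj : j = e i
    · exact Eventually.of_forall fun q hq => absurd hj hq
    · exact (hne j hj).mono fun q hq _ => hq
  filter_upwards [hz i, hall] with q h1 h2
  rw [Finset.prod_eq_zero_iff] at h1
  obtain ⟨j, _, hj⟩ := h1
  by_cases hje : j = e i
  · rwa [hje] at hj
  · exact absurd hj (h2 j hje)

end Matching

/-! ### Holomorphic factorization away from multiple roots -/

section LocalFactorization

theorem analyticAt_ev {E : Type*} [NormedAddCommGroup E] [NormedSpace ℂ E] {x : E} {n : ℕ}
    {W : E → Form} {v : E → ℂ × ℂ} (hW : ∀ᶠ y in 𝓝 x, (W y).IsHomogeneous n)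
    (hc : ∀ m, AnalyticAt ℂ (fun y => (W y).coeff m) x) (hv : AnalyticAt ℂ v x) :
    AnalyticAt ℂ (fun y => ev (W y) (v y)) x := by
  have e : ∀ (w : ℂ × ℂ) (m : Fin 2 →₀ ℕ),
      ev (MvPolynomial.monomial m 1) w = w.1 ^ m 0 * w.2 ^ m 1 := by
    intro w m
    simp [ev, MvPolynomial.eval_monomial, Finsupp.prod_fintype, Fin.prod_univ_two]
  have h : (fun y => ev (W y) (v y)) =ᶠ[𝓝 x] fun y =>
      ∑ m ∈ (Finset.univ : Finset (Fin 2)).finsuppAntidiag n,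
        (W y).coeff m * ((v y).1 ^ m 0 * (v y).2 ^ m 1) := by
    filter_upwards [hW] with y hy
    have := linearMap_eq_sum hy
      (MvPolynomial.aeval ![(v y).1, (v y).2] : Form →ₐ[ℂ] ℂ).toLinearMap
    simp only [AlgHom.toLinearMap_apply, smul_eq_mul] at this
    refine Eq.trans this ?_
    exact Finset.sum_congr rfl fun m _ => by rw [← e]; rfl
  refine AnalyticAt.congr ?_ h.symm
  have h1 : AnalyticAt ℂ (fun y => (v y).1) x := analyticAt_fst.comp hv
  have h2 : AnalyticAt ℂ (fun y => (v y).2) x := analyticAt_snd.comp hv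
  exact Finset.analyticAt_fun_sum _ fun m _ => (hc m).mul ((h1.pow _).mul (h2.pow _))

/-- The implicit function theorem, applied to the value of `W q` on the kernel vector of `l i`
displaced by `t` in a transverse direction: a simple root has nonzero derivative in `t`. -/
theorem exists_root_branch {n : ℕ} {W : ℂ × ℂ → Form} {p : ℂ × ℂ}
    (hom : ∀ᶠ q in 𝓝 p, (W q).IsHomogeneous n)
    (an : ∀ m, AnalyticAt ℂ (fun q => (W q).coeff m) p) (l : Fin n → ℂ × ℂ)
    (hl : W p = ∏ i, lin (l i)) (hl0 : ∀ i, l i ≠ 0)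
    (hli : ∀ i j, i ≠ j → det2 (l i) (l j) ≠ 0) (i : Fin n) :
    ∃ γ : OneForm, γ.Holo p ∧ γ.vec p = l i ∧ ∀ᶠ q in 𝓝 p, ev (W q) (γ.b q, -γ.a q) = 0 := by
  -- With the conjugate vector, `l i` takes the value `|l₁|² + |l₂|² ≠ 0` on `e`, so `e` is
  -- transverse to the kernel of `l i`.
  set e : ℂ × ℂ := (star (l i).1, star (l i).2) with he
  have hne : (l i).1 * e.1 + (l i).2 * e.2 ≠ 0 := by
    simp only [he, Complex.star_def, Complex.mul_conj]
    norm_cast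
    intro h0
    have h1 := Complex.normSq_nonneg (l i).1
    have h2 := Complex.normSq_nonneg (l i).2
    apply hl0 i
    ext
    · exact Complex.normSq_eq_zero.mp (by linarith)
    · exact Complex.normSq_eq_zero.mp (by linarith)
  set Φ : (ℂ × ℂ) × ℂ → ℂ :=
    fun y => ev (W y.1) ((l i).2 + y.2 * e.1, -(l i).1 + y.2 * e.2) with hΦ
  have hΦan : AnalyticAt ℂ Φ (p, 0) := by
    refine analyticAt_ev (W := fun y : (ℂ × ℂ) × ℂ => W y.1) (n := n) ?_ ?_ ?_
    · exact (continuous_fst.tendsto (p, (0 : ℂ))).eventually hom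
    · exact fun m => (an m).comp_of_eq analyticAt_fst rfl
    · exact (analyticAt_const.add (analyticAt_snd.mul analyticAt_const)).prod
        (analyticAt_const.add (analyticAt_snd.mul analyticAt_const))
  have hΦp : ∀ t, Φ (p, t) = ∏ j, (det2 (l j) (l i) + t * ((l j).1 * e.1 + (l j).2 * e.2)) := by
    intro t
    simp only [hΦ, hl, ev_prod, ev_lin, det2]
    exact Finset.prod_congr rfl fun j _ => by ring
  have hΦ0 : Φ (p, 0) = 0 := by
    rw [hΦp]
    apply Finset.prod_eq_zero (Finset.mem_univ i)
    simp only [det2]; ring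
  have hd : fderiv ℂ Φ (p, 0) (0, 1) ≠ 0 := by
    have h1 : HasDerivAt (fun t : ℂ => ((p, t) : (ℂ × ℂ) × ℂ)) (0, 1) 0 :=
      (hasDerivAt_const (0 : ℂ) p).prodMk (hasDerivAt_id (0 : ℂ))
    have h2 := hΦan.differentiableAt.hasFDerivAt.comp_hasDerivAt (0 : ℂ) h1
    -- The `i`-th factor equals `t` times a nonzero constant; `ψ` is what remains, and it is nonzero
    -- at `t = 0` because the roots are distinct.
    set ψ : ℂ → ℂ := fun t => ((l i).1 * e.1 + (l i).2 * e.2) *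
      ∏ j ∈ Finset.univ.erase i, (det2 (l j) (l i) + t * ((l j).1 * e.1 + (l j).2 * e.2)) with hψ
    have h3 : Φ ∘ (fun t : ℂ => ((p, t) : (ℂ × ℂ) × ℂ)) = fun t => t * ψ t := by
      ext t
      simp only [Function.comp, hΦp, hψ]
      rw [← Finset.mul_prod_erase Finset.univ _ (Finset.mem_univ i)]
      have : det2 (l i) (l i) = 0 := by simp only [det2]; ring
      rw [this]; ring
    have hψd : DifferentiableAt ℂ ψ 0 := by
      refine DifferentiableAt.const_mul (DifferentiableAt.fun_finsetProd fun j _ => ?_) _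
      fun_prop
    have h4 : HasDerivAt (fun t => t * ψ t) (ψ 0) 0 := by
      simpa using (hasDerivAt_id' (0 : ℂ)).fun_mul hψd.hasDerivAt
    rw [h3] at h2
    rw [h2.unique h4]
    refine mul_ne_zero hne (Finset.prod_ne_zero_iff.mpr fun j hj => ?_)
    simpa using hli j i (Finset.ne_of_mem_erase hj)
  have hc : ContDiffAt ℂ ⊤ Φ (p, 0) := hΦan.contDiffAt
  have inv : (fderiv ℂ Φ (p, 0) ∘L .inr ℂ (ℂ × ℂ) ℂ).IsInvertible := by
    refine ⟨ContinuousLinearEquiv.unitsEquivAut ℂ (Units.mk0 _ hd), ?_⟩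
    ext
    simp
  set τ := hc.implicitFunction (by simp) inv
  have hτ : AnalyticAt ℂ τ p := (hc.contDiffAt_implicitFunction (by simp) inv).analyticAt
  have hτ0 : τ p = 0 := hc.implicitFunction_apply_self (by simp) inv
  have hτe : ∀ᶠ q in 𝓝 p, Φ (q, τ q) = Φ (p, 0) :=
    hc.eventually_apply_implicitFunction (by simp) inv
  refine ⟨⟨fun q => (l i).1 - τ q * e.2, fun q => (l i).2 + τ q * e.1⟩,
    ⟨analyticAt_const.sub (hτ.mul analyticAt_const),
      analyticAt_const.add (hτ.mul analyticAt_const)⟩, ?_, ?_⟩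
  · simp [OneForm.vec, hτ0]
  · filter_upwards [hτe] with q hq
    rw [hΦ0] at hq
    simp only [hΦ] at hq
    rw [← hq]
    congr 2
    ring

/-- Near a point where its roots are distinct, a symmetric form is a product of `1`-forms. -/
theorem exists_local_factorization {n : ℕ} (hn : 1 ≤ n) {W : ℂ × ℂ → Form} {p : ℂ × ℂ}
    (hom : ∀ᶠ q in 𝓝 p, (W q).IsHomogeneous n)
    (an : ∀ m, AnalyticAt ℂ (fun q => (W q).coeff m) p) (hd : disc n (W p) ≠ 0) (h0 : W p ≠ 0) :
    ∃ γ : Fin n → OneForm, (∀ i, (γ i).Holo p) ∧ (∀ᶠ q in 𝓝 p, W q = ∏ i, (γ i).toForm q) := by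
  obtain ⟨l, hl⟩ := exists_eq_prod_lin hn hom.self_of_nhds
  have hl0 : ∀ i, l i ≠ 0 := by
    intro i hi
    apply h0
    rw [hl]
    apply Finset.prod_eq_zero (Finset.mem_univ i)
    simp [hi, lin]
  have hli : ∀ i j, i ≠ j → det2 (l i) (l j) ≠ 0 := by
    rw [hl] at hd
    exact (disc_ne_zero_iff hn (by simp) l).mp hd
  choose γ hγ hγl hγr using exists_root_branch hom an l hl hl0 hli
  have hprod0 : (∏ i, lin (l i)) ≠ 0 := hl ▸ h0
  -- The product of the branches is proportional to `W q`. Evaluating on a fixed vector outside all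
  -- the lines exhibits the factor as a quotient of analytic functions.
  obtain ⟨e, he⟩ : ∃ e, ev (∏ i, lin (l i)) e ≠ 0 := by
    by_contra! hc
    apply hprod0
    apply form_ext
    intro v
    rw [hc v]; simp [ev]
  have hden : AnalyticAt ℂ (fun q => ∏ i, ev ((γ i).toForm q) e) p := by
    refine Finset.analyticAt_fun_prod _ fun i _ => ?_
    simp only [OneForm.toForm_eq_lin, ev_lin, OneForm.vec]
    exact ((hγ i).1.mul analyticAt_const).add ((hγ i).2.mul analyticAt_const)
  have hden0 : ∏ i, ev ((γ i).toForm p) e ≠ 0 := by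
    simp only [OneForm.toForm_eq_lin, hγl, ← ev_prod]; exact he
  set c : Fn := fun q => ev (W q) e / ∏ i, ev ((γ i).toForm q) e with hc
  have hcan : AnalyticAt ℂ c p := (analyticAt_ev hom an analyticAt_const).div hden hden0
  have key : ∀ᶠ q in 𝓝 p, W q = MvPolynomial.C (c q) * ∏ i, (γ i).toForm q := by
    have hind : ∀ᶠ q in 𝓝 p, ∀ i j, i ≠ j → (γ i).wedge (γ j) q ≠ 0 := by
      simp only [eventually_all]
      intro i j hij
      apply ((hγ i).wedge (hγ j)).continuousAt.eventually_ne
      rw [OneForm.wedge_eq_det2, hγl, hγl]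
      exact hli i j hij
    have hnz : ∀ᶠ q in 𝓝 p, ∀ i, (γ i).vec q ≠ 0 := by
      rw [eventually_all]
      intro i
      have : ContinuousAt (γ i).vec p := (hγ i).1.continuousAt.prodMk (hγ i).2.continuousAt
      apply this.eventually_ne
      rw [hγl]; exact hl0 i
    filter_upwards [hom, hind, hnz, eventually_all.mpr hγr, hden.continuousAt.eventually_ne hden0]
      with q q1 q2 q3 q4 q5
    obtain ⟨d, hdq⟩ := eq_C_mul_prod_of_roots hn q1 (fun i => (γ i).vec q) q3 q2 q4
    have : c q = d := by
      simp only [hc]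
      rw [div_eq_iff q5, hdq, ev_mul, ev_C, ev_prod]
      rfl
    rw [this]; exact hdq
  obtain ⟨m, rfl⟩ : ∃ m, n = m + 1 := ⟨n - 1, by omega⟩
  refine ⟨Fin.cons (OneForm.smul c (γ 0)) fun i => γ i.succ, ?_, ?_⟩
  · intro i
    refine Fin.cases ?_ (fun i => ?_) i
    · exact (hγ 0).smul hcan
    · exact hγ i.succ
  · filter_upwards [key] with q hq
    rw [hq, Fin.prod_univ_succ, Fin.prod_univ_succ, ← mul_assoc]
    congr 1
    simp only [Fin.cons_zero, OneForm.toForm, OneForm.smul, Pi.mul_apply, map_mul]; ring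

end LocalFactorization

/-! ### The curvature of a web as a sum over triples -/

section TripleSums

/-- Each triple of distinct indices has six orderings, and repeated indices contribute nothing. The
sum over all triples refers to no order, so it can be carried along any bijection of the index sets.
-/
theorem six_mul_sum_lt {ι : Type*} [Fintype ι] [LinearOrder ι] [LocallyFiniteOrderTop ι]
    (T : ι → ι → ι → ℂ) (hrot : ∀ x y z, T x y z = T y z x) (hswap : ∀ x y z, T x y z = T y x z)
    (hzero : ∀ x y, T x x y = 0) :
    6 * ∑ r, ∑ s ∈ Finset.Ioi r, ∑ t ∈ Finset.Ioi s, T r s t = ∑ r, ∑ s, ∑ t, T r s t := by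
  classical
  set S : ι → ι → ι → ℂ := fun r s t => if r < s ∧ s < t then T r s t else 0 with hS
  have h1 : ∑ r, ∑ s ∈ Finset.Ioi r, ∑ t ∈ Finset.Ioi s, T r s t = ∑ r, ∑ s, ∑ t, S r s t := by
    refine Finset.sum_congr rfl fun r _ => ?_
    have e : ∀ a : ι, Finset.Ioi a = Finset.univ.filter fun b => a < b := fun a => by ext; simp
    simp only [e, Finset.sum_filter, hS]
    refine Finset.sum_congr rfl fun s _ => ?_
    split_ifs with h
    · simp [h]
    · simp [h]
  have h2 : ∀ r s t, T r s t = S r s t + S r t s + S s r t + S s t r + S t r s + S t s r := by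
    intro r s t
    have e1 : T r t s = T r s t := by rw [hswap, hrot]
    have e2 : T s r t = T r s t := (hswap r s t).symm
    have e3 : T s t r = T r s t := (hrot r s t).symm
    have e4 : T t r s = T r s t := hrot t r s
    have e5 : T t s r = T r s t := by rw [hswap, e3]
    simp only [hS, e1, e2, e3, e4, e5]
    by_cases hrs : r = s
    · subst hrs; simp [hzero]
    by_cases hst : s = t
    · subst hst; rw [hrot, hzero]; simp
    by_cases hrt : r = t
    · subst hrt; rw [← e2, hrot, hzero]; simp
    rcases lt_or_gt_of_ne hrs with a | a <;> rcases lt_or_gt_of_ne hst with b | b <;>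
      rcases lt_or_gt_of_ne hrt with c | c <;>
      first
        | (exfalso; order)
        | simp [a, b, c, not_lt_of_gt a, not_lt_of_gt b, not_lt_of_gt c]
  have c1 : ∑ r, ∑ s, ∑ t, S r t s = ∑ r, ∑ s, ∑ t, S r s t :=
    Finset.sum_congr rfl fun r _ => Finset.sum_comm
  have c2 : ∑ r, ∑ s, ∑ t, S s r t = ∑ r, ∑ s, ∑ t, S r s t := Finset.sum_comm
  have c3 : ∑ r, ∑ s, ∑ t, S s t r = ∑ r, ∑ s, ∑ t, S r s t := by
    rw [Finset.sum_comm]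
    exact Finset.sum_congr rfl fun r _ => Finset.sum_comm
  have c4 : ∑ r, ∑ s, ∑ t, S t r s = ∑ r, ∑ s, ∑ t, S r s t := by
    rw [← c3]
    rw [Finset.sum_comm, c3]
    have : ∀ y, ∑ x, ∑ t, S t x y = ∑ t, ∑ x, S t x y := fun y => Finset.sum_comm
    simp_rw [this]
    rw [Finset.sum_comm]
    exact Finset.sum_congr rfl fun r _ => Finset.sum_comm
  have c5 : ∑ r, ∑ s, ∑ t, S t s r = ∑ r, ∑ s, ∑ t, S r s t := by
    rw [← c4, Finset.sum_comm]
  rw [h1]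
  simp_rw [h2, Finset.sum_add_distrib]
  rw [c1, c2, c3, c4, c5]
  ring

/-- Triples are sorted by the number of indices in `Fin 2`; three of them would repeat. The factor 6
counts the orderings of `0, 1, i`, and the factor 3 the position of the index from `Fin 2` beside an
ordered pair `i, j`. -/
theorem sum_triples_sum_type {κ : Type*} [Fintype κ]
    (T : Fin 2 ⊕ κ → Fin 2 ⊕ κ → Fin 2 ⊕ κ → ℂ) (hrot : ∀ x y z, T x y z = T y z x)
    (hswap : ∀ x y z, T x y z = T y x z) (hzero : ∀ x y, T x x y = 0) :
    ∑ x, ∑ y, ∑ z, T x y z = 6 * ∑ i, T (.inl 0) (.inl 1) (.inr i) +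
      3 * ∑ i, ∑ j, (T (.inl 0) (.inr i) (.inr j) + T (.inl 1) (.inr i) (.inr j)) +
      ∑ i, ∑ j, ∑ l, T (.inr i) (.inr j) (.inr l) := by
  have z2 : ∀ x y, T y x x = 0 := fun x y => by rw [hrot, hzero]
  have z3 : ∀ x y, T x y x = 0 := fun x y => by rw [hswap, hrot, hzero]
  have m1 : ∀ i, T (.inl 1) (.inl 0) (.inr i) = T (.inl 0) (.inl 1) (.inr i) := fun i => hswap _ _ _
  have m2 : ∀ (a b : Fin 2) i, T (.inl a) (.inr i) (.inl b) = T (.inl b) (.inl a) (.inr i) :=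
    fun a b i => by rw [hrot (.inl b)]
  have m3 : ∀ (a b : Fin 2) i, T (.inr i) (.inl a) (.inl b) = T (.inl a) (.inl b) (.inr i) :=
    fun a b i => by rw [hrot]
  have m4 : ∀ (a : Fin 2) i j, T (.inr i) (.inl a) (.inr j) = T (.inl a) (.inr i) (.inr j) :=
    fun a i j => hswap _ _ _
  have m5 : ∀ (a : Fin 2) i j, T (.inr i) (.inr j) (.inl a) = T (.inl a) (.inr i) (.inr j) :=
    fun a i j => by rw [hrot (.inl a)]
  simp only [Fintype.sum_sum_type, Fin.sum_univ_two, hzero, z2, z3, m2, m3, m4, m5, m1,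
    Finset.sum_add_distrib, Finset.sum_const_zero]
  ring

theorem vec_ne_zero_of_wedge_ne {ι : Type*} [Fintype ι] {α : ι → OneForm} {p : ℂ × ℂ}
    (hcard : 2 ≤ Fintype.card ι)
    (hi : ∀ i j, i ≠ j → (α i).wedge (α j) p ≠ 0) (i : ι) : (α i).vec p ≠ 0 := by
  intro h0
  obtain ⟨j, hij⟩ := Fintype.exists_ne_of_one_lt_card (by omega) i
  apply hi j i hij
  rw [OneForm.wedge_eq_det2, h0]
  simp [det2]

variable {ι : Type*} [DecidableEq ι]

/-- The curvature at `p` of the `3`-subweb of the foliations indexed by `i`, `j`, `l`. -/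
def tripleCurv (α : ι → OneForm) (p : ℂ × ℂ) (i j l : ι) : ℂ :=
  if i ≠ j ∧ j ≠ l ∧ l ≠ i then (eta (α i) (α j) (α l)).d p else 0

variable {α : ι → OneForm} {p : ℂ × ℂ}

theorem tripleCurv_rotate (hα : ∀ i, (α i).Holo p)
    (hi : ∀ i j, i ≠ j → (α i).wedge (α j) p ≠ 0) (i j l : ι) :
    tripleCurv α p i j l = tripleCurv α p j l i := by
  unfold tripleCurv
  by_cases h : i ≠ j ∧ j ≠ l ∧ l ≠ i
  · rw [if_pos h, if_pos ⟨h.2.1, h.2.2, h.1⟩]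
    exact eta_rotate_d (hα i) (hα j) (hα l) (hi _ _ h.1) (hi _ _ h.2.1) (hi _ _ h.2.2)
  · rw [if_neg h, if_neg (fun h' => h ⟨h'.2.2, h'.1, h'.2.1⟩)]

theorem tripleCurv_swap (hα : ∀ i, (α i).Holo p)
    (hi : ∀ i j, i ≠ j → (α i).wedge (α j) p ≠ 0) (i j l : ι) :
    tripleCurv α p i j l = tripleCurv α p j i l := by
  unfold tripleCurv
  by_cases h : i ≠ j ∧ j ≠ l ∧ l ≠ i
  · rw [if_pos h, if_pos ⟨h.1.symm, h.2.2.symm, h.2.1.symm⟩]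
    exact eta_swap_d (hα i) (hα j) (hα l) (hi _ _ h.1) (hi _ _ h.2.1) (hi _ _ h.2.2)
  · rw [if_neg h, if_neg (fun h' => h ⟨h'.1.symm, h'.2.2.symm, h'.2.1.symm⟩)]

theorem tripleCurv_self (i j : ι) : tripleCurv α p i i j = 0 := by simp [tripleCurv]

theorem sum_tripleCurv_eq [Fintype ι] {κ : Type*} [Fintype κ] [DecidableEq κ] {β : κ → OneForm}
    (hα : ∀ i, (α i).Holo p) (hβ : ∀ i, (β i).Holo p)
    (hi : ∀ i j, i ≠ j → (α i).wedge (α j) p ≠ 0) (hj : ∀ i j, i ≠ j → (β i).wedge (β j) p ≠ 0)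
    (e : ι ≃ κ) (he : ∀ i, ∀ᶠ q in 𝓝 p, (β (e i)).wedge (α i) q = 0) :
    ∑ i, ∑ j, ∑ l, tripleCurv α p i j l = ∑ i, ∑ j, ∑ l, tripleCurv β p i j l := by
  rw [← e.sum_comp]
  refine Finset.sum_congr rfl fun i _ => ?_
  rw [← e.sum_comp]
  refine Finset.sum_congr rfl fun j _ => ?_
  rw [← e.sum_comp]
  refine Finset.sum_congr rfl fun l _ => ?_
  unfold tripleCurv
  by_cases h : i ≠ j ∧ j ≠ l ∧ l ≠ i
  · have h' : e i ≠ e j ∧ e j ≠ e l ∧ e l ≠ e i :=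
      ⟨e.injective.ne h.1, e.injective.ne h.2.1, e.injective.ne h.2.2⟩
    rw [if_pos h, if_pos h']
    exact eta_d_congr (hα i) (hα j) (hα l) (hβ _) (hβ _) (hβ _) (hi _ _ h.1) (hi _ _ h.2.1)
      (hi _ _ h.2.2) (hj _ _ h'.1) (hj _ _ h'.2.1) (hj _ _ h'.2.2) (he i) (he j) (he l)
  · rw [if_neg h, if_neg (fun h' => h ⟨fun x => h'.1 (congrArg e x),
      fun x => h'.2.1 (congrArg e x), fun x => h'.2.2 (congrArg e x)⟩)]

/-- The curvature of a web, computed with any local decomposition into foliations. -/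
theorem curvatureAt_iff [Fintype ι] {n : ℕ} (hn : 2 ≤ n) (hcard : Fintype.card ι = n) {W : ℂ × ℂ → Form}
    (hα : ∀ i, (α i).Holo p) (hi : ∀ i j, i ≠ j → (α i).wedge (α j) p ≠ 0)
    (hW : ∀ᶠ q in 𝓝 p, W q = ∏ i, (α i).toForm q) (κ : ℂ) :
    CurvatureAt n W p κ ↔ 6 * κ = ∑ i, ∑ j, ∑ l, tripleCurv α p i j l := by
  have key : ∀ β : Fin n → OneForm, (∀ i, (β i).Holo p) →
      (∀ i j, i ≠ j → (β i).wedge (β j) p ≠ 0) →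
      (∀ᶠ q in 𝓝 p, W q = ∏ i, (β i).toForm q) →
      6 * ∑ r, ∑ s ∈ Finset.Ioi r, ∑ t ∈ Finset.Ioi s, (eta (β r) (β s) (β t)).d p =
        ∑ i, ∑ j, ∑ l, tripleCurv α p i j l := by
    intro β hβ hj hWβ
    obtain ⟨e, he⟩ := exists_matching (by simp [hcard]) hβ hα hj hi (vec_ne_zero_of_wedge_ne (by simpa) hj)
      (vec_ne_zero_of_wedge_ne (by omega) hi) (by filter_upwards [hW, hWβ] with q h1 h2; rw [← h1, h2])
    rw [← sum_tripleCurv_eq hβ hα hj hi e he, ← six_mul_sum_lt (tripleCurv β p)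
      (tripleCurv_rotate hβ hj) (tripleCurv_swap hβ hj) tripleCurv_self]
    congr 1
    refine Finset.sum_congr rfl fun r _ => Finset.sum_congr rfl fun s hs =>
      Finset.sum_congr rfl fun t ht => ?_
    rw [Finset.mem_Ioi] at hs ht
    rw [tripleCurv, if_pos ⟨hs.ne, ht.ne, (hs.trans ht).ne'⟩]
  constructor
  · rintro ⟨β, hβ, hWβ, η, hη, rfl⟩
    -- Independence of the given factors means nonzero discriminant of `W p`, which in turn gives
    -- independence of the factors `β`.
    have hdisc : disc n (W p) ≠ 0 := by
      rw [hW.self_of_nhds]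
      exact (disc_ne_zero_iff (by omega) hcard fun i => (α i).vec p).mpr hi
    have hj : ∀ i j, i ≠ j → (β i).wedge (β j) p ≠ 0 := by
      rw [hWβ.self_of_nhds] at hdisc
      exact (disc_ne_zero_iff (by omega) (by simp) fun i => (β i).vec p).mp hdisc
    rw [← key β hβ hj hWβ]
    congr 1
    refine Finset.sum_congr rfl fun r _ => Finset.sum_congr rfl fun s hs =>
      Finset.sum_congr rfl fun t ht => ?_
    rw [Finset.mem_Ioi] at hs ht
    exact (hη r s t hs ht).d_eq_eta (hβ r) (hβ s) (hβ t) (hj _ _ hs.ne) (hj _ _ ht.ne)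
      (hj _ _ (hs.trans ht).ne')
  · intro h
    obtain ⟨e⟩ : Nonempty (Fin n ≃ ι) := ⟨(Fintype.equivFinOfCardEq hcard).symm⟩
    have hβ : ∀ i, (α (e i)).Holo p := fun i => hα _
    have hj : ∀ i j, i ≠ j → (α (e i)).wedge (α (e j)) p ≠ 0 :=
      fun i j hij => hi _ _ (e.injective.ne hij)
    have hWβ : ∀ᶠ q in 𝓝 p, W q = ∏ i, (α (e i)).toForm q := by
      filter_upwards [hW] with q hq
      rw [hq, e.prod_comp fun i => (α i).toForm q]
    refine ⟨fun i => α (e i), hβ, hWβ, fun r s t => eta (α (e r)) (α (e s)) (α (e t)), ?_, ?_⟩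
    · intro r s t hs ht
      exact isEta_eta (hβ r) (hβ s) (hβ t) (hj _ _ hs.ne) (hj _ _ ht.ne)
        (hj _ _ (hs.trans ht).ne')
    · have := key (fun i => α (e i)) hβ hj hWβ
      have h6 : (6 : ℂ) ≠ 0 := by norm_num
      exact mul_left_cancel₀ h6 (h.trans this.symm)

end TripleSums

/-! ### 3-webs sharing foliations with a 2-web given by a quadratic form -/

section Quadratic

theorem OneForm.wedge_def (α β : OneForm) (p : ℂ × ℂ) :
    α.wedge β p = α.a p * β.b p - α.b p * β.a p := rfl

/-- The value of `A dx² + B dx dy + C dy²` on the kernel vector `(γ.b, -γ.a)` of `γ`. -/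
def contr (A B C : Fn) (γ : OneForm) : Fn :=
  fun q => A q * γ.b q ^ 2 - B q * (γ.a q * γ.b q) + C q * γ.a q ^ 2

/-- Twice the contraction of the symmetric bilinear form of `A dx² + B dx dy + C dy²` with the
kernel vector `(γ.b, -γ.a)` of `γ`. -/
def polar (A B C : Fn) (γ : OneForm) : OneForm :=
  ⟨fun q => 2 * A q * γ.b q - B q * γ.a q, fun q => B q * γ.b q - 2 * C q * γ.a q⟩

/-- The discriminant of `A dx² + B dx dy + C dy²`. -/
def quadDisc (A B C : Fn) : Fn := fun q => B q ^ 2 - 4 * (A q * C q)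

variable {A B C : Fn} {γ γ' b₀ b₁ : OneForm} {p : ℂ × ℂ}

theorem analyticAt_contr (hA : AnalyticAt ℂ A p) (hB : AnalyticAt ℂ B p) (hC : AnalyticAt ℂ C p)
    (hγ : γ.Holo p) : AnalyticAt ℂ (contr A B C γ) p :=
  ((hA.mul (hγ.2.pow 2)).sub (hB.mul (hγ.1.mul hγ.2))).add (hC.mul (hγ.1.pow 2))

theorem Holo_polar (hA : AnalyticAt ℂ A p) (hB : AnalyticAt ℂ B p) (hC : AnalyticAt ℂ C p)
    (hγ : γ.Holo p) : (polar A B C γ).Holo p :=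
  ⟨((analyticAt_const.mul hA).mul hγ.2).sub (hB.mul hγ.1),
    (hB.mul hγ.2).sub ((analyticAt_const.mul hC).mul hγ.1)⟩

theorem wedge_polar : γ.wedge (polar A B C γ) p = -2 * contr A B C γ p := by
  simp only [OneForm.wedge, polar, contr]; ring

/-- The quadratic form with coefficients `A`, `B`, `C` is the product of `b₀` and `b₁` at `q`. -/
def QuadEq (A B C : Fn) (b₀ b₁ : OneForm) (q : ℂ × ℂ) : Prop :=
  A q = b₀.a q * b₁.a q ∧ B q = b₀.a q * b₁.b q + b₀.b q * b₁.a q ∧ C q = b₀.b q * b₁.b q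

theorem QuadEq.quadDisc_eq (h : QuadEq A B C b₀ b₁ p) : quadDisc A B C p = b₀.wedge b₁ p ^ 2 := by
  obtain ⟨h1, h2, h3⟩ := h
  simp only [quadDisc, OneForm.wedge, h1, h2, h3]; ring

theorem QuadEq.contr_eq (h : QuadEq A B C b₀ b₁ p) :
    contr A B C γ p = b₀.wedge γ p * b₁.wedge γ p := by
  obtain ⟨h1, h2, h3⟩ := h
  simp only [contr, OneForm.wedge, h1, h2, h3]; ring

/-- The form computing the curvature of the `3`-web defined by `γ` and a quadratic form whose
discriminant `D` is such that `dD / D = l`. -/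
def quadConn (A B C : Fn) (l : OneForm) (γ : OneForm) : OneForm :=
  cramer γ (polar A B C γ) γ.d fun q =>
    (polar A B C γ).d q - l.wedge (polar A B C γ) q / 2

/-- Normalize the relation as `γ + u₀ b₀ + u₁ b₁ = 0`. Then `2 u₀ b₀ = -γ + τ / (b₀ ∧ b₁)` with `(b₀
∧ b₁)² = D`, and `d(τ / (b₀ ∧ b₁))` equals `(dτ - ½ (dD/D) ∧ τ) / (b₀ ∧ b₁)`. The resulting
conditions on `h` involve the quadratic form alone and not its factors. -/
theorem eta_d_eq_quadConn {l : OneForm} (hA : AnalyticAt ℂ A p) (hB : AnalyticAt ℂ B p)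
    (hC : AnalyticAt ℂ C p) (hb₀ : b₀.Holo p) (hb₁ : b₁.Holo p) (hγ : γ.Holo p) (hl : l.Holo p)
    (h01 : b₀.wedge b₁ p ≠ 0) (h0 : b₀.wedge γ p ≠ 0) (h1 : b₁.wedge γ p ≠ 0)
    (hQ : ∀ᶠ q in 𝓝 p, QuadEq A B C b₀ b₁ q)
    (hlX : ∀ᶠ q in 𝓝 p, dX (quadDisc A B C) q = quadDisc A B C q * l.a q)
    (hlY : ∀ᶠ q in 𝓝 p, dY (quadDisc A B C) q = quadDisc A B C q * l.b q) :
    (eta b₀ b₁ γ).d p = (quadConn A B C l γ).d p := by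
  set τ := polar A B C γ with hτ
  have hτh : τ.Holo p := Holo_polar hA hB hC hγ
  have hD : AnalyticAt ℂ (b₀.wedge b₁) p := hb₀.wedge hb₁
  set u₀ : Fn := fun q => b₁.wedge γ q / b₀.wedge b₁ q with hu₀
  set u₁ : Fn := fun q => γ.wedge b₀ q / b₀.wedge b₁ q with hu₁
  have hw : γ.wedge τ p ≠ 0 := by
    rw [wedge_polar, hQ.self_of_nhds.contr_eq]
    exact mul_ne_zero (by norm_num) (mul_ne_zero h0 h1)
  have hHolo : (quadConn A B C l γ).Holo p :=
    Holo.cramer hγ hτh hγ.d (hτh.d.sub ((hl.wedge hτh).div_const)) hw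
  have conn : IsConn γ b₀ b₁ (quadConn A B C l γ) p (fun _ => 1) u₀ u₁ := by
    refine IsConn.of_two hγ hb₀ hHolo analyticAt_const ((hb₁.wedge hγ).div hD h01)
      ((hγ.wedge hb₀).div hD h01) one_ne_zero (div_ne_zero h1 h01)
      (div_ne_zero (wedge_comm_ne h0) h01) ?_ ?_ ?_ ?_
    · filter_upwards [hD.continuousAt.eventually_ne h01] with q hq
      simp only [hu₀, hu₁]
      field_simp
      simp only [OneForm.wedge]; ring
    · filter_upwards [hD.continuousAt.eventually_ne h01] with q hq
      simp only [hu₀, hu₁]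
      field_simp
      simp only [OneForm.wedge]; ring
    · filter_upwards [(hγ.wedge hτh).continuousAt.eventually_ne hw, hγ.eventually] with q hq hγq
      have h1 := cramer_wedge_left (a := γ.d) (b := fun q => τ.d q - l.wedge τ q / 2) hq
      rw [d_smul analyticAt_const hγq, dX_const, dY_const]
      have : (quadConn A B C l γ).wedge (smul (fun _ => 1) γ) q =
          (quadConn A B C l γ).wedge γ q := by
        simp [OneForm.wedge, smul]
      rw [this]
      simp only [zero_mul, sub_self, zero_add, one_mul]
      exact h1.symm
    · filter_upwards [(hγ.wedge hτh).continuousAt.eventually_ne hw, hγ.eventually, hτh.eventually,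
        hD.eventually_analyticAt, (hD.continuousAt.eventually_ne h01).eventually_nhds,
        hQ.eventually_nhds, hlX, hlY] with q hq hγq hτq hDq hDne hQq hX hY
      have hDne' := hDne.self_of_nhds
      have k1 : (quadConn A B C l γ).wedge γ q = γ.d q :=
        cramer_wedge_left (a := γ.d) (b := fun q => τ.d q - l.wedge τ q / 2) hq
      have k2 : (quadConn A B C l γ).wedge τ q = τ.d q - l.wedge τ q / 2 :=
        cramer_wedge_right (a := γ.d) (b := fun q => τ.d q - l.wedge τ q / 2) hq
      set g : Fn := fun r => 1 / b₀.wedge b₁ r with hg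
      have hgq : AnalyticAt ℂ g q := analyticAt_const.div hDq hDne'
      have e2 : (smul (fun _ => 2) (smul u₀ b₀)).d q =
          ((smul (fun _ => -1) γ).add (smul g τ)).d q := by
        apply d_congr
        · filter_upwards [hDne, hQq] with r hr hQr
          obtain ⟨a1, a2, a3⟩ := hQr
          simp only [smul, Pi.mul_apply, OneForm.add, hu₀, hg, hτ, polar]
          field_simp
          rw [a1, a2]
          simp only [OneForm.wedge]; ring
        · filter_upwards [hDne, hQq] with r hr hQr
          obtain ⟨a1, a2, a3⟩ := hQr
          simp only [smul, Pi.mul_apply, OneForm.add, hu₀, hg, hτ, polar]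
          field_simp
          rw [a2, a3]
          simp only [OneForm.wedge]; ring
      -- Differentiating `D = (b₀ ∧ b₁)²` shows that the logarithmic derivative of `b₀ ∧ b₁` is `l /
      -- 2`.
      have hDX : dX (quadDisc A B C) q = dX (fun r => b₀.wedge b₁ r * b₀.wedge b₁ r) q :=
        dX_congr (hQq.mono fun r hr => by rw [hr.quadDisc_eq]; ring)
      have hDY : dY (quadDisc A B C) q = dY (fun r => b₀.wedge b₁ r * b₀.wedge b₁ r) q :=
        dY_congr (hQq.mono fun r hr => by rw [hr.quadDisc_eq]; ring)
      rw [hX, hQq.self_of_nhds.quadDisc_eq, dX_mul hDq hDq] at hDX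
      rw [hY, hQq.self_of_nhds.quadDisc_eq, dY_mul hDq hDq] at hDY
      have hDX' : dX (b₀.wedge b₁) q = b₀.wedge b₁ q * l.a q / 2 := by
        apply mul_left_cancel₀ hDne'; linear_combination -hDX / 2
      have hDY' : dY (b₀.wedge b₁) q = b₀.wedge b₁ q * l.b q / 2 := by
        apply mul_left_cancel₀ hDne'; linear_combination -hDY / 2
      have hgX : dX g q = -(l.a q / 2) / b₀.wedge b₁ q := by
        rw [hg, dX_div analyticAt_const hDq hDne', dX_const, hDX']; field_simp; ring
      have hgY : dY g q = -(l.b q / 2) / b₀.wedge b₁ q := by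
        rw [hg, dY_div analyticAt_const hDq hDne', dY_const, hDY']; field_simp; ring
      have hu₀q : (smul u₀ b₀).Holo q → (smul (fun _ => 2) (smul u₀ b₀)).d q =
          2 * (smul u₀ b₀).d q := fun h => by
        rw [d_smul analyticAt_const h, dX_const, dY_const]; ring
      have hval : 2 * (smul u₀ b₀).d q = (quadConn A B C l γ).wedge
          ((smul (fun _ => -1) γ).add (smul g τ)) q := by
        rw [← hu₀q, e2, d_add (hγq.smul analyticAt_const) (hτq.smul hgq),
          d_smul analyticAt_const hγq, d_smul hgq hτq, dX_const, dY_const, hgX, hgY]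
        · have : (quadConn A B C l γ).wedge ((smul (fun _ => -1) γ).add (smul g τ)) q =
            -(quadConn A B C l γ).wedge γ q + g q * (quadConn A B C l γ).wedge τ q := by
            simp only [OneForm.wedge, OneForm.add, smul, Pi.mul_apply]; ring
          rw [this, k1, k2]
          simp only [hg, OneForm.wedge]
          field_simp
          ring
        · have hc : (smul u₀ b₀).a =ᶠ[𝓝 q] fun r => (-(γ.a r) + g r * τ.a r) / 2 := by
            filter_upwards [hDne, hQq] with r hr hQr
            obtain ⟨a1, a2, a3⟩ := hQr
            simp only [smul, Pi.mul_apply, hu₀, hg, hτ, polar]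
            field_simp
            rw [a1, a2]
            simp only [OneForm.wedge]; ring
          have hd : (smul u₀ b₀).b =ᶠ[𝓝 q] fun r => (-(γ.b r) + g r * τ.b r) / 2 := by
            filter_upwards [hDne, hQq] with r hr hQr
            obtain ⟨a1, a2, a3⟩ := hQr
            simp only [smul, Pi.mul_apply, hu₀, hg, hτ, polar]
            field_simp
            rw [a2, a3]
            simp only [OneForm.wedge]; ring
          exact ⟨((hγq.1.neg.add (hgq.mul hτq.1)).div_const).congr hc.symm,
            ((hγq.2.neg.add (hgq.mul hτq.2)).div_const).congr hd.symm⟩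
      have hpt : (quadConn A B C l γ).wedge ((smul (fun _ => -1) γ).add (smul g τ)) q =
          2 * (quadConn A B C l γ).wedge (smul u₀ b₀) q := by
        obtain ⟨a1, a2, a3⟩ := hQq.self_of_nhds
        have ea : ((smul (fun _ => -1) γ).add (smul g τ)).a q = 2 * (smul u₀ b₀).a q := by
          simp only [smul, Pi.mul_apply, OneForm.add, hu₀, hg, hτ, polar]
          field_simp
          rw [a1, a2]
          simp only [OneForm.wedge]; ring
        have eb : ((smul (fun _ => -1) γ).add (smul g τ)).b q = 2 * (smul u₀ b₀).b q := by
          simp only [smul, Pi.mul_apply, OneForm.add, hu₀, hg, hτ, polar]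
          field_simp
          rw [a2, a3]
          simp only [OneForm.wedge]; ring
        rw [OneForm.wedge, ea, eb, OneForm.wedge]; ring
      rw [hpt] at hval
      exact mul_left_cancel₀ two_ne_zero hval
  exact (conn.rotate.d_eq_eta hb₀ hb₁ hγ h01 h1 (wedge_comm_ne h0)).symm

/-- The form computing the curvature of the `3`-web defined by `γ`, `γ'` and a third form `b`. -/
def pairConn (γ γ' b : OneForm) : OneForm :=
  cramer γ γ' (fun q => γ.d q + (ext (γ'.wedge b)).wedge γ q / γ'.wedge b q)
    (fun q => γ'.d q + (ext (b.wedge γ)).wedge γ' q / b.wedge γ q)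

theorem Holo_pairConn {b : OneForm} (hγ : γ.Holo p) (hγ' : γ'.Holo p) (hb : b.Holo p)
    (h : γ.wedge γ' p ≠ 0) (h1 : γ'.wedge b p ≠ 0) (h2 : b.wedge γ p ≠ 0) :
    (pairConn γ γ' b).Holo p :=
  Holo.cramer hγ hγ'
    (hγ.d.add (((Holo.ext (hγ'.wedge hb)).wedge hγ).div (hγ'.wedge hb) h1))
    (hγ'.d.add (((Holo.ext (hb.wedge hγ)).wedge hγ').div (hb.wedge hγ) h2)) h

/-- Dividing `d(v γ) = h ∧ v γ` by `v = γ' ∧ b` gives `h ∧ γ = dγ + (dv/v) ∧ γ`, and likewise for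
`γ'`. Thus `b` enters only through logarithmic derivatives. -/
theorem eta_d_eq_pairConn {b : OneForm} (hγ : γ.Holo p) (hγ' : γ'.Holo p) (hb : b.Holo p)
    (h : γ.wedge γ' p ≠ 0) (h1 : γ'.wedge b p ≠ 0) (h2 : b.wedge γ p ≠ 0) :
    (eta b γ γ').d p = (pairConn γ γ' b).d p := by
  have conn : IsConn γ γ' b (pairConn γ γ' b) p (γ'.wedge b) (b.wedge γ) (γ.wedge γ') := by
    refine IsConn.of_two hγ hγ' (Holo_pairConn hγ hγ' hb h h1 h2) (hγ'.wedge hb) (hb.wedge hγ)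
      (hγ.wedge hγ') h1 h2 h ?_ ?_ ?_ ?_
    · filter_upwards with q
      simp only [OneForm.wedge]; ring
    · filter_upwards with q
      simp only [OneForm.wedge]; ring
    · filter_upwards [(hγ.wedge hγ').continuousAt.eventually_ne h, hγ.eventually,
        (hγ'.wedge hb).eventually_analyticAt, (hγ'.wedge hb).continuousAt.eventually_ne h1]
        with q q1 q2 q3 q4
      have e := cramer_wedge_left
        (a := fun q => γ.d q + (ext (γ'.wedge b)).wedge γ q / γ'.wedge b q)
        (b := fun q => γ'.d q + (ext (b.wedge γ)).wedge γ' q / b.wedge γ q) q1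
      rw [d_smul q3 q2]
      have e' : (pairConn γ γ' b).wedge (smul (γ'.wedge b) γ) q =
          γ'.wedge b q * (pairConn γ γ' b).wedge γ q := by
        simp only [OneForm.wedge, smul, Pi.mul_apply]; ring
      rw [e', pairConn, e, mul_add, mul_div_cancel₀ _ q4]
      simp only [OneForm.wedge, OneForm.ext]; ring
    · filter_upwards [(hγ.wedge hγ').continuousAt.eventually_ne h, hγ'.eventually,
        (hb.wedge hγ).eventually_analyticAt, (hb.wedge hγ).continuousAt.eventually_ne h2]
        with q q1 q2 q3 q4
      have e := cramer_wedge_right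
        (a := fun q => γ.d q + (ext (γ'.wedge b)).wedge γ q / γ'.wedge b q)
        (b := fun q => γ'.d q + (ext (b.wedge γ)).wedge γ' q / b.wedge γ q) q1
      rw [d_smul q3 q2]
      have e' : (pairConn γ γ' b).wedge (smul (b.wedge γ) γ') q =
          b.wedge γ q * (pairConn γ γ' b).wedge γ' q := by
        simp only [OneForm.wedge, smul, Pi.mul_apply]; ring
      rw [e', pairConn, e, mul_add, mul_div_cancel₀ _ q4]
      simp only [OneForm.wedge, OneForm.ext]; ring
  exact (conn.rotate.rotate.d_eq_eta hb hγ hγ' h2 h h1).symm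

/-- The form computing the sum of the curvatures of the `3`-webs defined by `γ`, `γ'` and one of
the factors of a quadratic form. -/
def quadPairConn (A B C : Fn) (γ γ' : OneForm) : OneForm :=
  cramer γ γ' (fun q => 2 * γ.d q + (ext (contr A B C γ')).wedge γ q / contr A B C γ' q)
    (fun q => 2 * γ'.d q + (ext (contr A B C γ)).wedge γ' q / contr A B C γ q)

theorem Holo_quadPairConn (hA : AnalyticAt ℂ A p) (hB : AnalyticAt ℂ B p)
    (hC : AnalyticAt ℂ C p) (hγ : γ.Holo p) (hγ' : γ'.Holo p) (h : γ.wedge γ' p ≠ 0)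
    (h1 : contr A B C γ p ≠ 0) (h2 : contr A B C γ' p ≠ 0) :
    (quadPairConn A B C γ γ').Holo p := by
  have c1 := analyticAt_contr hA hB hC hγ
  have c2 := analyticAt_contr hA hB hC hγ'
  exact Holo.cramer hγ hγ'
    ((analyticAt_const.mul hγ.d).add (((Holo.ext c2).wedge hγ).div c2 h2))
    ((analyticAt_const.mul hγ'.d).add (((Holo.ext c1).wedge hγ').div c1 h1)) h

/-- The logarithmic derivatives for `b₀` and `b₁` add up to those of `(b₀ ∧ γ)(b₁ ∧ γ)` and `(b₀ ∧
γ')(b₁ ∧ γ')`. These are values of the quadratic form, so the sum has no pole where its two factors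
merge. -/
theorem eta_d_add_eq_quadPairConn (hb₀ : b₀.Holo p) (hb₁ : b₁.Holo p) (hγ : γ.Holo p)
    (hγ' : γ'.Holo p) (h : γ.wedge γ' p ≠ 0) (h0 : b₀.wedge γ p ≠ 0) (h1 : b₁.wedge γ p ≠ 0)
    (h0' : b₀.wedge γ' p ≠ 0) (h1' : b₁.wedge γ' p ≠ 0)
    (hQ : ∀ᶠ q in 𝓝 p, QuadEq A B C b₀ b₁ q) :
    (eta b₀ γ γ').d p + (eta b₁ γ γ').d p = (quadPairConn A B C γ γ').d p := by
  rw [eta_d_eq_pairConn hγ hγ' hb₀ h (wedge_comm_ne h0') h0,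
    eta_d_eq_pairConn hγ hγ' hb₁ h (wedge_comm_ne h1') h1,
    ← d_add (Holo_pairConn hγ hγ' hb₀ h (wedge_comm_ne h0') h0)
      (Holo_pairConn hγ hγ' hb₁ h (wedge_comm_ne h1') h1)]
  have ev : ∀ᶠ q in 𝓝 p,
      ((pairConn γ γ' b₀).add (pairConn γ γ' b₁)).a q = (quadPairConn A B C γ γ').a q ∧
      ((pairConn γ γ' b₀).add (pairConn γ γ' b₁)).b q = (quadPairConn A B C γ γ').b q := by
    filter_upwards [(hγ.wedge hγ').continuousAt.eventually_ne h,
      (hb₀.wedge hγ).continuousAt.eventually_ne h0, (hb₁.wedge hγ).continuousAt.eventually_ne h1,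
      (hb₀.wedge hγ').continuousAt.eventually_ne h0',
      (hb₁.wedge hγ').continuousAt.eventually_ne h1', hQ.eventually_nhds, hγ.eventually,
      hγ'.eventually, hb₀.eventually, hb₁.eventually]
      with q n n0 n1 n0' n1' hq g g' k0 k1
    have c : contr A B C γ =ᶠ[𝓝 q] fun r => b₀.wedge γ r * b₁.wedge γ r :=
      hq.mono fun r hr => hr.contr_eq
    have c' : contr A B C γ' =ᶠ[𝓝 q] fun r => γ'.wedge b₀ r * γ'.wedge b₁ r :=
      hq.mono fun r hr => by rw [hr.contr_eq]; simp only [OneForm.wedge]; ring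
    refine eq_of_wedge_eq n ?_ ?_
    · have e : ((pairConn γ γ' b₀).add (pairConn γ γ' b₁)).wedge γ q =
          (pairConn γ γ' b₀).wedge γ q + (pairConn γ γ' b₁).wedge γ q := by
        simp only [OneForm.wedge, OneForm.add]; ring
      rw [e, pairConn, pairConn, quadPairConn, cramer_wedge_left n, cramer_wedge_left n,
        cramer_wedge_left n]
      have w0 := wedge_comm_ne n0'
      have w1 := wedge_comm_ne n1'
      rw [c'.self_of_nhds]
      have ew : (ext (contr A B C γ')).wedge γ q =
          (ext (γ'.wedge b₀)).wedge γ q * γ'.wedge b₁ q +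
          γ'.wedge b₀ q * (ext (γ'.wedge b₁)).wedge γ q := by
        simp only [OneForm.wedge_def, OneForm.ext]
        rw [dX_congr c', dY_congr c', dX_mul (g'.wedge k0) (g'.wedge k1),
          dY_mul (g'.wedge k0) (g'.wedge k1)]
        simp only [OneForm.wedge_def]
        ring
      rw [ew]
      field_simp
      ring
    · have e : ((pairConn γ γ' b₀).add (pairConn γ γ' b₁)).wedge γ' q =
          (pairConn γ γ' b₀).wedge γ' q + (pairConn γ γ' b₁).wedge γ' q := by
        simp only [OneForm.wedge, OneForm.add]; ring
      rw [e, pairConn, pairConn, quadPairConn, cramer_wedge_right n, cramer_wedge_right n,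
        cramer_wedge_right n]
      rw [c.self_of_nhds]
      have ew : (ext (contr A B C γ)).wedge γ' q =
          (ext (b₀.wedge γ)).wedge γ' q * b₁.wedge γ q +
          b₀.wedge γ q * (ext (b₁.wedge γ)).wedge γ' q := by
        simp only [OneForm.wedge_def, OneForm.ext]
        rw [dX_congr c, dY_congr c, dX_mul (k0.wedge g) (k1.wedge g),
          dY_mul (k0.wedge g) (k1.wedge g)]
        simp only [OneForm.wedge_def]
        ring
      rw [ew]
      field_simp
      ring
  exact d_congr (ev.mono fun q h => h.1) (ev.mono fun q h => h.2)

end Quadratic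

/-! ### Powers, finite sums, and the local data of the web -/

theorem dX_pow {g : Fn} {p : ℂ × ℂ} (hg : AnalyticAt ℂ g p) (m : ℕ) :
    dX (fun q => g q ^ m) p = m * g p ^ (m - 1) * dX g p := by
  simp only [dX]
  rw [fderiv_fun_pow m hg.differentiableAt]
  simp

theorem dY_pow {g : Fn} {p : ℂ × ℂ} (hg : AnalyticAt ℂ g p) (m : ℕ) :
    dY (fun q => g q ^ m) p = m * g p ^ (m - 1) * dY g p := by
  simp only [dY]
  rw [fderiv_fun_pow m hg.differentiableAt]
  simp

theorem dX_fun_sum {ι : Type*} (s : Finset ι) {g : ι → Fn} {p : ℂ × ℂ}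
    (hg : ∀ i, AnalyticAt ℂ (g i) p) : dX (fun q => ∑ i ∈ s, g i q) p = ∑ i ∈ s, dX (g i) p := by
  simp only [dX]
  rw [fderiv_fun_sum fun i _ => (hg i).differentiableAt]
  simp

theorem dY_fun_sum {ι : Type*} (s : Finset ι) {g : ι → Fn} {p : ℂ × ℂ}
    (hg : ∀ i, AnalyticAt ℂ (g i) p) : dY (fun q => ∑ i ∈ s, g i q) p = ∑ i ∈ s, dY (g i) p := by
  simp only [dY]
  rw [fderiv_fun_sum fun i _ => (hg i).differentiableAt]
  simp

/-- A finite sum of `1`-forms. -/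
def OneForm.sum {ι : Type*} [Fintype ι] (α : ι → OneForm) : OneForm :=
  ⟨fun q => ∑ i, (α i).a q, fun q => ∑ i, (α i).b q⟩

theorem OneForm.Holo_sum {ι : Type*} [Fintype ι] {α : ι → OneForm} {p : ℂ × ℂ}
    (hα : ∀ i, (α i).Holo p) : (OneForm.sum α).Holo p :=
  ⟨Finset.analyticAt_fun_sum _ fun i _ => (hα i).1,
    Finset.analyticAt_fun_sum _ fun i _ => (hα i).2⟩

theorem OneForm.d_sum {ι : Type*} [Fintype ι] {α : ι → OneForm} {p : ℂ × ℂ}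
    (hα : ∀ i, (α i).Holo p) : (OneForm.sum α).d p = ∑ i, (α i).d p := by
  simp only [OneForm.d, OneForm.sum]
  rw [dX_fun_sum _ fun i => (hα i).2, dY_fun_sum _ fun i => (hα i).1, Finset.sum_sub_distrib]

/-- The local data of a web `𝒲₂ ⊠ 𝒲ₖ`: the coefficients `A`, `B`, `C` of `𝒲₂`, with discriminant
`U f ^ m`, and forms `γ i` defining the foliations of `𝒲ₖ`, which is transverse to `𝒲₂`. -/
structure Setting (k m : ℕ) (A B C f U : Fn) (γ : Fin k → OneForm) : Prop where
  anA : AnalyticAt ℂ A 0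
  anB : AnalyticAt ℂ B 0
  anC : AnalyticAt ℂ C 0
  anU : AnalyticAt ℂ U 0
  U_ne : U 0 ≠ 0
  curve : IsSmoothCurve f
  holo : ∀ i, (γ i).Holo 0
  indep : ∀ i j, i ≠ j → (γ i).wedge (γ j) 0 ≠ 0
  transverse : ∀ i, contr A B C (γ i) 0 ≠ 0
  quadDisc_eq : ∀ᶠ p in 𝓝 (0 : ℂ × ℂ), quadDisc A B C p = U p * f p ^ m

/-! ### Decomposition of the curvature into a regular and a polar part -/

section Formula

variable {k m : ℕ} {A B C f U : Fn} {γ : Fin k → OneForm}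

/-- The residue form `∑ᵢ (df ∧ τᵢ) / Nᵢ γᵢ`, where `τᵢ` and `Nᵢ` are the contractions of `𝒲₂` with
the kernel of `γᵢ`. -/
def residueForm (A B C f : Fn) (γ : Fin k → OneForm) : OneForm :=
  OneForm.sum fun i =>
    smul (fun q => (ext f).wedge (polar A B C (γ i)) q / contr A B C (γ i) q) (γ i)

theorem Setting.holo_residueForm (S : Setting k m A B C f U γ) :
    (residueForm A B C f γ).Holo 0 :=
  OneForm.Holo_sum fun i => Holo.smul
    (((Holo.ext S.curve.analytic).wedge (Holo_polar S.anA S.anB S.anC (S.holo i))).div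
      (analyticAt_contr S.anA S.anB S.anC (S.holo i)) (S.transverse i)) (S.holo i)

/-- The logarithmic derivative of `g`. -/
def dlog (g : Fn) : OneForm := smul (fun q => 1 / g q) (ext g)

theorem Holo_dlog {g : Fn} {p : ℂ × ℂ} (hg : AnalyticAt ℂ g p) (h : g p ≠ 0) :
    (dlog g).Holo p := Holo.smul (analyticAt_const.div hg h) (Holo.ext hg)

theorem holo_quadConn {l : OneForm} {g : OneForm} {p : ℂ × ℂ} (hA : AnalyticAt ℂ A p)
    (hB : AnalyticAt ℂ B p) (hC : AnalyticAt ℂ C p) (hg : g.Holo p) (hl : l.Holo p)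
    (h : contr A B C g p ≠ 0) : (quadConn A B C l g).Holo p :=
  have hτ := Holo_polar hA hB hC hg
  Holo.cramer hg hτ hg.d (hτ.d.sub ((hl.wedge hτ).div_const))
    (by rw [wedge_polar]; exact mul_ne_zero (by norm_num) h)

/-- The part of the curvature which is holomorphic at the origin. -/
def regularPart (A B C U : Fn) (γ : Fin k → OneForm) : Fn := fun p =>
  ∑ i, (quadConn A B C (dlog U) (γ i)).d p +
    (∑ i, ∑ j, if i ≠ j then (quadPairConn A B C (γ i) (γ j)).d p else 0) / 2 +
    (∑ i, ∑ j, ∑ l, tripleCurv γ p i j l) / 6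

theorem Setting.analyticAt_regularPart (S : Setting k m A B C f U γ) :
    AnalyticAt ℂ (regularPart A B C U γ) 0 := by
  refine ((Finset.analyticAt_fun_sum _ fun i _ => ?_).add
    (AnalyticAt.div_const (Finset.analyticAt_fun_sum _ fun i _ =>
      Finset.analyticAt_fun_sum _ fun j _ => ?_))).add
    (AnalyticAt.div_const (Finset.analyticAt_fun_sum _ fun i _ =>
      Finset.analyticAt_fun_sum _ fun j _ => Finset.analyticAt_fun_sum _ fun l _ => ?_))
  · exact (holo_quadConn S.anA S.anB S.anC (S.holo i) (Holo_dlog S.anU S.U_ne)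
      (S.transverse i)).d
  · split_ifs with h
    · exact (Holo_quadPairConn S.anA S.anB S.anC (S.holo i) (S.holo j) (S.indep i j h)
        (S.transverse i) (S.transverse j)).d
    · exact analyticAt_const
  · unfold tripleCurv
    split_ifs with h
    · exact (Holo_eta (S.holo i) (S.holo j) (S.holo l) (S.indep _ _ h.1) (S.indep _ _ h.2.1)
        (S.indep _ _ h.2.2)).d
    · exact analyticAt_const

theorem Setting.eventually_good (S : Setting k m A B C f U γ) : ∀ᶠ p in 𝓝 (0 : ℂ × ℂ),
    AnalyticAt ℂ A p ∧ AnalyticAt ℂ B p ∧ AnalyticAt ℂ C p ∧ AnalyticAt ℂ U p ∧ U p ≠ 0 ∧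
    AnalyticAt ℂ f p ∧ (∀ i, (γ i).Holo p) ∧ (∀ i j, i ≠ j → (γ i).wedge (γ j) p ≠ 0) ∧
    (∀ i, contr A B C (γ i) p ≠ 0) ∧ ∀ᶠ q in 𝓝 p, quadDisc A B C q = U q * f q ^ m := by
  have h1 : ∀ᶠ p in 𝓝 (0 : ℂ × ℂ), ∀ i j, i ≠ j → (γ i).wedge (γ j) p ≠ 0 := by
    simp only [eventually_all]
    exact fun i j hij =>
      ((S.holo i).wedge (S.holo j)).continuousAt.eventually_ne (S.indep i j hij)
  have h2 : ∀ᶠ p in 𝓝 (0 : ℂ × ℂ), ∀ i, contr A B C (γ i) p ≠ 0 := by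
    rw [eventually_all]
    exact fun i => (analyticAt_contr S.anA S.anB S.anC (S.holo i)).continuousAt.eventually_ne
      (S.transverse i)
  filter_upwards [S.anA.eventually_analyticAt, S.anB.eventually_analyticAt,
    S.anC.eventually_analyticAt, S.anU.eventually_analyticAt,
    S.anU.continuousAt.eventually_ne S.U_ne, S.curve.analytic.eventually_analyticAt,
    eventually_all.mpr fun i => (S.holo i).eventually, h1, h2, S.quadDisc_eq.eventually_nhds]
    with p q1 q2 q3 q4 q5 q6 q7 q8 q9 q10
  exact ⟨q1, q2, q3, q4, q5, q6, q7, q8, q9, q10⟩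

/-- The form is affine in `l`. Adding `l'` leaves its wedge with `g` unchanged and subtracts `l' ∧ τ
/ 2` from its wedge with `τ`; as `g ∧ τ = -2N`, the correction is `(l' ∧ τ / 4N) g`. -/
theorem quadConn_d_add {g : OneForm} {l l' : OneForm} {p : ℂ × ℂ} (hA : AnalyticAt ℂ A p)
    (hB : AnalyticAt ℂ B p) (hC : AnalyticAt ℂ C p) (hg : g.Holo p) (hl : l.Holo p)
    (hl' : l'.Holo p) (h : contr A B C g p ≠ 0) :
    (quadConn A B C (l.add l') g).d p = (quadConn A B C l g).d p +
      (smul (fun q => l'.wedge (polar A B C g) q / (4 * contr A B C g q)) g).d p := by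
  have hτ := Holo_polar hA hB hC hg
  have hN := analyticAt_contr hA hB hC hg
  have hs : (smul (fun q => l'.wedge (polar A B C g) q / (4 * contr A B C g q)) g).Holo p :=
    hg.smul ((hl'.wedge hτ).div (analyticAt_const.mul hN) (mul_ne_zero (by norm_num) h))
  rw [← d_add (holo_quadConn hA hB hC hg hl h) hs]
  apply d_congr
  · filter_upwards [hN.continuousAt.eventually_ne h] with q hq
    simp only [quadConn, cramer, OneForm.add, smul, Pi.mul_apply, wedge_polar]
    field_simp
    simp only [OneForm.wedge]
    ring
  · filter_upwards [hN.continuousAt.eventually_ne h] with q hq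
    simp only [quadConn, cramer, OneForm.add, smul, Pi.mul_apply, wedge_polar]
    field_simp
    simp only [OneForm.wedge]
    ring

/-- The curvature off the discriminant is the sum of a holomorphic part and of a polar part. -/
theorem Setting.curvatureAt_iff (S : Setting k m A B C f U γ) {W : ℂ × ℂ → Form}
    (hW : ∀ᶠ p in 𝓝 (0 : ℂ × ℂ), f p ≠ 0 → ∃ b₀ b₁ : OneForm, b₀.Holo p ∧ b₁.Holo p ∧
      (∀ᶠ q in 𝓝 p, QuadEq A B C b₀ b₁ q) ∧
      ∀ᶠ q in 𝓝 p, W q = b₀.toForm q * b₁.toForm q * ∏ i, (γ i).toForm q) :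
    ∀ᶠ p in 𝓝 (0 : ℂ × ℂ), f p ≠ 0 → ∀ κ, CurvatureAt (k + 2) W p κ ↔
      κ = regularPart A B C U γ p +
        (smul (fun q => m / 4 / f q) (residueForm A B C f γ)).d p := by
  filter_upwards [hW, S.eventually_good] with p hWp hgood hfp κ
  obtain ⟨anA, anB, anC, anU, hU, anf, hγ, hγγ, hN, hΔ⟩ := hgood
  obtain ⟨b₀, b₁, hb₀, hb₁, hQ, hWq⟩ := hWp hfp
  have h01 : b₀.wedge b₁ p ≠ 0 := by
    intro h0
    have := hQ.self_of_nhds.quadDisc_eq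
    rw [h0, hΔ.self_of_nhds] at this
    simp [hU, hfp] at this
  have hb : ∀ i, b₀.wedge (γ i) p ≠ 0 ∧ b₁.wedge (γ i) p ≠ 0 := by
    intro i
    have := hN i
    rwa [hQ.self_of_nhds.contr_eq, mul_ne_zero_iff] at this
  set α : Fin 2 ⊕ Fin k → OneForm := Sum.elim ![b₀, b₁] γ with hα
  have hαh : ∀ x, (α x).Holo p := by
    rintro (a | i)
    · fin_cases a
      · exact hb₀
      · exact hb₁
    · exact hγ i
  have hαi : ∀ x y, x ≠ y → (α x).wedge (α y) p ≠ 0 := by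
    rintro (a | i) (c | j) hxy
    · fin_cases a <;> fin_cases c
      · exact absurd rfl hxy
      · exact h01
      · exact wedge_comm_ne h01
      · exact absurd rfl hxy
    · fin_cases a
      · exact (hb j).1
      · exact (hb j).2
    · fin_cases c
      · exact wedge_comm_ne (hb i).1
      · exact wedge_comm_ne (hb i).2
    · exact hγγ i j fun h => hxy (congrArg _ h)
  have hαW : ∀ᶠ q in 𝓝 p, W q = ∏ x, (α x).toForm q := by
    filter_upwards [hWq] with q hq
    rw [hq, Fintype.prod_sum_type, Fin.prod_univ_two]
    rfl
  rw [Webs.curvatureAt_iff (by omega) (by simp [add_comm]) hαh hαi hαW,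
    sum_triples_sum_type (tripleCurv α p) (tripleCurv_rotate hαh hαi) (tripleCurv_swap hαh hαi)
      tripleCurv_self]
  -- The logarithmic derivative of the discriminant `U f^m`; only its second summand has a pole
  -- along the curve.
  set l : OneForm := (dlog U).add (smul (fun q => m / f q) (ext f)) with hl
  have hlf : (smul (fun q => m / f q) (ext f)).Holo p :=
    Holo.smul (analyticAt_const.div anf hfp) (Holo.ext anf)
  have hlh : l.Holo p := (Holo_dlog anU hU).add hlf
  have anpow : ∀ q, AnalyticAt ℂ f q → AnalyticAt ℂ (fun r => f r ^ m) q := fun q h => h.pow m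
  have hpow : ∀ z : ℂ, z ≠ 0 → (m : ℂ) * z ^ (m - 1) = z ^ m * (m / z) := by
    intro z hz
    rcases m with _ | m
    · simp
    · rw [Nat.add_sub_cancel, pow_succ]; field_simp
  have hlX : ∀ᶠ q in 𝓝 p, dX (quadDisc A B C) q = quadDisc A B C q * l.a q := by
    filter_upwards [hΔ.eventually_nhds, anU.eventually_analyticAt, anf.eventually_analyticAt,
      anU.continuousAt.eventually_ne hU, anf.continuousAt.eventually_ne hfp] with q q1 q2 q3 q4 q5
    rw [dX_congr q1, q1.self_of_nhds, dX_mul q2 (anpow q q3), dX_pow q3, hpow _ q5]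
    simp only [hl, dlog, OneForm.add, smul, Pi.mul_apply, OneForm.ext]
    field_simp
  have hlY : ∀ᶠ q in 𝓝 p, dY (quadDisc A B C) q = quadDisc A B C q * l.b q := by
    filter_upwards [hΔ.eventually_nhds, anU.eventually_analyticAt, anf.eventually_analyticAt,
      anU.continuousAt.eventually_ne hU, anf.continuousAt.eventually_ne hfp] with q q1 q2 q3 q4 q5
    rw [dY_congr q1, q1.self_of_nhds, dY_mul q2 (anpow q q3), dY_pow q3, hpow _ q5]
    simp only [hl, dlog, OneForm.add, smul, Pi.mul_apply, OneForm.ext]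
    field_simp
  have t1 : ∀ i, tripleCurv α p (.inl 0) (.inl 1) (.inr i) =
      (quadConn A B C (dlog U) (γ i)).d p + (smul (fun q =>
        (smul (fun q => m / f q) (ext f)).wedge (polar A B C (γ i)) q /
          (4 * contr A B C (γ i) q)) (γ i)).d p := by
    intro i
    rw [tripleCurv, if_pos (by simp), ← quadConn_d_add anA anB anC (hγ i) (Holo_dlog anU hU) hlf
      (hN i)]
    exact eta_d_eq_quadConn anA anB anC hb₀ hb₁ (hγ i) hlh h01 (hb i).1 (hb i).2 hQ hlX hlY
  have t2 : ∀ i j, tripleCurv α p (.inl 0) (.inr i) (.inr j) +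
      tripleCurv α p (.inl 1) (.inr i) (.inr j) =
      if i ≠ j then (quadPairConn A B C (γ i) (γ j)).d p else 0 := by
    intro i j
    by_cases hij : i = j
    · simp [tripleCurv, hij]
    · rw [tripleCurv, tripleCurv, if_pos (by simp [hij]), if_pos (by simp [hij]), if_pos hij]
      exact eta_d_add_eq_quadPairConn hb₀ hb₁ (hγ i) (hγ j) (hγγ i j hij) (hb i).1 (hb i).2
        (hb j).1 (hb j).2 hQ
  have t3 : ∀ i j l, tripleCurv α p (.inr i) (.inr j) (.inr l) = tripleCurv γ p i j l := by
    intro i j l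
    simp [tripleCurv, hα]
  -- In `m / 4`, the `m` is the multiplicity of the curve in the discriminant and the 4 comes from
  -- `quadConn_d_add`.
  have t4 : ∑ i, (smul (fun q => (smul (fun q => m / f q) (ext f)).wedge (polar A B C (γ i)) q /
          (4 * contr A B C (γ i) q)) (γ i)).d p =
      (smul (fun q => m / 4 / f q) (residueForm A B C f γ)).d p := by
    rw [← OneForm.d_sum]
    · apply d_congr
      · filter_upwards with q
        simp only [OneForm.sum, smul, Pi.mul_apply, residueForm, Finset.mul_sum]
        refine Finset.sum_congr rfl fun i _ => ?_
        simp only [OneForm.wedge, Pi.mul_apply]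
        ring
      · filter_upwards with q
        simp only [OneForm.sum, smul, Pi.mul_apply, residueForm, Finset.mul_sum]
        refine Finset.sum_congr rfl fun i _ => ?_
        simp only [OneForm.wedge, Pi.mul_apply]
        ring
    · intro i
      exact (hγ i).smul ((hlf.wedge (Holo_polar anA anB anC (hγ i))).div
        (analyticAt_const.mul (analyticAt_contr anA anB anC (hγ i)))
        (mul_ne_zero (by norm_num) (hN i)))
  simp_rw [t1, t2, t3, Finset.sum_add_distrib]
  rw [t4]
  have h6 : (6 : ℂ) ≠ 0 := by norm_num
  -- The weights 6, 3, 1 of the three kinds of triples, divided by 6, are the 1, 1/2, 1/6 of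
  -- `regularPart`.
  simp only [regularPart]
  constructor
  · intro h
    apply mul_left_cancel₀ h6
    rw [h]; ring
  · intro h
    rw [h]; ring

end Formula

/-! ### When the polar part extends across the curve -/

section Residue

variable {k m : ℕ} {A B C f U : Fn} {γ : Fin k → OneForm}

theorem d_smul_div {Θ : OneForm} {p : ℂ × ℂ} (hΘ : Θ.Holo p) (hf : AnalyticAt ℂ f p)
    (h : f p ≠ 0) (c : ℂ) : (smul (fun q => c / f q) Θ).d p =
      c * (f p * Θ.d p - (ext f).wedge Θ p) / f p ^ 2 := by
  rw [d_smul (g := fun q => c / f q) (analyticAt_const.div hf h) hΘ, dX_div analyticAt_const hf h,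
    dY_div analyticAt_const hf h, dX_const, dY_const]
  simp only [OneForm.wedge, OneForm.ext]
  field_simp
  ring

/-- If the polar part is holomorphic, then the residue form vanishes on the curve. -/
theorem wedge_eq_zero_of_holomorphic (hf : IsSmoothCurve f) {Θ : OneForm} (hΘ : Θ.Holo 0) {c : ℂ}
    (hc : c ≠ 0) {g : Fn} (hg : AnalyticAt ℂ g 0)
    (h : ∀ᶠ p in 𝓝 (0 : ℂ × ℂ), f p ≠ 0 → g p = (smul (fun q => c / f q) Θ).d p) :
    ∀ᶠ p in 𝓝 (0 : ℂ × ℂ), f p = 0 → (ext f).wedge Θ p = 0 := by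
  have key : ∀ᶠ p in 𝓝 (0 : ℂ × ℂ), f p ≠ 0 →
      g p * f p ^ 2 = c * (f p * Θ.d p - (ext f).wedge Θ p) := by
    filter_upwards [h, hΘ.eventually, hf.analytic.eventually_analyticAt] with p h1 h2 h3 h4
    rw [h1 h4, d_smul_div h2 h3 h4, div_mul_cancel₀ _ (pow_ne_zero 2 h4)]
  filter_upwards [key.eventually_nhds, hf.eventually_frequently, hΘ.eventually,
    hf.analytic.eventually_analyticAt, hg.eventually_analyticAt] with p h1 h2 h3 h4 h5 h6
  have hcont : ContinuousAt (fun q => g q * f q ^ 2 - c * (f q * Θ.d q - (ext f).wedge Θ q)) p :=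
    (h5.continuousAt.mul (h4.continuousAt.pow 2)).sub (continuousAt_const.mul
      ((h4.continuousAt.mul h3.d.continuousAt).sub ((Holo.ext h4).wedge h3).continuousAt))
  -- The identity `g f² = c (f dΘ - df ∧ Θ)` extends to the curve by continuity, since the
  -- complement is dense; setting `f = 0` there leaves `df ∧ Θ = 0`.
  have hz : (fun q => g q * f q ^ 2 - c * (f q * Θ.d q - (ext f).wedge Θ q)) p = 0 := by
    by_contra hne
    have := hcont.eventually_ne hne
    obtain ⟨q, hq1, hq2, hq3⟩ := (h2.and_eventually (this.and h1)).exists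
    exact hq2 (sub_eq_zero.mpr (hq3 hq1))
  simpa [h6, hc] using hz

/-- If the residue form is a constant multiple of `df` on the curve, then the polar part is
holomorphic. -/
theorem holomorphic_of_residue (hf : IsSmoothCurve f) {Θ : OneForm} (hΘ : Θ.Holo 0) (c e : ℂ)
    (h : ∀ᶠ p in 𝓝 (0 : ℂ × ℂ), f p = 0 → Θ.a p = e * dX f p ∧ Θ.b p = e * dY f p) :
    ∃ g : Fn, AnalyticAt ℂ g 0 ∧
      ∀ᶠ p in 𝓝 (0 : ℂ × ℂ), f p ≠ 0 → g p = (smul (fun q => c / f q) Θ).d p := by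
  -- Division by `f` gives `Θ = e df + f Q`, hence `Θ / f = Q + e df/f`, and the second term is
  -- closed.
  obtain ⟨Q₁, h1, e1⟩ := hf.exists_eq_mul (g := fun p => Θ.a p - e * dX f p)
    (hΘ.1.sub (analyticAt_const.mul (analyticAt_dX hf.analytic)))
    (h.mono fun p hp hfp => sub_eq_zero.mpr (hp hfp).1)
  obtain ⟨Q₂, h2, e2⟩ := hf.exists_eq_mul (g := fun p => Θ.b p - e * dY f p)
    (hΘ.2.sub (analyticAt_const.mul (analyticAt_dY hf.analytic)))
    (h.mono fun p hp hfp => sub_eq_zero.mpr (hp hfp).2)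
  set Q : OneForm := ⟨Q₁, Q₂⟩
  have hQ : Q.Holo 0 := ⟨h1, h2⟩
  refine ⟨fun p => c * Q.d p, analyticAt_const.mul hQ.d, ?_⟩
  filter_upwards [e1.eventually_nhds, e2.eventually_nhds, hQ.eventually,
    hf.analytic.eventually_analyticAt]
    with p p1 p2 p3 p4 p6
  have hlog : (dlog f).d p = 0 := by
    rw [← dlog_closed p4 p6]
    simp only [OneForm.d, dlog, smul, OneForm.ext]
    congr 1
    · apply dX_congr; filter_upwards with q; simp [div_eq_mul_inv, mul_comm]
    · apply dY_congr; filter_upwards with q; simp [div_eq_mul_inv, mul_comm]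
  have hne := p4.continuousAt.eventually_ne p6
  have : (smul (fun q => c / f q) Θ).d p =
      ((smul (fun _ => c) Q).add (smul (fun _ => c * e) (dlog f))).d p := by
    apply d_congr
    · filter_upwards [p1, hne] with q hq hq0
      simp only [smul, Pi.mul_apply, OneForm.add, dlog, OneForm.ext, Q]
      field_simp
      linear_combination c * hq
    · filter_upwards [p2, hne] with q hq hq0
      simp only [smul, Pi.mul_apply, OneForm.add, dlog, OneForm.ext, Q]
      field_simp
      linear_combination c * hq
  rw [this, d_add (p3.smul analyticAt_const) ((Holo_dlog p4 p6).smul analyticAt_const),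
    d_smul analyticAt_const p3, d_smul analyticAt_const (Holo_dlog p4 p6), hlog, dX_const,
    dY_const, dX_const, dY_const]
  ring

end Residue

/-! ### A linear equation for the barycenter -/

section Barycenter

/-- The two products have the same multiset of roots. So the coordinates `t` allowed by
`barycenterLine` have a determined sum, whichever factorization is used. -/
theorem sum_roots_eq {k : ℕ} {x y t : Fin k → ℂ} {a : ℂ} (hy : ∀ i, y i ≠ 0)
    (h : ∀ z : ℂ, ∏ i, (x i + z * y i) = a * ∏ i, (z - t i)) :
    ∑ i, t i = -∑ i, x i / y i := by
  have hP : Polynomial.C (∏ i, y i) * ∏ i, (Polynomial.X - Polynomial.C (-(x i / y i))) =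
      Polynomial.C a * ∏ i, (Polynomial.X - Polynomial.C (t i)) := by
    apply Polynomial.funext
    intro z
    simp only [Polynomial.eval_mul, Polynomial.eval_C, Polynomial.eval_prod, Polynomial.eval_sub,
      Polynomial.eval_X]
    rw [← h z, ← Finset.prod_mul_distrib]
    refine Finset.prod_congr rfl fun i _ => ?_
    have := hy i
    field_simp
    ring
  have hQ : ∏ i, y i ≠ 0 := Finset.prod_ne_zero_iff.mpr fun i _ => hy i
  have hroots : ∀ s : Fin k → ℂ,
      (∏ i, (Polynomial.X - Polynomial.C (s i))).roots = Finset.univ.val.map s := by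
    intro s
    have := Polynomial.roots_multiset_prod_X_sub_C (Finset.univ.val.map s)
    rwa [Multiset.map_map] at this
  have hne : ∀ s : Fin k → ℂ, (∏ i, (Polynomial.X - Polynomial.C (s i))) ≠ 0 := fun s =>
    Finset.prod_ne_zero_iff.mpr fun i _ => Polynomial.X_sub_C_ne_zero _
  have ha : a ≠ 0 := by
    rintro rfl
    rw [Polynomial.C_0, zero_mul] at hP
    exact mul_ne_zero (Polynomial.C_ne_zero.mpr hQ) (hne _) hP
  have hR := congrArg (fun P : Polynomial ℂ => P.roots.sum) hP
  simp only [Polynomial.roots_C_mul _ hQ, Polynomial.roots_C_mul _ ha, hroots] at hR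
  rw [← Finset.sum_neg_distrib]
  exact hR.symm

/-- The value of a linear form on a vector. -/
def pairing (g v : ℂ × ℂ) : ℂ := g.1 * v.1 + g.2 * v.2

/-- On `e + s v`, the sum of the quotients `gᵢ(w)/gᵢ(v)` equals `k s - ∑ tᵢ`, since the root of `gᵢ`
is `tᵢ = -gᵢ(e)/gᵢ(v)`. It vanishes exactly at the mean, and being linear in `w` it is free of the
choice of `e`. -/
theorem mem_barycenterLine_iff {k : ℕ} (hk : 1 ≤ k) {g : Fin k → ℂ × ℂ} {v w : ℂ × ℂ} (hv : v ≠ 0)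
    (hg : ∀ i, pairing (g i) v ≠ 0) :
    w ∈ barycenterLine k (∏ i, lin (g i)) v ↔ ∑ i, pairing (g i) w / pairing (g i) v = 0 := by
  have hk0 : (k : ℂ) ≠ 0 := by exact_mod_cast (by omega : k ≠ 0)
  have hev : ∀ x : ℂ × ℂ, ev (∏ i, lin (g i)) x = ∏ i, pairing (g i) x := fun x => by
    simp only [ev_prod, ev_lin, pairing]
  have hadd : ∀ (i : Fin k) (e : ℂ × ℂ) (z : ℂ),
      pairing (g i) (e + z • v) = pairing (g i) e + z * pairing (g i) v := by
    intro i e z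
    simp only [pairing, Prod.fst_add, Prod.snd_add, Prod.smul_fst, Prod.smul_snd, smul_eq_mul]
    ring
  have hsum : ∀ (e : ℂ × ℂ) (c s : ℂ), ∑ i, pairing (g i) (c • (e + s • v)) / pairing (g i) v =
      c * (∑ i, pairing (g i) e / pairing (g i) v + k * s) := by
    intro e c s
    have : ∀ i, pairing (g i) (c • (e + s • v)) / pairing (g i) v =
        c * (pairing (g i) e / pairing (g i) v + s) := by
      intro i
      have h1 : pairing (g i) (c • (e + s • v)) = c * pairing (g i) (e + s • v) := by
        simp only [pairing, Prod.smul_fst, Prod.smul_snd, smul_eq_mul]; ring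
      rw [h1, hadd, mul_div_assoc, add_div, mul_div_cancel_right₀ _ (hg i)]
    simp only [this, ← Finset.mul_sum, Finset.sum_add_distrib, Finset.sum_const, Finset.card_univ,
      Fintype.card_fin, nsmul_eq_mul]
  have hne : ev (∏ i, lin (g i)) v ≠ 0 := by
    rw [hev]; exact Finset.prod_ne_zero_iff.mpr fun i _ => hg i
  simp only [barycenterLine, Set.mem_ofPred_eq, hne, false_and, false_or, ne_eq, not_false_eq_true,
    true_and]
  constructor
  · rintro ⟨e, a, t, -, ht, c, rfl⟩
    have h := sum_roots_eq (x := fun i => pairing (g i) e) (y := fun i => pairing (g i) v) (t := t)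
      (a := a) hg fun z => by rw [← ht z, hev]; simp only [hadd]
    rw [hsum, h]
    field_simp
    ring
  · intro h
    obtain ⟨e, he⟩ : ∃ e : ℂ × ℂ, v.1 * e.2 - v.2 * e.1 ≠ 0 := by
      by_cases h1 : v.1 = 0
      · have h2 : v.2 ≠ 0 := fun h2 => hv (Prod.ext h1 h2)
        exact ⟨(1, 0), by simpa using h2⟩
      · exact ⟨(0, 1), by simpa using h1⟩
    set D := v.1 * e.2 - v.2 * e.1 with hD
    set S := ∑ i, pairing (g i) e / pairing (g i) v with hS
    set x := (v.1 * w.2 - v.2 * w.1) / D with hx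
    set y := (w.1 * e.2 - w.2 * e.1) / D with hy
    -- Coordinates of `w` in the basis `e, v` by Cramer's rule; the equation then says that `y / x`
    -- is the mean, with `w = 0` when `x = 0`.
    have hw : w = x • e + y • v := by
      ext
      · simp only [hx, hy, Prod.fst_add, Prod.smul_fst, smul_eq_mul]
        field_simp
        rw [hD]; ring
      · simp only [hx, hy, Prod.snd_add, Prod.smul_snd, smul_eq_mul]
        field_simp
        rw [hD]; ring
    have hxy : x * S + y * k = 0 := by
      have : ∀ i, pairing (g i) w / pairing (g i) v =
          x * (pairing (g i) e / pairing (g i) v) + y := by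
        intro i
        have h1 : pairing (g i) w = x * pairing (g i) e + y * pairing (g i) v := by
          rw [hw]
          simp only [pairing, Prod.fst_add, Prod.snd_add, Prod.smul_fst, Prod.smul_snd,
            smul_eq_mul]
          ring
        rw [h1, add_div, mul_div_cancel_right₀ _ (hg i), mul_div_assoc]
      rw [← h]
      simp only [this, Finset.sum_add_distrib, ← Finset.mul_sum, Finset.sum_const,
        Finset.card_univ, Fintype.card_fin, nsmul_eq_mul]
      ring
    refine ⟨e, ∏ i, pairing (g i) v, fun i => -(pairing (g i) e / pairing (g i) v), he, ?_, x, ?_⟩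
    · intro z
      rw [hev, ← Finset.prod_mul_distrib]
      refine Finset.prod_congr rfl fun i _ => ?_
      have := hg i
      rw [hadd]
      field_simp
      ring
    · have hy' : y = x * ((-S) / k) := by
        field_simp
        linear_combination hxy
      rw [Finset.sum_neg_distrib, ← hS, smul_add, smul_smul, ← hy']
      exact hw

end Barycenter

/-! ### Linear algebra at a point of the curve -/

section Pointwise

theorem exists_sq_of_quadDisc_eq_zero {A B C : ℂ} (h : B ^ 2 - 4 * (A * C) = 0) :
    ∃ l : ℂ × ℂ, A = l.1 ^ 2 ∧ B = 2 * (l.1 * l.2) ∧ C = l.2 ^ 2 := by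
  by_cases hA : A = 0
  · have hB : B = 0 := by simpa [hA] using h
    obtain ⟨c, hc⟩ := IsAlgClosed.exists_pow_nat_eq C (n := 2) (by norm_num)
    exact ⟨(0, c), by simp [hA], by simp [hB], hc.symm⟩
  · obtain ⟨a, ha⟩ := IsAlgClosed.exists_pow_nat_eq A (n := 2) (by norm_num)
    have ha0 : a ≠ 0 := by rintro rfl; exact hA (by rw [← ha]; simp)
    refine ⟨(a, B / (2 * a)), ha.symm, by field_simp, ?_⟩
    simp only
    field_simp
    rw [ha]
    linear_combination -h

theorem pairing_ker (g F : ℂ × ℂ) : pairing g (F.2, -F.1) = det2 g F := by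
  simp only [pairing, det2]; ring

theorem exists_smul_ker {F v : ℂ × ℂ} (hF : F ≠ 0) (h : pairing F v = 0) :
    ∃ c : ℂ, v = c • ((F.2, -F.1) : ℂ × ℂ) := by
  apply exists_smul_of_det2_eq_zero
  · intro h0
    simp only [Prod.mk_eq_zero, neg_eq_zero] at h0
    exact hF (Prod.ext h0.2 h0.1)
  · simp only [pairing, det2] at h ⊢
    linear_combination -h

theorem forall_ker_iff_det2 {F l : ℂ × ℂ} (hF : F ≠ 0) :
    (∀ v, pairing F v = 0 → pairing l v = 0) ↔ det2 F l = 0 := by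
  constructor
  · intro h
    have := h (F.2, -F.1) (by simp only [pairing]; ring)
    rw [pairing_ker, det2_neg] at this
    simpa using this
  · intro h v hv
    obtain ⟨c, rfl⟩ := exists_smul_ker hF hv
    simp only [pairing, det2, Prod.smul_fst, Prod.smul_snd, smul_eq_mul] at *
    linear_combination -c * h

/-- Both kernels are lines, spanned by `(F.2, -F.1)` and `(l.2, -l.1)`. Rescaling either vector
multiplies the sum in `mem_barycenterLine_iff` by a constant. -/
theorem forall_ker_iff_barycenter {k : ℕ} (hk : 1 ≤ k) {F l : ℂ × ℂ} {g : Fin k → ℂ × ℂ}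
    (hF : F ≠ 0) (hl : ∀ i, det2 l (g i) ≠ 0) :
    (∀ w, pairing F w = 0 → ∃ v : ℂ × ℂ, v ≠ 0 ∧ pairing l v = 0 ∧
      w ∈ barycenterLine k (∏ i, lin (g i)) v) ↔ ∑ i, det2 F (g i) / det2 l (g i) = 0 := by
  have hl0 : l ≠ 0 := by
    rintro rfl
    exact hl ⟨0, hk⟩ (by simp [det2])
  have main : ∀ c : ℂ, c ≠ 0 → ∀ d : ℂ, (d • ((F.2, -F.1) : ℂ × ℂ) ∈
      barycenterLine k (∏ i, lin (g i)) (c • ((l.2, -l.1) : ℂ × ℂ)) ↔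
        d * ∑ i, det2 F (g i) / det2 l (g i) = 0) := by
    intro c hc d
    have hsm : ∀ i (c : ℂ) (l : ℂ × ℂ), pairing (g i) (c • ((l.2, -l.1) : ℂ × ℂ)) =
        -(c * det2 l (g i)) := by
      intro i c l
      simp only [pairing, det2, Prod.smul_fst, Prod.smul_snd, smul_eq_mul]; ring
    rw [mem_barycenterLine_iff hk]
    · have : ∀ i, pairing (g i) (d • ((F.2, -F.1) : ℂ × ℂ)) /
          pairing (g i) (c • ((l.2, -l.1) : ℂ × ℂ)) = d / c * (det2 F (g i) / det2 l (g i)) := by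
        intro i
        rw [hsm, hsm, neg_div_neg_eq, mul_div_mul_comm]
      simp only [this, ← Finset.mul_sum]
      rw [div_mul_eq_mul_div, div_eq_zero_iff]
      simp [hc]
    · rw [smul_ne_zero_iff]
      refine ⟨hc, fun h => hl0 ?_⟩
      simp only [Prod.mk_eq_zero, neg_eq_zero] at h
      exact Prod.ext h.2 h.1
    · intro i
      rw [hsm]
      exact neg_ne_zero.mpr (mul_ne_zero hc (hl i))
  constructor
  · intro h
    obtain ⟨v, hv0, hv, hw⟩ := h (F.2, -F.1) (by simp only [pairing]; ring)
    obtain ⟨c, rfl⟩ := exists_smul_ker hl0 hv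
    have := (main c (smul_ne_zero_iff.mp hv0).1 1).mp (by simpa using hw)
    simpa using this
  · intro h w hw
    obtain ⟨d, rfl⟩ := exists_smul_ker hF hw
    refine ⟨(1 : ℂ) • ((l.2, -l.1) : ℂ × ℂ), ?_, ?_, (main 1 one_ne_zero d).mpr (by rw [h, mul_zero])⟩
    · rw [one_smul]
      intro h
      simp only [Prod.mk_eq_zero, neg_eq_zero] at h
      exact hl0 (Prod.ext h.2 h.1)
    · simp only [pairing, one_smul]; ring

/-- The residue at a point where the two tangent lines of `𝒲₂` coincide. -/
theorem residue_eq_of_sum_eq_zero {k : ℕ} {F l : ℂ × ℂ} {g : Fin k → ℂ × ℂ}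
    (hl : ∀ i, det2 l (g i) ≠ 0)
    (h : ∑ i, det2 F (g i) / det2 l (g i) = 0) :
    (∑ i, 2 * det2 F l / det2 l (g i) * (g i).1 = -2 * k * F.1) ∧
      ∑ i, 2 * det2 F l / det2 l (g i) * (g i).2 = -2 * k * F.2 := by
  -- Let `σ = (P, Q) = ∑ (2 / (l ∧ gᵢ)) gᵢ`. Then `F ∧ σ = 0` by hypothesis and `l ∧ σ = 2k`, and
  -- the plane identity `(F ∧ l) σ = (F ∧ σ) l - (l ∧ σ) F` yields `-2k F`.
  set P := ∑ i, 2 / det2 l (g i) * (g i).1 with hP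
  set Q := ∑ i, 2 / det2 l (g i) * (g i).2 with hQ
  have e1 : ∑ i, 2 * det2 F l / det2 l (g i) * (g i).1 = det2 F l * P := by
    rw [hP, Finset.mul_sum]; exact Finset.sum_congr rfl fun i _ => by ring
  have e2 : ∑ i, 2 * det2 F l / det2 l (g i) * (g i).2 = det2 F l * Q := by
    rw [hQ, Finset.mul_sum]; exact Finset.sum_congr rfl fun i _ => by ring
  have h1 : F.1 * Q - F.2 * P = 0 := by
    rw [hP, hQ, Finset.mul_sum, Finset.mul_sum, ← Finset.sum_sub_distrib,
      ← mul_zero (2 : ℂ), ← h, Finset.mul_sum]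
    exact Finset.sum_congr rfl fun i _ => by simp only [det2]; ring
  have h2 : l.1 * Q - l.2 * P = 2 * k := by
    rw [hP, hQ, Finset.mul_sum, Finset.mul_sum, ← Finset.sum_sub_distrib]
    have : ∀ i, l.1 * (2 / det2 l (g i) * (g i).2) - l.2 * (2 / det2 l (g i) * (g i).1) = 2 := by
      intro i
      have h3 : l.1 * (2 / det2 l (g i) * (g i).2) - l.2 * (2 / det2 l (g i) * (g i).1) =
        2 * (det2 l (g i) / det2 l (g i)) := by simp only [det2]; ring
      rw [h3, div_self (hl i), mul_one]
    simp only [this, Finset.sum_const, Finset.card_univ, Fintype.card_fin, nsmul_eq_mul]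
    ring
  rw [e1, e2]
  constructor
  · simp only [det2]; linear_combination (-F.1) * h2 + l.1 * h1
  · simp only [det2]; linear_combination (-F.2) * h2 + l.2 * h1

end Pointwise

/-! ### Invariance of the curve and vanishing of the residue -/

section Invariance

variable {k m : ℕ} {A B C f U : Fn} {γ : Fin k → OneForm}

/-- `l` is a linear form whose square is the quadratic form with coefficients `A`, `B`, `C` at `p`,
transverse to the `γ i`. -/
structure IsDoubleLine (A B C : Fn) (γ : Fin k → OneForm) (p : ℂ × ℂ) (l : ℂ × ℂ) : Prop where
  eqA : A p = l.1 ^ 2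
  eqB : B p = 2 * (l.1 * l.2)
  eqC : C p = l.2 ^ 2
  ne : ∀ i, det2 l ((γ i).vec p) ≠ 0

/-- Since `m ≥ 1`, the discriminant of the quadratic form vanishes on the curve, where the form is
thus a square; transversality to the `γ i` is an open condition. -/
theorem Setting.exists_isDoubleLine (S : Setting k m A B C f U γ) (hm : 1 ≤ m) :
    ∀ᶠ p in 𝓝 (0 : ℂ × ℂ), f p = 0 → ∃ l, IsDoubleLine A B C γ p l := by
  filter_upwards [S.eventually_good] with p hp hfp
  obtain ⟨-, -, -, -, -, -, -, -, hN, hΔ⟩ := hp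
  have h0 := hΔ.self_of_nhds
  rw [hfp, zero_pow (by omega), mul_zero] at h0
  obtain ⟨l, h1, h2, h3⟩ := exists_sq_of_quadDisc_eq_zero h0
  refine ⟨l, h1, h2, h3, fun i hi => hN i ?_⟩
  have : contr A B C (γ i) p = det2 l ((γ i).vec p) ^ 2 := by
    simp only [contr, h1, h2, h3, det2, OneForm.vec]; ring
  rw [this, hi]; simp

variable {p l : ℂ × ℂ}

theorem IsDoubleLine.contr_eq (h : IsDoubleLine A B C γ p l) (i : Fin k) :
    contr A B C (γ i) p = det2 l ((γ i).vec p) ^ 2 := by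
  simp only [contr, h.eqA, h.eqB, h.eqC, det2, OneForm.vec]; ring

theorem IsDoubleLine.polar_eq (h : IsDoubleLine A B C γ p l) (i : Fin k) :
    (polar A B C (γ i)).vec p = (2 * det2 l ((γ i).vec p)) • l := by
  ext
  · simp only [polar, h.eqA, h.eqB, det2, OneForm.vec, Prod.smul_fst, smul_eq_mul]; ring
  · simp only [polar, h.eqC, h.eqB, det2, OneForm.vec, Prod.smul_snd, smul_eq_mul]; ring

theorem IsDoubleLine.wedge_polar_div (h : IsDoubleLine A B C γ p l) (α : OneForm) (i : Fin k) :
    α.wedge (polar A B C (γ i)) p / contr A B C (γ i) p =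
      2 * det2 (α.vec p) l / det2 l ((γ i).vec p) := by
  have := h.ne i
  rw [OneForm.wedge_eq_det2, h.polar_eq, h.contr_eq]
  have e : det2 (α.vec p) ((2 * det2 l ((γ i).vec p)) • l) =
      2 * det2 l ((γ i).vec p) * det2 (α.vec p) l := by
    simp only [det2, Prod.smul_fst, Prod.smul_snd, smul_eq_mul]; ring
  rw [e]
  field_simp

theorem IsDoubleLine.residueForm_eq (h : IsDoubleLine A B C γ p l) :
    (residueForm A B C f γ).a p = ∑ i, 2 * det2 ((ext f).vec p) l / det2 l ((γ i).vec p) *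
      ((γ i).vec p).1 ∧
    (residueForm A B C f γ).b p = ∑ i, 2 * det2 ((ext f).vec p) l / det2 l ((γ i).vec p) *
      ((γ i).vec p).2 := by
  constructor
  · simp only [residueForm, OneForm.sum, smul, Pi.mul_apply, h.wedge_polar_div]; rfl
  · simp only [residueForm, OneForm.sum, smul, Pi.mul_apply, h.wedge_polar_div]; rfl

/-- The obstruction to holomorphy factors, and its two factors express the two invariance
conditions. -/
theorem IsDoubleLine.ext_wedge_residueForm (h : IsDoubleLine A B C γ p l) :
    (ext f).wedge (residueForm A B C f γ) p = 2 * det2 ((ext f).vec p) l *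
      ∑ i, det2 ((ext f).vec p) ((γ i).vec p) / det2 l ((γ i).vec p) := by
  rw [OneForm.wedge_def, h.residueForm_eq.1, h.residueForm_eq.2, Finset.mul_sum, Finset.mul_sum, ← Finset.sum_sub_distrib, Finset.mul_sum]
  refine Finset.sum_congr rfl fun i _ => ?_
  simp only [OneForm.vec, det2]
  ring

theorem IsSmoothCurve.eventually_vec_ne (hf : IsSmoothCurve f) :
    ∀ᶠ p in 𝓝 (0 : ℂ × ℂ), (ext f).vec p ≠ 0 := by
  have h : Holo (ext f) 0 := Holo.ext hf.analytic
  have hc : ContinuousAt (fun p => (ext f).vec p) 0 := h.1.continuousAt.prodMk h.2.continuousAt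
  apply hc.eventually_ne
  intro h0
  rcases hf.dX_or_dY with h1 | h1
  · exact h1 (congrArg Prod.snd h0)
  · exact h1 (congrArg Prod.fst h0)

theorem fderiv_eq_pairing (f : Fn) (p v : ℂ × ℂ) : fderiv ℂ f p v = pairing ((ext f).vec p) v := by
  have : v = v.1 • ((1, 0) : ℂ × ℂ) + v.2 • ((0, 1) : ℂ × ℂ) := by ext <;> simp
  conv_lhs => rw [this, map_add, map_smul, map_smul]
  simp only [pairing, OneForm.vec, ext, dX, dY, smul_eq_mul]
  ring

/-- The two invariance conditions in terms of the double tangent line of `𝒲₂` along the curve. -/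
theorem IsDoubleLine.invariant_iff (hk : 1 ≤ k) (h : IsDoubleLine A B C γ p l)
    (hF : (ext f).vec p ≠ 0) {ω₂ ωk : ℂ × ℂ → Form} {u : ℂ} (hu : u ≠ 0)
    (hω₂ : ∀ v : ℂ × ℂ, A p * v.1 ^ 2 + B p * (v.1 * v.2) + C p * v.2 ^ 2 = u * ev (ω₂ p) v)
    (hωk : ωk p = ∏ i, (γ i).toForm p) :
    ((∀ v, fderiv ℂ f p v = 0 → v ∈ tangentLines ω₂ p) ↔ det2 ((ext f).vec p) l = 0) ∧
    ((∀ v, fderiv ℂ f p v = 0 → v ∈ barycenter k ω₂ ωk p) ↔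
      ∑ i, det2 ((ext f).vec p) ((γ i).vec p) / det2 l ((γ i).vec p) = 0) := by
  have hev : ∀ v, v ∈ tangentLines ω₂ p ↔ pairing l v = 0 := by
    intro v
    have h1 : pairing l v ^ 2 = u * ev (ω₂ p) v := by
      rw [← hω₂, h.eqA, h.eqB, h.eqC, pairing]; ring
    rw [tangentLines, Set.mem_ofPred_eq, ← pow_eq_zero_iff (a := pairing l v) two_ne_zero, h1]
    simp [hu]
  simp only [fderiv_eq_pairing]
  constructor
  · rw [← forall_ker_iff_det2 hF]
    simp only [hev]
  · rw [← forall_ker_iff_barycenter hk hF h.ne]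
    simp only [barycenter, Set.mem_ofPred_eq, hev, hωk, OneForm.toForm_eq_lin]

/-- The polar part of the curvature is holomorphic if and only if the curve is invariant by `𝒲₂` or
by the barycenter. -/
theorem Setting.polarPart_holomorphic_iff (S : Setting k m A B C f U γ) (hk : 1 ≤ k) (hm : 1 ≤ m)
    {ω₂ ωk : ℂ × ℂ → Form}
    (hω₂ : ∀ᶠ p in 𝓝 (0 : ℂ × ℂ), ∃ u : ℂ, u ≠ 0 ∧
      ∀ v : ℂ × ℂ, A p * v.1 ^ 2 + B p * (v.1 * v.2) + C p * v.2 ^ 2 = u * ev (ω₂ p) v)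
    (hωk : ∀ᶠ p in 𝓝 (0 : ℂ × ℂ), ωk p = ∏ i, (γ i).toForm p) :
    (∃ g : Fn, AnalyticAt ℂ g 0 ∧ ∀ᶠ p in 𝓝 (0 : ℂ × ℂ), f p ≠ 0 →
      g p = (smul (fun q => (m / 4 : ℂ) / f q) (residueForm A B C f γ)).d p) ↔
    (Invariant f (tangentLines ω₂) ∨ Invariant f (barycenter k ω₂ ωk)) := by
  have hinv : ∀ᶠ p in 𝓝 (0 : ℂ × ℂ), f p = 0 → ∃ l, IsDoubleLine A B C γ p l ∧
      ((∀ v, fderiv ℂ f p v = 0 → v ∈ tangentLines ω₂ p) ↔ det2 ((ext f).vec p) l = 0) ∧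
      ((∀ v, fderiv ℂ f p v = 0 → v ∈ barycenter k ω₂ ωk p) ↔
        ∑ i, det2 ((ext f).vec p) ((γ i).vec p) / det2 l ((γ i).vec p) = 0) := by
    filter_upwards [S.exists_isDoubleLine hm, S.curve.eventually_vec_ne, hω₂, hωk]
      with p h1 h2 h3 h4 hfp
    obtain ⟨l, hl⟩ := h1 hfp
    obtain ⟨u, hu, h3⟩ := h3
    exact ⟨l, hl, hl.invariant_iff hk h2 hu h3 h4⟩
  have hc : (m / 4 : ℂ) ≠ 0 := by
    have : (m : ℂ) ≠ 0 := by exact_mod_cast (by omega : m ≠ 0)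
    exact div_ne_zero this (by norm_num)
  constructor
  · rintro ⟨g, hg, h⟩
    have hz := wedge_eq_zero_of_holomorphic S.curve S.holo_residueForm hc hg h
    -- The linear form `l` is a pointwise choice of square root, with no regularity in `p`. It is
    -- replaced by the holomorphic form `τ`, which on the curve is the nonzero multiple `2 (l ∧ γ
    -- i₀) l`; irreducibility then applies to analytic functions.
    set i₀ : Fin k := ⟨0, hk⟩
    set τ := polar A B C (γ i₀) with hτ
    have hτh : τ.Holo 0 := Holo_polar S.anA S.anB S.anC (S.holo i₀)
    have hF : Holo (ext f) 0 := Holo.ext S.curve.analytic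
    have hτγ : ∀ {p l}, IsDoubleLine A B C γ p l → ∀ i, τ.wedge (γ i) p =
        2 * det2 l ((γ i₀).vec p) * det2 l ((γ i).vec p) := by
      intro p l hl i
      rw [OneForm.wedge_eq_det2, hτ, hl.polar_eq]
      simp only [det2, Prod.smul_fst, Prod.smul_snd, smul_eq_mul]; ring
    have hne : ∀ i, τ.wedge (γ i) 0 ≠ 0 := by
      intro i
      obtain ⟨l, hl⟩ := (S.exists_isDoubleLine hm).self_of_nhds S.curve.zero
      rw [hτγ hl]
      exact mul_ne_zero (mul_ne_zero two_ne_zero (hl.ne _)) (hl.ne i)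
    have hsum : ∀ {p l}, IsDoubleLine A B C γ p l →
        ∑ i, (ext f).wedge (γ i) p / τ.wedge (γ i) p = (2 * det2 l ((γ i₀).vec p))⁻¹ *
          ∑ i, det2 ((ext f).vec p) ((γ i).vec p) / det2 l ((γ i).vec p) := by
      intro p l hl
      rw [Finset.mul_sum]
      refine Finset.sum_congr rfl fun i _ => ?_
      rw [hτγ hl, OneForm.wedge_eq_det2]
      have := hl.ne i
      have := hl.ne i₀
      field_simp
    have hmul : ∀ {p l}, IsDoubleLine A B C γ p l → (ext f).wedge τ p =
        2 * det2 l ((γ i₀).vec p) * det2 ((ext f).vec p) l := by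
      intro p l hl
      rw [OneForm.wedge_eq_det2, hτ, hl.polar_eq]
      simp only [det2, Prod.smul_fst, Prod.smul_snd, smul_eq_mul]; ring
    rcases S.curve.eventually_zero_of_mul (g := (ext f).wedge τ)
      (h := fun p => ∑ i, (ext f).wedge (γ i) p / τ.wedge (γ i) p) (hF.wedge hτh)
      (Finset.analyticAt_fun_sum _ fun i _ => (hF.wedge (S.holo i)).div (hτh.wedge (S.holo i))
        (hne i)) (by
        filter_upwards [hinv, hz] with p h1 h2 hfp
        obtain ⟨l, hl, -, -⟩ := h1 hfp
        have h3 := h2 hfp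
        rw [hl.ext_wedge_residueForm] at h3
        have := hl.ne i₀
        rw [hsum hl, hmul hl]
        field_simp
        linear_combination h3 / 2) with h | h
    · left
      filter_upwards [hinv, h] with p h1 h2 hfp
      obtain ⟨l, hl, h3, -⟩ := h1 hfp
      refine h3.mpr ?_
      have h4 := h2 hfp
      rw [hmul hl] at h4
      exact (mul_eq_zero.mp h4).resolve_left (mul_ne_zero two_ne_zero (hl.ne _))
    · right
      filter_upwards [hinv, h] with p h1 h2 hfp
      obtain ⟨l, hl, -, h3⟩ := h1 hfp
      refine h3.mpr ?_
      have h4 := h2 hfp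
      rw [hsum hl] at h4
      exact (mul_eq_zero.mp h4).resolve_left
        (inv_ne_zero (mul_ne_zero two_ne_zero (hl.ne _)))
  · rintro (h | h)
    · apply holomorphic_of_residue S.curve S.holo_residueForm _ 0
      filter_upwards [hinv, h] with p h1 h2 hfp
      obtain ⟨l, hl, h3, -⟩ := h1 hfp
      have h4 := h3.mp (h2 hfp)
      rw [hl.residueForm_eq.1, hl.residueForm_eq.2, h4]
      simp
    · apply holomorphic_of_residue S.curve S.holo_residueForm _ (-2 * k)
      filter_upwards [hinv, h] with p h1 h2 hfp
      obtain ⟨l, hl, -, h3⟩ := h1 hfp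
      rw [hl.residueForm_eq.1, hl.residueForm_eq.2]
      exact residue_eq_of_sum_eq_zero hl.ne (h3.mp (h2 hfp))

end Invariance

/-! ### From the hypotheses on discriminants to the local data -/

section Setup

/-- The discriminant of a binary quadratic form. -/
theorem quadratic_form_eq {F : Form} (hF : F.IsHomogeneous 2) :
    (∀ v : ℂ × ℂ, ev F (1, 0) * v.1 ^ 2 + (ev F (1, 1) - ev F (1, 0) - ev F (0, 1)) * (v.1 * v.2) +
      ev F (0, 1) * v.2 ^ 2 = ev F v) ∧
    disc 2 F = (ev F (1, 1) - ev F (1, 0) - ev F (0, 1)) ^ 2 - 4 * (ev F (1, 0) * ev F (0, 1)) := by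
  obtain ⟨l, rfl⟩ := exists_eq_prod_lin one_le_two hF
  constructor
  · intro v
    simp only [Fin.prod_univ_two, ev_mul, ev_lin]
    ring
  · rw [disc_prod_lin one_le_two (Fintype.card_fin 2)]
    simp [ev_mul, Fin.prod_univ_two, ev_lin, discConst, pairProd, det2]
    ring

/-- Only the finitely many exponents of total degree `n` matter, so one neighbourhood serves all
coefficients. -/
theorem eventually_analyticAt_coeff {n : ℕ} {W : ℂ × ℂ → Form}
    (hom : ∀ᶠ p in 𝓝 (0 : ℂ × ℂ), (W p).IsHomogeneous n)
    (an : ∀ m, AnalyticAt ℂ (fun p => (W p).coeff m) 0) :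
    ∀ᶠ p in 𝓝 (0 : ℂ × ℂ), ∀ m, AnalyticAt ℂ (fun q => (W q).coeff m) p := by
  have h : ∀ᶠ p in 𝓝 (0 : ℂ × ℂ), ∀ m ∈ (Finset.univ : Finset (Fin 2)).finsuppAntidiag n,
      AnalyticAt ℂ (fun q => (W q).coeff m) p := by
    rw [Filter.eventually_all_finset]
    exact fun m _ => (an m).eventually_analyticAt
  filter_upwards [h, hom.eventually_nhds] with p h1 h2 m
  by_cases hm : m ∈ (Finset.univ : Finset (Fin 2)).finsuppAntidiag n
  · exact h1 m hm
  · refine (analyticAt_const (v := (0 : ℂ))).congr ?_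
    filter_upwards [h2] with q hq
    refine (hq.coeff_eq_zero fun hd => hm ?_).symm
    simp only [Finset.mem_finsuppAntidiag, Finset.subset_univ, and_true]
    rw [← hd, Finsupp.degree_eq_sum]

/-- If two webs `𝒲₂`, `𝒲ₖ` have a superposition with the same discriminant as `𝒲₂`, then `𝒲ₖ` has
no discriminant and is transverse to `𝒲₂` at the origin. -/
theorem disc_ne_zero_of_sameDivisor {k : ℕ} (hk : 1 ≤ k) {ω ω₂ ωk : ℂ × ℂ → Form}
    (hω₂ : IsWeb 2 ω₂) (hωk : IsWeb k ωk) (hsup : SameWeb ω (superpose ω₂ ωk))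
    (hdisc : SameDivisor (discFn 2 ω₂) (discFn (k + 2) ω)) :
    disc k (ωk 0) ≠ 0 ∧ Polynomial.resultant (dehom (ωk 0)) (dehom (ω₂ 0)) k 2 ≠ 0 := by
  obtain ⟨u, hu, -, hsup⟩ := hsup
  obtain ⟨t, ht, -, hdisc⟩ := hdisc
  obtain ⟨c, -, hmul⟩ := disc_mul hk one_le_two
  -- By `disc_mul`, the equality of divisors reads `disc 2 (ω₂ p) = Φ p * disc 2 (ω₂ p)`. Cancelling
  -- at points arbitrarily close to the origin gives `Φ 0 = 1`, so no factor of `Φ` vanishes there.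
  set Φ : Fn := fun p => t p * (u p ^ (k + 1) * u p ^ (k + 1)) * c * disc k (ωk p) *
    Polynomial.resultant (dehom (ωk p)) (dehom (ω₂ p)) k 2 ^ 2 with hΦ
  have hcont : ContinuousAt Φ 0 :=
    (((ht.continuousAt.mul ((hu.continuousAt.pow _).mul (hu.continuousAt.pow _))).mul
      continuousAt_const).mul (continuousAt_disc hωk.homogeneous fun m =>
        (hωk.analytic m).continuousAt)).mul
      ((continuousAt_resultant_dehom hωk.homogeneous (fun m => (hωk.analytic m).continuousAt)
        hω₂.homogeneous fun m => (hω₂.analytic m).continuousAt).pow 2)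
  have hone : ∃ᶠ p in 𝓝 (0 : ℂ × ℂ), Φ p = 1 := by
    refine (hω₂.disc_ne_zero.and_eventually (((hsup.and hdisc).and hω₂.homogeneous).and
      hωk.homogeneous)).mono ?_
    rintro p ⟨h1, ⟨⟨h2, h3⟩, h4⟩, h5⟩
    simp only [discFn] at h3
    rw [h2, superpose, mul_comm (ω₂ p), disc_C_mul, hmul _ _ h5 h4] at h3
    apply mul_right_cancel₀ h1
    rw [one_mul]
    conv_rhs => rw [h3]
    simp only [hΦ, show k + 2 - 1 = k + 1 by omega]
    ring
  have h0 : Φ 0 = 1 := by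
    by_contra hne
    exact hone (hcont.eventually_ne hne)
  constructor
  · intro h
    simp [hΦ, h] at h0
  · intro h
    simp [hΦ, h] at h0

theorem toForm_smul (g : Fn) (α : OneForm) (p : ℂ × ℂ) :
    (smul g α).toForm p = MvPolynomial.C (g p) * α.toForm p := by
  simp only [smul, OneForm.toForm, Pi.mul_apply, MvPolynomial.C_mul]; ring

theorem ev_toForm (α : OneForm) (p v : ℂ × ℂ) : ev (α.toForm p) v = α.a p * v.1 + α.b p * v.2 := by
  rw [OneForm.toForm_eq_lin, ev_lin]; rfl

/-- The germs of webs considered admit the local description `Setting`. -/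
theorem exists_setting {k : ℕ} (hk : 1 ≤ k) {ω ω₂ ωk : ℂ × ℂ → Form}
    (hω₂ : IsWeb 2 ω₂) (hωk : IsWeb k ωk) (hsup : SameWeb ω (superpose ω₂ ωk))
    {f : Fn} (hf : IsSmoothCurve f) {m : ℕ}
    (hsmooth : SameDivisor (discFn (k + 2) ω) (fun p => f p ^ m))
    (hdisc : SameDivisor (discFn 2 ω₂) (discFn (k + 2) ω)) :
    ∃ (A B C U : Fn) (γ : Fin k → OneForm), Setting k m A B C f U γ ∧
      (∀ᶠ p in 𝓝 (0 : ℂ × ℂ), ∃ u : ℂ, u ≠ 0 ∧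
        ∀ v : ℂ × ℂ, A p * v.1 ^ 2 + B p * (v.1 * v.2) + C p * v.2 ^ 2 = u * ev (ω₂ p) v) ∧
      (∀ᶠ p in 𝓝 (0 : ℂ × ℂ), ωk p = ∏ i, (γ i).toForm p) ∧
      ∀ᶠ p in 𝓝 (0 : ℂ × ℂ), f p ≠ 0 → ∃ b₀ b₁ : OneForm, b₀.Holo p ∧ b₁.Holo p ∧
        (∀ᶠ q in 𝓝 p, QuadEq A B C b₀ b₁ q) ∧
        ∀ᶠ q in 𝓝 p, ω q = b₀.toForm q * b₁.toForm q * ∏ i, (γ i).toForm q := by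
  obtain ⟨hdk, hR⟩ := disc_ne_zero_of_sameDivisor hk hω₂ hωk hsup hdisc
  obtain ⟨u, hu, hu0, hsup⟩ := hsup
  obtain ⟨s, hs, hs0, hsmooth⟩ := hsmooth
  obtain ⟨t, ht, ht0, hdisc⟩ := hdisc
  -- The discriminant does not suffice: for `k = 1` it is a nonzero constant even on the zero form.
  -- The resultant with `ω₂ 0` does exclude zero.
  have hωk0 : ωk 0 ≠ 0 := by
    intro h0
    apply hR
    obtain ⟨l, hl⟩ := exists_eq_prod_lin one_le_two hω₂.homogeneous.self_of_nhds
    have hz : ωk 0 = ∏ _i : Fin k, lin 0 := by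
      rw [h0]
      exact (Finset.prod_eq_zero (Finset.mem_univ ⟨0, hk⟩) (by simp [lin])).symm
    have := resultant_prod_lin (fun _ : Fin k => (0 : ℂ × ℂ)) l
    rw [Fintype.card_fin, Fintype.card_fin, ← hz, ← hl] at this
    rw [this]
    exact Finset.prod_eq_zero (Finset.mem_univ ⟨0, hk⟩)
      (Finset.prod_eq_zero (Finset.mem_univ 0) (by simp [det2]))
  obtain ⟨γ, hγ, hfac⟩ := exists_local_factorization hk hωk.homogeneous hωk.analytic hdk hωk0
  have anev : ∀ v : ℂ × ℂ, AnalyticAt ℂ (fun p => ev (ω₂ p) v) 0 := fun v =>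
    analyticAt_ev hω₂.homogeneous hω₂.analytic analyticAt_const
  -- The unit relating `ω` to the product is absorbed by `𝒲₂`, whose coefficients are recovered from
  -- values at three vectors.
  set A : Fn := fun p => u p * ev (ω₂ p) (1, 0) with hA
  set B : Fn := fun p => u p * (ev (ω₂ p) (1, 1) - ev (ω₂ p) (1, 0) - ev (ω₂ p) (0, 1)) with hB
  set C : Fn := fun p => u p * ev (ω₂ p) (0, 1) with hC
  have hquad : ∀ᶠ p in 𝓝 (0 : ℂ × ℂ), ∀ v : ℂ × ℂ,
      A p * v.1 ^ 2 + B p * (v.1 * v.2) + C p * v.2 ^ 2 = u p * ev (ω₂ p) v := by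
    filter_upwards [hω₂.homogeneous] with p hp v
    rw [← (quadratic_form_eq hp).1 v]
    simp only [hA, hB, hC]; ring
  -- The discriminant of a quadratic form is quadratic in its coefficients, whence `u²`; the units
  -- `t` and `s` come from the two equalities of divisors.
  have S : Setting k m A B C f (fun p => u p ^ 2 * (t p * s p)) γ := by
    refine ⟨hu.mul (anev _), hu.mul (((anev _).sub (anev _)).sub (anev _)), hu.mul (anev _),
      (hu.pow 2).mul (ht.mul hs), mul_ne_zero (pow_ne_zero 2 hu0) (mul_ne_zero ht0 hs0), hf, hγ,
      ?_, ?_, ?_⟩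
    · have h := hfac.self_of_nhds
      simp only [OneForm.toForm_eq_lin] at h
      rw [h, disc_ne_zero_iff hk (Fintype.card_fin k)] at hdk
      exact hdk
    · intro i
      have h := hfac.self_of_nhds
      simp only [OneForm.toForm_eq_lin] at h
      obtain ⟨l, hl⟩ := exists_eq_prod_lin one_le_two hω₂.homogeneous.self_of_nhds
      have hres := resultant_prod_lin (fun i => (γ i).vec 0) l
      rw [Fintype.card_fin, Fintype.card_fin, ← h, ← hl] at hres
      rw [hres, Finset.prod_ne_zero_iff] at hR
      have hc : contr A B C (γ i) 0 = u 0 * ∏ j, det2 (l j) ((γ i).vec 0) := by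
        rw [← ev_prod_lin_ker, ← hl, ← hquad.self_of_nhds]
        simp only [contr, OneForm.vec]; ring
      rw [hc]
      exact mul_ne_zero hu0 (hR i (Finset.mem_univ i))
    · filter_upwards [hsmooth, hdisc, hω₂.homogeneous] with p h1 h2 h3
      have h4 := (quadratic_form_eq h3).2
      simp only [discFn] at h1 h2
      have h5 : quadDisc A B C p = u p ^ 2 * disc 2 (ω₂ p) := by
        rw [h4]; simp only [quadDisc, hA, hB, hC]; ring
      rw [h5, h2, h1]; ring
  refine ⟨A, B, C, _, γ, S, ?_, hfac, ?_⟩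
  · filter_upwards [hquad, hu.continuousAt.eventually_ne hu0] with p h1 h2
    exact ⟨u p, h2, h1⟩
  · filter_upwards [hω₂.homogeneous.eventually_nhds,
      eventually_analyticAt_coeff hω₂.homogeneous hω₂.analytic, hfac.eventually_nhds,
      hsup.eventually_nhds, S.eventually_good, hu.eventually_analyticAt]
      with p h1 h2 h3 h4 h5 h6 hfp
    obtain ⟨-, -, -, -, hU, -, -, -, -, hΔ⟩ := h5
    have hd4 := (quadratic_form_eq h1.self_of_nhds).2
    have hd : disc 2 (ω₂ p) ≠ 0 := by
      intro h0
      have h7 : quadDisc A B C p = u p ^ 2 * disc 2 (ω₂ p) := by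
        rw [hd4]; simp only [quadDisc, hA, hB, hC]; ring
      rw [h0, mul_zero, hΔ.self_of_nhds] at h7
      exact mul_ne_zero hU (pow_ne_zero m hfp) h7
    have hne : ω₂ p ≠ 0 := by
      intro h0
      apply hd
      rw [hd4, h0]
      simp [ev]
    obtain ⟨b, hb, hbq⟩ := exists_local_factorization one_le_two h1 h2 hd hne
    refine ⟨smul u (b 0), b 1, (hb 0).smul h6, hb 1, ?_, ?_⟩
    · filter_upwards [hbq] with q hq
      have hev : ∀ v : ℂ × ℂ, ev (ω₂ q) v =
          ((b 0).a q * v.1 + (b 0).b q * v.2) * ((b 1).a q * v.1 + (b 1).b q * v.2) := by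
        intro v
        rw [hq, Fin.prod_univ_two, ev_mul, ev_toForm, ev_toForm]
      refine ⟨?_, ?_, ?_⟩
      · simp only [hA, hev, smul, Pi.mul_apply]; ring
      · simp only [hB, hev, smul, Pi.mul_apply]; ring
      · simp only [hC, hev, smul, Pi.mul_apply]; ring
    · filter_upwards [hbq, h3, h4] with q q1 q2 q3
      rw [q3, superpose, q2, q1, Fin.prod_univ_two, toForm_smul]
      ring

end Setup

end

end Webs

/-! ### The theorem -/

theorem theorem1 (k : ℕ) (hk : 1 ≤ k) (ω ω₂ ωk : ℂ × ℂ → Form)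
    (hω : IsWeb (k + 2) ω) (hω₂ : IsWeb 2 ω₂) (hωk : IsWeb k ωk)
    (hsup : SameWeb ω (superpose ω₂ ωk))
    (f : Fn) (hf : IsSmoothCurve f) (m : ℕ) (hm : 1 ≤ m)
    (hsmooth : SameDivisor (discFn (k + 2) ω) (fun p => f p ^ m))
    (hdisc : SameDivisor (discFn 2 ω₂) (discFn (k + 2) ω)) :
    HolomorphicCurvature (k + 2) ω ↔
      (Invariant f (tangentLines ω₂) ∨ Invariant f (barycenter k ω₂ ωk)) := by
  obtain ⟨A, B, C, U, γ, S, hquad, hfac, hW⟩ := exists_setting hk hω₂ hωk hsup hf hsmooth hdisc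
  rw [← S.polarPart_holomorphic_iff hk hm hquad hfac]
  have hreg := S.analyticAt_regularPart
  have hcurv := S.curvatureAt_iff hW
  -- As `m ≥ 1`, the discriminant vanishes exactly on the curve. Adding or subtracting `regularPart`
  -- then exchanges extensions of the curvature with extensions of the polar part.
  have hne : ∀ᶠ p in 𝓝 (0 : ℂ × ℂ), discFn (k + 2) ω p ≠ 0 ↔ f p ≠ 0 := by
    obtain ⟨s, hs, hs0, hsm⟩ := hsmooth
    filter_upwards [hsm, hs.continuousAt.eventually_ne hs0] with p h1 h2
    rw [h1]
    simp [h2, show m ≠ 0 by omega]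
  constructor
  · rintro ⟨g, hg, h⟩
    refine ⟨fun p => g p - regularPart A B C U γ p, hg.sub hreg, ?_⟩
    filter_upwards [h, hne, hcurv] with p h1 h2 h3 hfp
    rw [(h3 hfp (g p)).mp (h1 (h2.mpr hfp))]
    ring
  · rintro ⟨g, hg, h⟩
    refine ⟨fun p => regularPart A B C U γ p + g p, hreg.add hg, ?_⟩
    filter_upwards [h, hne, hcurv] with p h1 h2 h3 hd
    have hfp := h2.mp hd
    rw [h3 hfp, h1 hfp]
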